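/- **Conventions.** A *3CNF formula* is a conjunction of $m$ clauses over $n$ variables, each clause being a disjunction of one, two or three literals; 3CNF-SAT asks whether some truth assignment satisfies a given 3CNF formula. The *Exponential Time Hypothesis* (ETH) states that the infimum of those $c>0$ for which 3CNF-SAT can be solved in time $c^{n}(n+m)^{O(1)}$ is greater than $1$. For a finite simple undirected graph $G=(V,E)$ put $|G|=|V|+|E|$. A *path decomposition* of $G$ is a non-empty sequence $B_1,\dots,B_r\subseteq V$ of bags with $\bigcup_i B_i=V$, such that the two ends of each edge lie together in some bag and such that $v\in B_i\cap B_k$ and $i\le j\le k$ imply $v\in B_j$; its *width* is $\max_i|B_i|-1$. Running times are those of a deterministic sequential machine (polynomially equivalent to multi-tape Turing machines). For an integer $l\ge 3$ consider two decision problems. The input of both is a finite simple undirected graph $G$, an integer $k$, and a path decomposition of $G$; its width is denoted by $p$. Since running times are measured in $p$ and $|G|$ only, one considers only inputs whose size is polynomial in $|G|$, say $0\le k\le |V|$ and $r\le|V|$. * **$C_l$-Vertex Deletion:** can one remove at most $k$ vertices from $G$ so that the remaining vertices induce a graph without cycles of length $l$? * **Girth $>l$ Vertex Deletion:** can one remove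 at most $k$ vertices from $G$ so that the remaining vertices induce a graph without cycles of length at most $l$? **Theorem.** Assume ETH, and let $l\ge 5$. Then neither $C_l$-Vertex Deletion nor Girth $>l$ Vertex Deletion has an algorithm running in time $2^{o(p^2)}\,|G|^{O(1)}$; that is, for neither of the two problems are there an algorithm, a function $f:\mathbb N\to\mathbb R$ with $f(p)=o(p^2)$ as $p\to\infty$, and constants $C,d$ such that the algorithm solves the problem in at most $C\cdot 2^{f(p)}\cdot|G|^{d}$ steps on all inputs. -/

import Mathlib

open scoped Asymptotics

/-! ## Machine model

Structured programs over finitely many stacks of bits.  Every elementary operation (pushing or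
popping one bit, inspecting the top of one stack) costs one step, so that programs and multi-tape
Turing machines simulate each other with constant overhead per step. -/

namespace ETHLower

/-- Programs over stacks of bits. The stacks are indexed by natural numbers, and a program mentions
only finitely many of them. -/
inductive Prog : Type
  /-- do nothing -/
  | skip : Prog
  /-- push the bit `b` on stack `i` -/
  | push (i : ℕ) (b : Bool) : Prog
  /-- remove the top bit of stack `i`, if there is one -/
  | pop (i : ℕ) : Prog
  /-- sequential composition -/
  | seq (p q : Prog) : Prog
  /-- branch on the top of stack `i`: empty stack, top bit `false`, top bit `true` -/
  | branch (i : ℕ) (onEmpty onFalse onTrue : Prog) : Prog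
  /-- repeat `p` as long as stack `i` is not empty -/
  | loop (i : ℕ) (p : Prog) : Prog

/-- The contents of all stacks; the head of a list is the top of the stack. -/
abbrev Store : Type := ℕ → List Bool

/-- `Runs p s s' t`: started on `s`, the program `p` halts after exactly `t` steps with the stacks
in state `s'`. -/
inductive Runs : Prog → Store → Store → ℕ → Prop
  | skip (s : Store) : Runs Prog.skip s s 1
  | push (i : ℕ) (b : Bool) (s : Store) :
      Runs (Prog.push i b) s (Function.update s i (b :: s i)) 1
  | pop (i : ℕ) (s : Store) :
      Runs (Prog.pop i) s (Function.update s i (s i).tail) 1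
  | seq {p q : Prog} {s s₁ s₂ : Store} {t₁ t₂ : ℕ} :
      Runs p s s₁ t₁ → Runs q s₁ s₂ t₂ → Runs (Prog.seq p q) s s₂ (t₁ + t₂)
  | branchEmpty {i : ℕ} {p q r : Prog} {s s' : Store} {t : ℕ} :
      (s i).head? = none → Runs p s s' t → Runs (Prog.branch i p q r) s s' (t + 1)
  | branchFalse {i : ℕ} {p q r : Prog} {s s' : Store} {t : ℕ} :
      (s i).head? = some false → Runs q s s' t → Runs (Prog.branch i p q r) s s' (t + 1)
  | branchTrue {i : ℕ} {p q r : Prog} {s s' : Store} {t : ℕ} :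
      (s i).head? = some true → Runs r s s' t → Runs (Prog.branch i p q r) s s' (t + 1)
  | loopDone {i : ℕ} {p : Prog} {s : Store} :
      s i = [] → Runs (Prog.loop i p) s s 1
  | loopStep {i : ℕ} {p : Prog} {s s₁ s₂ : Store} {t₁ t₂ : ℕ} :
      s i ≠ [] → Runs p s s₁ t₁ → Runs (Prog.loop i p) s₁ s₂ t₂ →
        Runs (Prog.loop i p) s s₂ (t₁ + t₂ + 1)

/-- Programs are deterministic: result and number of steps are determined by the start. -/
theorem Runs.deterministic {p : Prog} {s s₁ s₂ : Store} {t₁ t₂ : ℕ}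
    (h₁ : Runs p s s₁ t₁) (h₂ : Runs p s s₂ t₂) : s₁ = s₂ ∧ t₁ = t₂ := by
  induction h₁ generalizing s₂ t₂ with
  | skip s => cases h₂; exact ⟨rfl, rfl⟩
  | push i b s => cases h₂; exact ⟨rfl, rfl⟩
  | pop i s => cases h₂; exact ⟨rfl, rfl⟩
  | seq _ _ ih₁ ih₂ =>
    cases h₂ with
    | seq a b =>
      obtain ⟨rfl, rfl⟩ := ih₁ a
      obtain ⟨rfl, rfl⟩ := ih₂ b
      exact ⟨rfl, rfl⟩
  | branchEmpty h _ ih | branchFalse h _ ih | branchTrue h _ ih =>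
    cases h₂ with
    | branchEmpty h' a | branchFalse h' a | branchTrue h' a =>
      first
        | (obtain ⟨rfl, rfl⟩ := ih a; exact ⟨rfl, rfl⟩)
        | (rw [h] at h'; simp at h')
  | loopDone h =>
    cases h₂ with
    | loopDone _ => exact ⟨rfl, rfl⟩
    | loopStep h' _ _ => exact absurd h h'
  | loopStep h _ _ ih₁ ih₂ =>
    cases h₂ with
    | loopDone h' => exact absurd h' h
    | loopStep _ a b =>
      obtain ⟨rfl, rfl⟩ := ih₁ a
      obtain ⟨rfl, rfl⟩ := ih₂ b
      exact ⟨rfl, rfl⟩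

/-- At the start the input is on stack `0`, all other stacks are empty. -/
def initial (input : List Bool) : Store := Function.update (fun _ => []) 0 input

/-- On `input`, the program halts within `T` steps, and accepts (i.e. halts with the bit `true` on
top of stack `0`) if and only if `answer` holds. -/
def DecidesWithin (P : Prog) (input : List Bool) (answer : Prop) (T : ℝ) : Prop :=
  ∃ (s : Store) (t : ℕ), Runs P (initial input) s t ∧ (t : ℝ) ≤ T ∧
    ((s 0).head? = some true ↔ answer)

/-! ## Encodings by bit strings -/

/-- A natural number in unary. -/
def encNat (n : ℕ) : List Bool := List.replicate n true ++ [false]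

/-- A list: every entry is announced by the bit `true`, the end of the list by `false`. -/
def encList {α : Type} (enc : α → List Bool) (L : List α) : List Bool :=
  L.flatMap (fun a => true :: enc a) ++ [false]

/-! ## 3CNF-SAT and the Exponential Time Hypothesis -/

/-- Formulas in 3CNF: conjunctions of clauses with one, two or three literals each. A literal
consists of a variable and the truth value that satisfies it. -/
structure CNF3 where
  numVars : ℕ
  clauses : List (List (Fin numVars × Bool))
  clause_length : ∀ c ∈ clauses, 1 ≤ c.length ∧ c.length ≤ 3

/-- Some assignment makes at least one literal true in every clause. -/
def CNF3.Satisfiable (φ : CNF3) : Prop :=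
  ∃ a : Fin φ.numVars → Bool, ∀ c ∈ φ.clauses, ∃ r ∈ c, a r.1 = r.2

/-- The input string of a formula. -/
def CNF3.encode (φ : CNF3) : List Bool :=
  encNat φ.numVars ++
    encList (encList fun r : Fin φ.numVars × Bool => encNat (r.1 : ℕ) ++ [r.2]) φ.clauses

/-- There is an algorithm for 3CNF-SAT running in time `c ^ n * (n + m) ^ O(1)`, where `n` and `m`
are the numbers of variables and clauses. -/
def CNF3SatSolvable (c : ℝ) : Prop :=
  ∃ (P : Prog) (C : ℝ) (d : ℕ), ∀ φ : CNF3,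
    DecidesWithin P φ.encode φ.Satisfiable
      (C * c ^ φ.numVars * ((φ.numVars + φ.clauses.length + 1 : ℕ) : ℝ) ^ d)

/-- The Exponential Time Hypothesis: the infimum of the numbers `c` such that there is a `c ^ n`
algorithm for 3CNF-SAT is greater than `1`. -/
def ETH : Prop :=
  ∃ c₀ : ℝ, 1 < c₀ ∧ c₀ ∈ lowerBounds {c : ℝ | 0 < c ∧ CNF3SatSolvable c}

/-! ## Path decompositions and the two problems -/

/-- `B 0, B 1, …, B (r - 1)` are the bags, in their order along the path, of a path decomposition
of `G`. -/
structure IsPathDecomposition {V : Type} (G : SimpleGraph V) {r : ℕ} (B : Fin r → Finset V) :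
    Prop where
  nonempty : 0 < r
  cover : ∀ v : V, ∃ i, v ∈ B i
  edge : ∀ u v : V, G.Adj u v → ∃ i, u ∈ B i ∧ v ∈ B i
  convex : ∀ (v : V) (i j k : Fin r), i ≤ j → j ≤ k → v ∈ B i → v ∈ B k → v ∈ B j

/-- The width: the size of the largest bag minus one. -/
def width {V : Type} {r : ℕ} (B : Fin r → Finset V) : ℕ :=
  (Finset.univ.sup fun i => (B i).card) - 1

/-- The size `|G| = |V(G)| + |E(G)|` of a graph. -/
noncomputable def graphSize {V : Type} (G : SimpleGraph V) : ℕ :=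
  Nat.card V + Nat.card G.edgeSet

/-- An instance: a graph, an integer `k` and a path decomposition of the graph. The edges are given
by a list in which each edge occurs once (in one of its two orientations), the path decomposition
by the list of its bags. The numbers `k` and of bags are at most the number of vertices, so that
the size of an instance is polynomial in `|G|`. -/
structure Instance where
  numVertices : ℕ
  graph : SimpleGraph (Fin numVertices)
  k : ℕ
  edges : List (Fin numVertices × Fin numVertices)
  edges_nodup : (edges.map fun e => s(e.1, e.2)).Nodup
  mem_edges : ∀ e : Sym2 (Fin numVertices),
    e ∈ (edges.map fun e => s(e.1, e.2)) ↔ e ∈ graph.edgeSet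
  bags : List (List (Fin numVertices))
  bags_nodup : ∀ b ∈ bags, b.Nodup
  pathDecomposition :
    IsPathDecomposition graph fun i : Fin bags.length => (bags.get i).toFinset
  k_le : k ≤ numVertices
  bags_le : bags.length ≤ numVertices

/-- The width `p` of the given path decomposition. -/
def Instance.pathWidth (I : Instance) : ℕ :=
  width fun i : Fin I.bags.length => (I.bags.get i).toFinset

/-- The input string of an instance. -/
def Instance.encode (I : Instance) : List Bool :=
  encNat I.numVertices ++ encNat I.k ++
    encList (fun e : Fin I.numVertices × Fin I.numVertices =>
      encNat (e.1 : ℕ) ++ encNat (e.2 : ℕ)) I.edges ++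
    encList (encList fun v : Fin I.numVertices => encNat (v : ℕ)) I.bags

/-- `C_l`-Vertex Deletion: at most `k` vertices can be removed from `G` so that the remaining ones
induce a graph without cycles of length `l`. -/
def CycleVertexDeletion (l : ℕ) {V : Type} (G : SimpleGraph V) (k : ℕ) : Prop :=
  ∃ X : Finset V, X.card ≤ k ∧
    ∀ (v : {u : V | u ∉ X}) (w : (G.induce {u : V | u ∉ X}).Walk v v), w.IsCycle → w.length ≠ l

/-- Girth `> l` Vertex Deletion: at most `k` vertices can be removed from `G` so that the remaining
ones induce a graph without cycles of length at most `l`. -/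
def GirthVertexDeletion (l : ℕ) {V : Type} (G : SimpleGraph V) (k : ℕ) : Prop :=
  ∃ X : Finset V, X.card ≤ k ∧
    ∀ (v : {u : V | u ∉ X}) (w : (G.induce {u : V | u ∉ X}).Walk v v), w.IsCycle → ¬ w.length ≤ l

/-- The problem `Q` has an algorithm running in time `2 ^ o(p ^ 2) * |G| ^ O(1)`, where `p` is the
width of the given path decomposition. -/
def SolvableInTime (Q : Instance → Prop) : Prop :=
  ∃ (P : Prog) (f : ℕ → ℝ) (C : ℝ) (d : ℕ),
    f =o[Filter.atTop] (fun p : ℕ => (p : ℝ) ^ 2) ∧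
    ∀ I : Instance,
      DecidesWithin P I.encode (Q I)
        (C * (2 : ℝ) ^ f I.pathWidth * (graphSize I.graph : ℝ) ^ d)

end ETHLower

/-!
ETH is applied through a polynomial time reduction from 3CNF-SAT in which the width of the path
decomposition is only `O(√n)`, where `n` is the number of variables. An algorithm with running time
`2 ^ o(p ^ 2) * |G| ^ O(1)` would thus solve 3CNF-SAT in time `2 ^ o(n) * (n + m) ^ O(1)`, that is,
in time `c ^ n * (n + m) ^ O(1)` for every `c > 1` (`not_solvableInTime`).

The variables are placed in a square of side length `S = O(√n)`. A literal is represented by a pair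
of two out of `3 * S` vertices, the hubs: one hub for the row of its variable, and one for the column
together with the sign (`posA`, `posB`). There is a gadget for every variable `v`, with the clause
`v ∨ ¬ v`, and one for every clause. A gadget has three threads, which are paths between the two hubs
of the literals of its clause (`TEdge`); the threads have length `shortLen l` for variables and
`longLen l` for clauses, and `shortLen l + longLen l = l`. The first inner vertices of the three
threads are joined pairwise by an edge and by a path of length `l - 1`. This gives three cycles of
length `l`, and to destroy them at least two vertices of the gadget have to be removed. All bags of
the path decomposition contain the hubs, and each bag one gadget.

Let `M` be the number of gadgets, and `k = 2 * M`. If a set of `k` vertices meets all cycles of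
length `l`, then it contains exactly two vertices of each gadget and no hub, so that a thread of each
gadget is untouched (`Hits.exists_kept`). If untouched threads of a variable and of a clause belong
to the same literal, then they form a cycle of length `l` (`Hits.parallel`). Hence making the
literals of the untouched threads of the variables false yields a satisfying assignment
(`exists_satisfies_of_cycleVertexDeletion`).

Conversely, given a satisfying assignment one keeps a thread of a false literal for every variable
and a thread of a true literal for every clause, and removes the first inner vertices of the other
threads. A remaining cycle consists of whole threads. Since all of them join a row to a column, the
cycle has two threads that are parallel, or at least four threads. Parallel threads do not come from
a variable and a clause, nor from two variables, so they are both long, and two of them have length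
more than `l`; and so have four threads of any kind since `l ≥ 5`
(`Core.lt_card`, `girthVertexDeletion_of_satisfies`). So there are no cycles of length at most `l`,
and one reduction serves both problems, since a set that meets all cycles of length at most `l` meets
in particular those of length `l`.

The reduction is carried out by an explicit stack program. Its running time is bounded by means of
the predicate `Poly`, which is closed under composition, branching and loops with polynomially many
iterations (`exists_reduction`).
-/

namespace ETHLower

open Function (update)

/-! ### Programs with polynomial running time -/

/-- `Poly p R`: whenever `R B s s'` holds, `p` leads from the store `s` to `s'` within a number of
steps that is polynomial in `B`. The parameter `B` is meant to bound the sizes of all data on which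
the number of iterations of a loop depends. -/
def Poly (p : Prog) (R : ℕ → Store → Store → Prop) : Prop :=
  ∃ K j : ℕ, ∀ B s s', R B s s' → ∃ t, Runs p s s' t ∧ t ≤ K * (B + 1) ^ j

/-- `Iter R i m s s'`: the store `s'` is reached from `s` by `m` steps of the relation `R`, each of
them starting with a non-empty stack `i`, and stack `i` is empty at the end. -/
inductive Iter (R : Store → Store → Prop) (i : ℕ) : ℕ → Store → Store → Prop
  | done {s : Store} : s i = [] → Iter R i 0 s s
  | step {m : ℕ} {s s₁ s₂ : Store} : s i ≠ [] → R s s₁ → Iter R i m s₁ s₂ → Iter R i (m + 1) s s₂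

variable {p q r : Prog} {R R' R₀ R₁ R₂ : ℕ → Store → Store → Prop}

theorem Poly.mono (h : Poly p R) (hR : ∀ B s s', R' B s s' → R B s s') : Poly p R' := by
  obtain ⟨K, j, h⟩ := h
  exact ⟨K, j, fun B s s' h' => h B s s' (hR B s s' h')⟩

theorem Poly.skip : Poly Prog.skip fun _ s s' => s' = s :=
  ⟨1, 0, by rintro B s _ rfl; exact ⟨1, .skip _, by simp⟩⟩

theorem Poly.push (i : ℕ) (b : Bool) :
    Poly (Prog.push i b) fun _ s s' => s' = update s i (b :: s i) :=
  ⟨1, 0, by rintro B s _ rfl; exact ⟨1, .push i b s, by simp⟩⟩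

theorem Poly.pop (i : ℕ) : Poly (Prog.pop i) fun _ s s' => s' = update s i (s i).tail :=
  ⟨1, 0, by rintro B s _ rfl; exact ⟨1, .pop i s, by simp⟩⟩

theorem mul_pow_le_mul_pow_max (K B j j' : ℕ) : K * (B + 1) ^ j ≤ K * (B + 1) ^ max j j' :=
  Nat.mul_le_mul_left _ (Nat.pow_le_pow_right (by omega) (le_max_left _ _))

theorem Poly.seq (h : Poly p R) (h' : Poly q R') :
    Poly (Prog.seq p q) fun B s s'' => ∃ s', R B s s' ∧ R' B s' s'' := by
  obtain ⟨K, j, h⟩ := h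
  obtain ⟨K', j', h'⟩ := h'
  refine ⟨K + K', max j j', ?_⟩
  rintro B s s'' ⟨s', h₁, h₂⟩
  obtain ⟨t, ht, hle⟩ := h B s s' h₁
  obtain ⟨t', ht', hle'⟩ := h' B s' s'' h₂
  refine ⟨_, .seq ht ht', ?_⟩
  have a := mul_pow_le_mul_pow_max K B j j'
  have b := mul_pow_le_mul_pow_max K' B j' j
  rw [max_comm] at b
  rw [add_mul]
  omega

theorem Poly.branch (i : ℕ) (h₀ : Poly p R₀) (h₁ : Poly q R₁) (h₂ : Poly r R₂) :
    Poly (Prog.branch i p q r) fun B s s' =>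
      ((s i).head? = none ∧ R₀ B s s') ∨ ((s i).head? = some false ∧ R₁ B s s') ∨
        ((s i).head? = some true ∧ R₂ B s s') := by
  obtain ⟨K₀, j₀, h₀⟩ := h₀
  obtain ⟨K₁, j₁, h₁⟩ := h₁
  obtain ⟨K₂, j₂, h₂⟩ := h₂
  refine ⟨K₀ + K₁ + K₂ + 1, j₀ + j₁ + j₂, ?_⟩
  intro B s s' h
  have hp : ∀ j, j ≤ j₀ + j₁ + j₂ → (B + 1) ^ j ≤ (B + 1) ^ (j₀ + j₁ + j₂) := fun j hj =>
    Nat.pow_le_pow_right (by omega) hj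
  have hone := hp 0 (by omega)
  rcases h with ⟨e, h⟩ | ⟨e, h⟩ | ⟨e, h⟩
  · obtain ⟨t, ht, hle⟩ := h₀ _ _ _ h
    refine ⟨_, .branchEmpty e ht, ?_⟩
    have := hle.trans (Nat.mul_le_mul_left K₀ (hp j₀ (by omega)))
    nlinarith
  · obtain ⟨t, ht, hle⟩ := h₁ _ _ _ h
    refine ⟨_, .branchFalse e ht, ?_⟩
    have := hle.trans (Nat.mul_le_mul_left K₁ (hp j₁ (by omega)))
    nlinarith
  · obtain ⟨t, ht, hle⟩ := h₂ _ _ _ h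
    refine ⟨_, .branchTrue e ht, ?_⟩
    have := hle.trans (Nat.mul_le_mul_left K₂ (hp j₂ (by omega)))
    nlinarith

theorem Poly.loop (i : ℕ) (h : Poly p R) :
    Poly (Prog.loop i p) fun B s s' => ∃ m ≤ B, Iter (R B) i m s s' := by
  obtain ⟨K, j, h⟩ := h
  refine ⟨K + 2, j + 1, ?_⟩
  rintro B s s' ⟨m, hm, hI⟩
  have key : ∃ t, Runs (Prog.loop i p) s s' t ∧ t ≤ m * (K * (B + 1) ^ j + 1) + 1 := by
    clear hm
    induction hI with
    | done e => exact ⟨1, .loopDone e, by omega⟩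
    | step e hR _ ih =>
      obtain ⟨t, ht, hle⟩ := h _ _ _ hR
      obtain ⟨t', ht', hle'⟩ := ih
      refine ⟨_, .loopStep e ht ht', ?_⟩
      nlinarith
  obtain ⟨t, ht, hle⟩ := key
  refine ⟨t, ht, hle.trans ?_⟩
  have h1 : m * (K * (B + 1) ^ j + 1) ≤ B * (K * (B + 1) ^ j + 1) := Nat.mul_le_mul_right _ hm
  have h2 : 1 ≤ (B + 1) ^ j := Nat.one_le_pow _ _ (by omega)
  rw [pow_succ]
  nlinarith

/-- A program pushes at most one bit per step. -/
theorem Runs.length_le {s s' : Store} {t : ℕ} (h : Runs p s s' t) (i : ℕ) :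
    (s' i).length ≤ (s i).length + t := by
  induction h with
  | skip s => omega
  | push j b s =>
    by_cases e : i = j
    · subst e; simp
    · simp [Function.update_of_ne e]
  | pop j s =>
    by_cases e : i = j
    · subst e; simp; omega
    · simp [Function.update_of_ne e]
  | seq _ _ ih₁ ih₂ => omega
  | branchEmpty _ _ ih | branchFalse _ _ ih | branchTrue _ _ ih => omega
  | loopDone _ => omega
  | loopStep _ _ _ ih₁ ih₂ => omega

/-! ### Basic stack programs -/

/-- The contents of a stack that holds the number `x` in unary, without end marker. -/
abbrev unary (x : ℕ) : List Bool := List.replicate x true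

/-- Push the bits of a fixed list, one after another. -/
def pushes (i : ℕ) : List Bool → Prog
  | [] => Prog.skip
  | b :: bs => Prog.seq (Prog.push i b) (pushes i bs)

theorem Poly.pushes (i : ℕ) (bs : List Bool) :
    Poly (pushes i bs) fun _ s s' => s' = update s i (bs.reverse ++ s i) := by
  induction bs with
  | nil => exact Poly.skip.mono (by rintro B s _ rfl; simp)
  | cons b bs ih =>
    refine ((Poly.push i b).seq ih).mono ?_
    rintro B s _ rfl
    exact ⟨_, rfl, by simp⟩

/-- Empty a stack. -/
def clear (i : ℕ) : Prog := Prog.loop i (Prog.pop i)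

theorem Poly.clear (i : ℕ) :
    Poly (clear i) fun B s s' => (s i).length ≤ B ∧ s' = update s i [] := by
  refine (Poly.loop i (Poly.pop i)).mono ?_
  rintro B s _ ⟨hB, rfl⟩
  refine ⟨_, hB, ?_⟩
  generalize e : s i = L
  clear hB
  induction L generalizing s with
  | nil =>
    have : update s i [] = s := by rw [← e]; simp
    rw [this]; exact .done e
  | cons b L ih =>
    refine .step (by simp [e]) rfl ?_
    have := ih (update s i (s i).tail) (by simp [e])
    rwa [Function.update_idem] at this

/-- Move the contents of stack `i` to stack `j`, in reversed order. -/
def transfer (i j : ℕ) : Prog :=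
  Prog.loop i (Prog.branch i Prog.skip (Prog.seq (Prog.pop i) (Prog.push j false))
    (Prog.seq (Prog.pop i) (Prog.push j true)))

theorem Poly.transfer {i j : ℕ} (hij : i ≠ j) :
    Poly (transfer i j) fun B s s' =>
      (s i).length ≤ B ∧ s' = update (update s i []) j ((s i).reverse ++ s j) := by
  refine (Poly.loop i (Poly.branch i Poly.skip ((Poly.pop i).seq (Poly.push j false))
    ((Poly.pop i).seq (Poly.push j true)))).mono ?_
  rintro B s _ ⟨hB, rfl⟩
  refine ⟨_, hB, ?_⟩
  generalize e : s i = L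
  clear hB
  induction L generalizing s with
  | nil =>
    have : update (update s i []) j (([] : List Bool).reverse ++ s j) = s := by
      rw [← e, Function.update_eq_self]; simp [e]
    rw [this]; exact .done e
  | cons b L ih =>
    have := ih (update (update s i (s i).tail) j (b :: s j)) (by simp [e, hij])
    refine .step (s₁ := update (update s i (s i).tail) j (b :: s j)) (by simp [e]) ?_ ?_
    · cases b
      · exact .inr (.inl ⟨by simp [e], _, rfl, by simp [hij.symm]⟩)
      · exact .inr (.inr ⟨by simp [e], _, rfl, by simp [hij.symm]⟩)
    · convert this using 1
      funext k
      by_cases h1 : k = j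
      · subst h1; simp
      · by_cases h2 : k = i
        · subst h2; simp [h1]
        · simp [h1, h2]

/-- Add the unary number on stack `src` to stack `dst`, with the help of an empty stack `tmp`. -/
def addTo (src dst tmp : ℕ) : Prog :=
  Prog.seq (Prog.loop src (Prog.seq (Prog.pop src) (Prog.seq (Prog.push dst true)
    (Prog.push tmp true)))) (Prog.loop tmp (Prog.seq (Prog.pop tmp) (Prog.push src true)))

theorem Poly.addTo {src dst tmp : ℕ} (h₁ : src ≠ dst) (h₂ : src ≠ tmp) (h₃ : dst ≠ tmp) :
    Poly (addTo src dst tmp) fun B s s' => ∃ x ≤ B, s src = unary x ∧ s tmp = [] ∧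
      s' = update s dst (unary x ++ s dst) := by
  refine ((Poly.loop src ((Poly.pop src).seq ((Poly.push dst true).seq (Poly.push tmp true)))).seq
    (Poly.loop tmp ((Poly.pop tmp).seq (Poly.push src true)))).mono ?_
  rintro B s _ ⟨x, hx, hs, ht, rfl⟩
  refine ⟨update (update (update s src []) dst (unary x ++ s dst)) tmp (unary x),
    ⟨x, hx, ?_⟩, x, hx, ?_⟩
  · have key : ∀ x (s : Store), s src = unary x →
        Iter (fun s s' => ∃ s₁, s₁ = update s src (s src).tail ∧
          ∃ s₂, s₂ = update s₁ dst (true :: s₁ dst) ∧ s' = update s₂ tmp (true :: s₂ tmp))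
          src x s
          (update (update (update s src []) dst (unary x ++ s dst)) tmp (unary x ++ s tmp)) := by
      intro x
      induction x with
      | zero =>
        intro s hs
        have : update (update (update s src []) dst (unary 0 ++ s dst)) tmp (unary 0 ++ s tmp)
            = s := by
          have hs : s src = [] := hs
          rw [← hs]; simp
        rw [this]
        exact .done (by simpa using hs)
      | succ x ih =>
        intro s hs
        refine .step (by simp [hs, List.replicate_succ]) ⟨_, rfl, _, rfl, rfl⟩ ?_
        have := ih (update (update (update s src (unary x)) dst (true :: s dst)) tmp
          (true :: s tmp)) (by simp [h₁, h₂])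
        convert this using 1
        · simp [hs, List.replicate_succ, h₁.symm, h₂.symm, h₃.symm]
        · funext k
          by_cases e1 : k = tmp
          · subst e1; simp [List.replicate_succ']
          · by_cases e2 : k = dst
            · subst e2; simp [e1, List.replicate_succ']
            · by_cases e3 : k = src
              · subst e3; simp [e1, e2]
              · simp [e1, e2, e3]
    have := key x s hs
    rwa [ht, List.append_nil] at this
  · have key : ∀ x (s : Store), s tmp = unary x →
        Iter (fun s s' => ∃ s₁, s₁ = update s tmp (s tmp).tail ∧
          s' = update s₁ src (true :: s₁ src)) tmp x s
          (update (update s tmp []) src (unary x ++ s src)) := by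
      intro x
      induction x with
      | zero =>
        intro s hs
        have : update (update s tmp []) src (unary 0 ++ s src) = s := by
          have hs : s tmp = [] := hs
          rw [← hs]; simp
        rw [this]
        exact .done (by simpa using hs)
      | succ x ih =>
        intro s hs
        refine .step (by simp [hs, List.replicate_succ]) ⟨_, rfl, rfl⟩ ?_
        have := ih (update (update s tmp (unary x)) src (true :: s src)) (by simp [h₂.symm])
        convert this using 1
        · simp [hs, List.replicate_succ, h₂]
        · funext k
          by_cases e1 : k = src
          · subst e1; simp [List.replicate_succ']
          · by_cases e2 : k = tmp
            · subst e2; simp [e1]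
            · simp [e1, e2]
    convert key x _ ?_ using 1
    · funext k
      by_cases e1 : k = src
      · subst e1; simp [h₁, h₂, hs]
      · by_cases e2 : k = tmp
        · subst e2; simp [h₃.symm, h₂.symm, ht]
        · simp [e1, e2]
          by_cases e3 : k = dst
          · subst e3; simp
          · simp [e1, e3]
    · simp

/-- Read a number, terminated by `false`, from stack `0`, and execute `step` for every unit. The
stack `fl`, which has to be empty, is used as a flag. -/
def readUnary (fl : ℕ) (step : Prog) : Prog :=
  Prog.seq (Prog.push fl true) (Prog.loop fl (Prog.branch 0 (Prog.pop fl)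
    (Prog.seq (Prog.pop 0) (Prog.pop fl)) (Prog.seq (Prog.pop 0) step)))

theorem Poly.readUnary {fl : ℕ} (hfl : fl ≠ 0) (h : Poly p R) :
    Poly (readUnary fl p) fun B s s' => ∃ x < B, ∃ (Z : ℕ → Store) (rest : List Bool),
      (∀ k ≤ x, Z k 0 = unary (x - k) ++ false :: rest ∧ Z k fl = [true]) ∧
      Z 0 = update s fl (true :: s fl) ∧
      (∀ k < x, R B (update (Z k) 0 (unary (x - (k + 1)) ++ false :: rest)) (Z (k + 1))) ∧
      s' = update (update (Z x) 0 rest) fl [] := by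
  refine ((Poly.push fl true).seq (Poly.loop fl (Poly.branch 0 (Poly.pop fl)
    ((Poly.pop 0).seq (Poly.pop fl)) ((Poly.pop 0).seq h)))).mono ?_
  rintro B s _ ⟨x, hx, Z, rest, hZ, h0, hR, rfl⟩
  refine ⟨_, h0, x + 1, hx, ?_⟩
  have key : ∀ m k, k + m = x →
      Iter (fun s s' => ((s 0).head? = none ∧ s' = update s fl (s fl).tail) ∨
        ((s 0).head? = some false ∧
          ∃ s₁, s₁ = update s 0 (s 0).tail ∧ s' = update s₁ fl (s₁ fl).tail) ∨
        ((s 0).head? = some true ∧ ∃ s₁, s₁ = update s 0 (s 0).tail ∧ R B s₁ s')) fl (m + 1)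
        (Z k) (update (update (Z x) 0 rest) fl []) := by
    intro m
    induction m with
    | zero =>
      rintro k hk
      obtain rfl : k = x := hk
      obtain ⟨a, b⟩ := hZ k le_rfl
      refine .step (by simp [b]) (.inr (.inl ⟨by simp [a], _, rfl, rfl⟩)) ?_
      simp only [a, b, Nat.sub_self, List.replicate_zero, List.nil_append, List.tail_cons,
        Function.update_of_ne hfl]
      exact .done (by simp)
    | succ m ih =>
      rintro k hk
      obtain ⟨a, b⟩ := hZ k (by omega)
      have e : x - k = x - (k + 1) + 1 := by omega
      refine .step (by simp [b]) (.inr (.inr ⟨?_, _, rfl, ?_⟩)) (ih (k + 1) (by omega))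
      · simp [a, e, List.replicate_succ]
      · have := hR k (by omega)
        rw [a, e, show unary (x - (k + 1) + 1) = true :: unary (x - (k + 1)) from
          List.replicate_succ]
        exact this
  exact key x 0 (by omega)

end ETHLower

namespace ETHLower

open Function (update)

/-- Sequential composition. -/
infixr:60 " ;; " => Prog.seq

/-! ### The registers of the reduction -/

/-- The contents of the stacks used by the reduction, in the order of their indices. Input and final
output are on `io`, the flag `fl` controls the reading of numbers, and `tmp` and `r` are auxiliary.
The strings of edges and of bags grow, in reversed order, on `E` and `Bg`. In unary, `s` holds the
side length of the square of variables, `base` the first number that is not used yet for a vertex,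
`k` the number of vertices that may be removed, `H` the number of hubs, `cnt` and `hc` count
variables and hubs, `la` and `lb` are the hubs of the current literal, and `a0` to `b2` those of the
three literals of the current clause. -/
structure Cfg where
  io : List Bool := []
  tmp : List Bool := []
  fl : List Bool := []
  s : List Bool := []
  r : List Bool := []
  E : List Bool := []
  Bg : List Bool := []
  base : List Bool := []
  k : List Bool := []
  H : List Bool := []
  cnt : List Bool := []
  hc : List Bool := []
  la : List Bool := []
  lb : List Bool := []
  a0 : List Bool := []
  a1 : List Bool := []
  a2 : List Bool := []
  b0 : List Bool := []
  b1 : List Bool := []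
  b2 : List Bool := []

/-- The store whose stacks are given by a list; the other stacks are empty. -/
def store (L : List (List Bool)) : Store := fun i => L.getD i []

theorem update_store {L : List (List Bool)} {i : ℕ} (h : i < L.length) (x : List Bool) :
    update (store L) i x = store (L.set i x) := by
  funext k
  by_cases e : k = i
  · subst e; simp [store, h]
  · simp [store, e, Ne.symm e]

/-- The store described by a configuration. -/
def cfg (c : Cfg) : Store :=
  store [c.io, c.tmp, c.fl, c.s, c.r, c.E, c.Bg, c.base, c.k, c.H, c.cnt, c.hc, c.la, c.lb,
    c.a0, c.a1, c.a2, c.b0, c.b1, c.b2]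

section registers
variable (c : Cfg) (x : List Bool)

@[simp] theorem cfg_io : cfg c 0 = c.io := rfl
@[simp] theorem cfg_tmp : cfg c 1 = c.tmp := rfl
@[simp] theorem cfg_fl : cfg c 2 = c.fl := rfl
@[simp] theorem cfg_s : cfg c 3 = c.s := rfl
@[simp] theorem cfg_r : cfg c 4 = c.r := rfl
@[simp] theorem cfg_E : cfg c 5 = c.E := rfl
@[simp] theorem cfg_Bg : cfg c 6 = c.Bg := rfl
@[simp] theorem cfg_base : cfg c 7 = c.base := rfl
@[simp] theorem cfg_k : cfg c 8 = c.k := rfl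
@[simp] theorem cfg_H : cfg c 9 = c.H := rfl
@[simp] theorem cfg_cnt : cfg c 10 = c.cnt := rfl
@[simp] theorem cfg_hc : cfg c 11 = c.hc := rfl
@[simp] theorem cfg_la : cfg c 12 = c.la := rfl
@[simp] theorem cfg_lb : cfg c 13 = c.lb := rfl
@[simp] theorem cfg_a0 : cfg c 14 = c.a0 := rfl
@[simp] theorem cfg_a1 : cfg c 15 = c.a1 := rfl
@[simp] theorem cfg_a2 : cfg c 16 = c.a2 := rfl
@[simp] theorem cfg_b0 : cfg c 17 = c.b0 := rfl
@[simp] theorem cfg_b1 : cfg c 18 = c.b1 := rfl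
@[simp] theorem cfg_b2 : cfg c 19 = c.b2 := rfl
@[simp] theorem upd_io : update (cfg c) 0 x = cfg { c with io := x } := update_store (by simp) x
@[simp] theorem upd_fl : update (cfg c) 2 x = cfg { c with fl := x } := update_store (by simp) x
@[simp] theorem upd_s : update (cfg c) 3 x = cfg { c with s := x } := update_store (by simp) x
@[simp] theorem upd_r : update (cfg c) 4 x = cfg { c with r := x } := update_store (by simp) x
@[simp] theorem upd_E : update (cfg c) 5 x = cfg { c with E := x } := update_store (by simp) x
@[simp] theorem upd_Bg : update (cfg c) 6 x = cfg { c with Bg := x } := update_store (by simp) x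
@[simp] theorem upd_base : update (cfg c) 7 x = cfg { c with base := x } :=
  update_store (by simp) x
@[simp] theorem upd_k : update (cfg c) 8 x = cfg { c with k := x } := update_store (by simp) x
@[simp] theorem upd_H : update (cfg c) 9 x = cfg { c with H := x } := update_store (by simp) x
@[simp] theorem upd_cnt : update (cfg c) 10 x = cfg { c with cnt := x } := update_store (by simp) x
@[simp] theorem upd_hc : update (cfg c) 11 x = cfg { c with hc := x } := update_store (by simp) x
@[simp] theorem upd_la : update (cfg c) 12 x = cfg { c with la := x } := update_store (by simp) x
@[simp] theorem upd_lb : update (cfg c) 13 x = cfg { c with lb := x } := update_store (by simp) x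
@[simp] theorem upd_a0 : update (cfg c) 14 x = cfg { c with a0 := x } := update_store (by simp) x
@[simp] theorem upd_a1 : update (cfg c) 15 x = cfg { c with a1 := x } := update_store (by simp) x
@[simp] theorem upd_a2 : update (cfg c) 16 x = cfg { c with a2 := x } := update_store (by simp) x
@[simp] theorem upd_b0 : update (cfg c) 17 x = cfg { c with b0 := x } := update_store (by simp) x
@[simp] theorem upd_b1 : update (cfg c) 18 x = cfg { c with b1 := x } := update_store (by simp) x
@[simp] theorem upd_b2 : update (cfg c) 19 x = cfg { c with b2 := x } := update_store (by simp) x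

end registers

/-- `Poly` for stores that are given by configurations, so that the effect of a program can be
described by the registers that it changes. -/
def PolyC (p : Prog) (R : ℕ → Cfg → Cfg → Prop) : Prop :=
  Poly p fun B s s' => ∃ c c', s = cfg c ∧ s' = cfg c' ∧ R B c c'

variable {p q r : Prog} {R R' R₀ R₁ R₂ : ℕ → Cfg → Cfg → Prop}

theorem Poly.cfg {R : ℕ → Store → Store → Prop} (h : Poly p R) :
    PolyC p fun B c c' => R B (cfg c) (cfg c') :=
  h.mono (by rintro B _ _ ⟨c, c', rfl, rfl, h⟩; exact h)

theorem PolyC.mono (h : PolyC p R) (hR : ∀ B c c', R' B c c' → R B c c') : PolyC p R' :=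
  Poly.mono h (by rintro B _ _ ⟨c, c', rfl, rfl, h⟩; exact ⟨c, c', rfl, rfl, hR _ _ _ h⟩)

theorem PolyC.skip : PolyC Prog.skip fun _ c c' => c' = c :=
  Poly.skip.cfg.mono (by rintro _ _ _ rfl; rfl)

theorem PolyC.seq (h : PolyC p R) (h' : PolyC q R') :
    PolyC (p ;; q) fun B c c'' => ∃ c', R B c c' ∧ R' B c' c'' :=
  (Poly.seq h h').mono (by
    rintro B _ _ ⟨c, c'', rfl, rfl, c', h₁, h₂⟩
    exact ⟨cfg c', ⟨c, c', rfl, rfl, h₁⟩, c', c'', rfl, rfl, h₂⟩)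

theorem PolyC.branch (i : ℕ) (h₀ : PolyC p R₀) (h₁ : PolyC q R₁) (h₂ : PolyC r R₂) :
    PolyC (Prog.branch i p q r) fun B c c' =>
      ((cfg c i).head? = none ∧ R₀ B c c') ∨ ((cfg c i).head? = some false ∧ R₁ B c c') ∨
        ((cfg c i).head? = some true ∧ R₂ B c c') :=
  (Poly.branch i h₀ h₁ h₂).mono (by
    rintro B _ _ ⟨c, c', rfl, rfl, h⟩
    rcases h with ⟨e, h⟩ | ⟨e, h⟩ | ⟨e, h⟩
    · exact .inl ⟨e, c, c', rfl, rfl, h⟩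
    · exact .inr (.inl ⟨e, c, c', rfl, rfl, h⟩)
    · exact .inr (.inr ⟨e, c, c', rfl, rfl, h⟩))

/-- The analogue of `Iter` for configurations. -/
inductive IterC (R : Cfg → Cfg → Prop) (i : ℕ) : ℕ → Cfg → Cfg → Prop
  | done {c : Cfg} : cfg c i = [] → IterC R i 0 c c
  | step {m : ℕ} {c c₁ c₂ : Cfg} : cfg c i ≠ [] → R c c₁ → IterC R i m c₁ c₂ →
      IterC R i (m + 1) c c₂

theorem PolyC.loop (i : ℕ) (h : PolyC p R) :
    PolyC (Prog.loop i p) fun B c c' => ∃ m ≤ B, IterC (R B) i m c c' :=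
  (Poly.loop i h).mono (by
    rintro B _ _ ⟨c, c', rfl, rfl, m, hm, h⟩
    refine ⟨m, hm, ?_⟩
    clear hm
    induction h with
    | done e => exact .done e
    | step e h _ ih => exact .step e ⟨_, _, rfl, rfl, h⟩ ih)

/-! ### Parsing literals and clauses -/

/-- The index of the first hub of a literal: its row in a square of side length `S`. -/
def posA (S : ℕ) (x : ℕ × Bool) : ℕ := x.1 / S

/-- The index of the second hub of a literal, given by its column and its sign. -/
def posB (S : ℕ) (x : ℕ × Bool) : ℕ := S + 2 * (x.1 % S) + x.2.toNat

theorem succ_div_mod {S v : ℕ} (hS : 0 < S) :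
    (v % S + 1 < S ∧ (v + 1) / S = v / S ∧ (v + 1) % S = v % S + 1) ∨
      (v % S + 1 = S ∧ (v + 1) / S = v / S + 1 ∧ (v + 1) % S = 0) := by
  have h1 := Nat.mod_lt v hS
  have h2 := Nat.div_add_mod v S
  rcases Nat.lt_or_ge (v % S + 1) S with h | h
  · left
    have := (Nat.div_mod_unique (a := v + 1) (d := v / S) (c := v % S + 1) hS).2
      ⟨by omega, h⟩
    exact ⟨h, this.1, this.2⟩
  · right
    have e : v % S + 1 = S := by omega
    have := (Nat.div_mod_unique (a := v + 1) (d := v / S + 1) (c := 0) hS).2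
      ⟨by rw [mul_add]; omega, hS⟩
    exact ⟨e, this.1, this.2⟩

/-- Advance the pair of hubs of a positive literal to the next variable. -/
def locStep : Prog :=
  pushes 13 [true, true] ;; Prog.pop 4 ;;
    Prog.branch 4 (addTo 3 4 1 ;; clear 13 ;; addTo 3 13 1 ;; Prog.push 12 true) Prog.skip Prog.skip

theorem PolyC.locStep : PolyC locStep fun B c c' => ∃ S v, 0 < S ∧ 3 * S ≤ B ∧ c.s = unary S ∧
    c.tmp = [] ∧ c.la = unary (v / S) ∧ c.lb = unary (S + 2 * (v % S)) ∧
    c.r = unary (S - v % S) ∧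
    c' = { c with
      la := unary ((v + 1) / S), lb := unary (S + 2 * ((v + 1) % S)),
      r := unary (S - (v + 1) % S) } := by
  refine ((Poly.pushes 13 [true, true]).cfg.seq ((Poly.pop 4).cfg.seq (PolyC.branch 4
    ((Poly.addTo (by decide) (by decide) (by decide)).cfg.seq ((Poly.clear 13).cfg.seq
      ((Poly.addTo (by decide) (by decide) (by decide)).cfg.seq (Poly.push 12 true).cfg)))
      PolyC.skip PolyC.skip))).mono ?_
  rintro B c _ ⟨S, v, hS, hB, e1, e2, e3, e4, e5, rfl⟩
  have hm := Nat.mod_lt v hS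
  have e6 : true :: true :: unary (S + 2 * (v % S)) = unary (S + 2 * (v % S) + 2) := rfl
  have e7 : (unary (S - v % S)).tail = unary (S - v % S - 1) := by simp
  refine ⟨{ c with lb := unary (S + 2 * (v % S) + 2) }, by simp [e4, e6],
    { c with lb := unary (S + 2 * (v % S) + 2), r := unary (S - v % S - 1) },
      by simp [e5], ?_⟩
  rcases succ_div_mod (v := v) hS with ⟨h1, h2, h3⟩ | ⟨h1, h2, h3⟩
  · right; right
    obtain ⟨y, hy⟩ : ∃ y, S - v % S - 1 = y + 1 := ⟨S - v % S - 2, by omega⟩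
    refine ⟨by simp [hy, List.replicate_succ], ?_⟩
    rw [h2, h3, ← e3, show S - (v % S + 1) = S - v % S - 1 by omega,
      show S + 2 * (v % S + 1) = S + 2 * (v % S) + 2 by ring]
  · left
    have hy : S - v % S - 1 = 0 := by omega
    refine ⟨by simp [hy], { c with lb := unary (S + 2 * (v % S) + 2), r := unary S },
      ⟨S, by omega, by simp [e1], by simp [e2], by simp [hy]⟩,
      { c with lb := [], r := unary S }, ⟨by simp; omega, by simp⟩,
      { c with lb := unary S, r := unary S }, ⟨S, by omega, by simp [e1], by simp [e2], by simp⟩,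
      ?_⟩
    simp [h2, h3, e3, List.replicate_succ]

/-- Read a literal from stack `0` and store the indices of its hubs. -/
def parseLit : Prog :=
  clear 12 ;; clear 13 ;; addTo 3 13 1 ;; addTo 3 4 1 ;; readUnary 2 locStep ;; clear 4 ;;
    Prog.branch 0 Prog.skip (Prog.pop 0) (Prog.pop 0 ;; Prog.push 13 true)

theorem PolyC.parseLit : PolyC parseLit fun B c c' => ∃ S x rest, 0 < S ∧ 3 * S ≤ B ∧ x.1 < B ∧
    c.s = unary S ∧ c.tmp = [] ∧ c.fl = [] ∧ c.r = [] ∧ c.la.length ≤ B ∧ c.lb.length ≤ B ∧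
    c.io = encNat x.1 ++ x.2 :: rest ∧
    c' = { c with io := rest, la := unary (posA S x), lb := unary (posB S x) } := by
  refine ((Poly.clear 12).cfg.seq ((Poly.clear 13).cfg.seq
    ((Poly.addTo (by decide) (by decide) (by decide)).cfg.seq
    ((Poly.addTo (by decide) (by decide) (by decide)).cfg.seq
    ((Poly.readUnary (by decide) PolyC.locStep).cfg.seq ((Poly.clear 4).cfg.seq
    (PolyC.branch 0 PolyC.skip (Poly.pop 0).cfg
      ((Poly.pop 0).cfg.seq (Poly.push 13 true).cfg)))))))).mono ?_
  rintro B c _ ⟨S, ⟨v, b⟩, rest, hS, hB, hv, e1, e2, e3, e4, h5, h6, e7, rfl⟩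
  have hm := Nat.mod_lt v hS
  dsimp only at e7 hv
  refine ⟨{ c with la := [] }, ⟨by simpa using h5, by simp⟩,
    { c with la := [], lb := [] }, ⟨by simpa using h6, by simp⟩,
    { c with la := [], lb := unary S }, ⟨S, by omega, by simp [e1], by simp [e2], by simp⟩,
    { c with la := [], lb := unary S, r := unary S },
      ⟨S, by omega, by simp [e1], by simp [e2], by simp [e4]⟩,
    { c with
      io := b :: rest, la := unary (v / S), lb := unary (S + 2 * (v % S)),
      r := unary (S - v % S) }, ⟨v, hv, fun w => cfg { c with
        io := unary (v - w) ++ false :: b :: rest, fl := [true], la := unary (w / S),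
        lb := unary (S + 2 * (w % S)), r := unary (S - w % S) }, b :: rest, ?_, ?_, ?_, ?_⟩,
    { c with
      io := b :: rest, la := unary (v / S), lb := unary (S + 2 * (v % S)) },
    ⟨by simp; omega, by simp [e4]⟩, ?_⟩
  · intro w hw; simp
  · simp [e3, e7, encNat]
  · intro w hw
    exact ⟨_, _, upd_io _ _, rfl, S, w, hS, hB, e1, e2, rfl, rfl, rfl, rfl⟩
  · simp [e3]
  · right
    cases b
    · left; simp [posA, posB]
    · right
      refine ⟨by simp, _, (upd_io _ _).symm, ?_⟩
      simp [posA, posB, List.replicate_succ]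

/-- Copy the hubs of the current literal to the registers `i` and `j`. -/
def copyTo (i j : ℕ) : Prog := addTo 12 i 1 ;; addTo 13 j 1

theorem PolyC.copyTo {i j : ℕ} (hi : 13 < i) (hj : 13 < j) :
    PolyC (copyTo i j) fun B c c' => ∃ x ≤ B, ∃ y ≤ B, c.la = unary x ∧ c.lb = unary y ∧
      c.tmp = [] ∧
      cfg c' = update (update (cfg c) i (unary x ++ cfg c i)) j
        (unary y ++ (update (cfg c) i (unary x ++ cfg c i)) j) := by
  refine ((Poly.addTo (by omega) (by omega) (by omega)).seq
    (Poly.addTo (by omega) (by omega) (by omega))).cfg.mono ?_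
  rintro B c c' ⟨x, hx, y, hy, e1, e2, e3, e4⟩
  refine ⟨_, ⟨x, hx, e1, e3, rfl⟩, y, hy, ?_, ?_, e4⟩
  · rw [Function.update_of_ne (by omega)]; exact e2
  · rw [Function.update_of_ne (by omega)]; exact e3

/-- If another literal follows on stack `0`, read it. -/
def parseNext : Prog := Prog.branch 0 Prog.skip Prog.skip (Prog.pop 0 ;; parseLit)

/-- Read a clause from stack `0` and store the hubs of three literals, the last literal being
repeated if there are fewer. -/
def parseClause : Prog :=
  Prog.pop 0 ;; parseLit ;; copyTo 14 17 ;; parseNext ;; copyTo 15 18 ;; parseNext ;;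
    copyTo 16 19 ;; Prog.pop 0 ;; clear 12 ;; clear 13

/-- The `t`-th literal of a clause that is filled up to three literals by repeating the last one. -/
def lit (C : List (ℕ × Bool)) (t : ℕ) : ℕ × Bool := C.getD (min t (C.length - 1)) (0, false)

/-- The bits that encode a literal. -/
def encLit (x : ℕ × Bool) : List Bool := encNat x.1 ++ [x.2]

theorem posA_le {S : ℕ} (x : ℕ × Bool) : posA S x ≤ x.1 := Nat.div_le_self _ _

theorem posB_lt {S : ℕ} (hS : 0 < S) (x : ℕ × Bool) : posB S x < 3 * S := by
  have := Nat.mod_lt x.1 hS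
  unfold posB
  rcases x.2 <;> simp <;> omega

theorem PolyC.parseClause : PolyC parseClause fun B c c' => ∃ S C rest, 0 < S ∧ 3 * S ≤ B ∧
    (∀ x ∈ C, x.1 < B) ∧ 1 ≤ C.length ∧ C.length ≤ 3 ∧
    c.s = unary S ∧ c.tmp = [] ∧ c.fl = [] ∧ c.r = [] ∧ c.la = [] ∧ c.lb = [] ∧
    c.a0 = [] ∧ c.a1 = [] ∧ c.a2 = [] ∧ c.b0 = [] ∧ c.b1 = [] ∧ c.b2 = [] ∧
    c.io = encList encLit C ++ rest ∧
    c' = { c with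
      io := rest, a0 := unary (posA S (lit C 0)), a1 := unary (posA S (lit C 1)),
      a2 := unary (posA S (lit C 2)), b0 := unary (posB S (lit C 0)),
      b1 := unary (posB S (lit C 1)), b2 := unary (posB S (lit C 2)) } := by
  have hnext := PolyC.branch 0 PolyC.skip PolyC.skip ((Poly.pop 0).cfg.seq PolyC.parseLit)
  refine ((Poly.pop 0).cfg.seq (PolyC.parseLit.seq ((PolyC.copyTo (by decide) (by decide)).seq
    (hnext.seq ((PolyC.copyTo (by decide) (by decide)).seq (hnext.seq
    ((PolyC.copyTo (by decide) (by decide)).seq ((Poly.pop 0).cfg.seq ((Poly.clear 12).cfg.seq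
    (Poly.clear 13).cfg))))))))).mono ?_
  rintro B c _ ⟨S, C, rest, hS, hB, hC, hC1, hC3, e1, e2, e3, e4, e5, e6, f0, f1, f2, g0, g1, g2,
    e7, rfl⟩
  have hb : ∀ x, posB S x ≤ B := fun x => (posB_lt hS x).le.trans hB
  have ha : ∀ x, x ∈ C → posA S x ≤ B := fun x hx => (posA_le x).trans (hC x hx).le
  rcases C with _ | ⟨x, _ | ⟨y, _ | ⟨z, _ | ⟨_, _⟩⟩⟩⟩
  · simp at hC1
  · refine ⟨{ c with io := encNat x.1 ++ x.2 :: false :: rest }, ?_,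
      { c with io := false :: rest, la := unary (posA S x), lb := unary (posB S x) },
      ⟨S, x, _, hS, hB, hC x (by simp), e1, e2, e3, e4, by simp [e5], by simp [e6], rfl, rfl⟩,
      { c with
        io := false :: rest, la := unary (posA S x), lb := unary (posB S x),
        a0 := unary (posA S x), b0 := unary (posB S x) },
      ⟨_, ha x (by simp), _, hb x, rfl, rfl, e2, by simp [f0, g0]⟩, _,
      .inr (.inl ⟨rfl, rfl⟩), { c with
        io := false :: rest, la := unary (posA S x), lb := unary (posB S x),
        a0 := unary (posA S x), b0 := unary (posB S x),
        a1 := unary (posA S x), b1 := unary (posB S x) },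
      ⟨_, ha x (by simp), _, hb x, rfl, rfl, e2, by simp [f1, g1]⟩, _,
      .inr (.inl ⟨rfl, rfl⟩), { c with
        io := false :: rest, la := unary (posA S x), lb := unary (posB S x),
        a0 := unary (posA S x), b0 := unary (posB S x),
        a1 := unary (posA S x), b1 := unary (posB S x),
        a2 := unary (posA S x), b2 := unary (posB S x) },
      ⟨_, ha x (by simp), _, hb x, rfl, rfl, e2, by simp [f2, g2]⟩, _, (upd_io _ _).symm, _,
      ⟨by simpa using ha x (by simp), (upd_la _ _).symm⟩, by simpa using hb x, ?_⟩
    · simp [e7, encList, encLit]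
    · simp [lit, e5, e6]
  · refine ⟨{ c with io := encNat x.1 ++ x.2 :: true :: (encNat y.1 ++ y.2 :: false :: rest) }, ?_,
      { c with
        io := true :: (encNat y.1 ++ y.2 :: false :: rest), la := unary (posA S x),
        lb := unary (posB S x) },
      ⟨S, x, _, hS, hB, hC x (by simp), e1, e2, e3, e4, by simp [e5], by simp [e6], rfl, rfl⟩,
      { c with
        io := true :: (encNat y.1 ++ y.2 :: false :: rest), la := unary (posA S x),
        lb := unary (posB S x), a0 := unary (posA S x), b0 := unary (posB S x) },
      ⟨_, ha x (by simp), _, hb x, rfl, rfl, e2, by simp [f0, g0]⟩,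
      { c with
        io := false :: rest, la := unary (posA S y),
        lb := unary (posB S y), a0 := unary (posA S x), b0 := unary (posB S x) },
      .inr (.inr ⟨rfl, _, (upd_io _ _).symm, S, y, _, hS, hB, hC y (by simp), e1, e2, e3, e4,
        by simpa using ha x (by simp), by simpa using hb x, rfl, rfl⟩), { c with
        io := false :: rest, la := unary (posA S y), lb := unary (posB S y),
        a0 := unary (posA S x), b0 := unary (posB S x),
        a1 := unary (posA S y), b1 := unary (posB S y) },
      ⟨_, ha y (by simp), _, hb y, rfl, rfl, e2, by simp [f1, g1]⟩, _,
      .inr (.inl ⟨rfl, rfl⟩), { c with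
        io := false :: rest, la := unary (posA S y), lb := unary (posB S y),
        a0 := unary (posA S x), b0 := unary (posB S x),
        a1 := unary (posA S y), b1 := unary (posB S y),
        a2 := unary (posA S y), b2 := unary (posB S y) },
      ⟨_, ha y (by simp), _, hb y, rfl, rfl, e2, by simp [f2, g2]⟩, _, (upd_io _ _).symm, _,
      ⟨by simpa using ha y (by simp), (upd_la _ _).symm⟩, by simpa using hb y, ?_⟩
    · simp [e7, encList, encLit]
    · simp [lit, e5, e6]
  · refine ⟨{ c with io := encNat x.1 ++ x.2 :: true :: (encNat y.1 ++ y.2 :: true ::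
        (encNat z.1 ++ z.2 :: false :: rest)) }, ?_,
      { c with
        io := true :: (encNat y.1 ++ y.2 :: true :: (encNat z.1 ++ z.2 :: false :: rest)),
        la := unary (posA S x), lb := unary (posB S x) },
      ⟨S, x, _, hS, hB, hC x (by simp), e1, e2, e3, e4, by simp [e5], by simp [e6], rfl, rfl⟩,
      { c with
        io := true :: (encNat y.1 ++ y.2 :: true :: (encNat z.1 ++ z.2 :: false :: rest)),
        la := unary (posA S x),
        lb := unary (posB S x), a0 := unary (posA S x), b0 := unary (posB S x) },
      ⟨_, ha x (by simp), _, hb x, rfl, rfl, e2, by simp [f0, g0]⟩,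
      { c with
        io := true :: (encNat z.1 ++ z.2 :: false :: rest), la := unary (posA S y),
        lb := unary (posB S y), a0 := unary (posA S x), b0 := unary (posB S x) },
      .inr (.inr ⟨rfl, _, (upd_io _ _).symm, S, y, _, hS, hB, hC y (by simp), e1, e2, e3, e4,
        by simpa using ha x (by simp), by simpa using hb x, rfl, rfl⟩), { c with
        io := true :: (encNat z.1 ++ z.2 :: false :: rest), la := unary (posA S y),
        lb := unary (posB S y), a0 := unary (posA S x), b0 := unary (posB S x),
        a1 := unary (posA S y), b1 := unary (posB S y) },
      ⟨_, ha y (by simp), _, hb y, rfl, rfl, e2, by simp [f1, g1]⟩,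
      { c with
        io := false :: rest, la := unary (posA S z),
        lb := unary (posB S z), a0 := unary (posA S x), b0 := unary (posB S x),
        a1 := unary (posA S y), b1 := unary (posB S y) },
      .inr (.inr ⟨rfl, _, (upd_io _ _).symm, S, z, _, hS, hB, hC z (by simp), e1, e2, e3, e4,
        by simpa using ha y (by simp), by simpa using hb y, rfl, rfl⟩), { c with
        io := false :: rest, la := unary (posA S z), lb := unary (posB S z),
        a0 := unary (posA S x), b0 := unary (posB S x),
        a1 := unary (posA S y), b1 := unary (posB S y),
        a2 := unary (posA S z), b2 := unary (posB S z) },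
      ⟨_, ha z (by simp), _, hb z, rfl, rfl, e2, by simp [f2, g2]⟩, _, (upd_io _ _).symm, _,
      ⟨by simpa using ha z (by simp), (upd_la _ _).symm⟩, by simpa using hb z, ?_⟩
    · simp [e7, encList, encLit]
    · simp [lit, e5, e6]
  · simp only [List.length_cons] at hC3
    omega

end ETHLower

namespace ETHLower

open Function (update)

/-! ### Emitting the gadgets -/

theorem reverse_encNat_add (x y : ℕ) :
    (encNat (x + y)).reverse = (encNat y).reverse ++ unary x := by
  simp [encNat, Nat.add_comm x y]

/-- A register together with a constant stands for the sum of both. -/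
def regVal (s : Store) (e : ℕ × ℕ) : ℕ := (s e.1).length + e.2

/-- Append the encoding of a number to the string that stack `out` holds in reversed order. -/
def emitNum (out : ℕ) (e : ℕ × ℕ) : Prog := addTo e.1 out 1 ;; pushes out (encNat e.2)

theorem Poly.emitNum {out : ℕ} {e : ℕ × ℕ} (h₁ : out ≠ 1) (h₂ : e.1 ≠ out) (h₃ : e.1 ≠ 1) :
    Poly (emitNum out e) fun B s s' => (∃ x ≤ B, s e.1 = unary x) ∧ s 1 = [] ∧
      s' = update s out ((encNat (regVal s e)).reverse ++ s out) := by
  refine ((Poly.addTo h₂ h₃ h₁).seq (Poly.pushes out (encNat e.2))).mono ?_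
  rintro B s _ ⟨⟨x, hx, e1⟩, e2, rfl⟩
  refine ⟨_, ⟨x, hx, e1, e2, rfl⟩, ?_⟩
  simp [regVal, e1, reverse_encNat_add]

/-- Emit several numbers. -/
def emitNums (out : ℕ) : List (ℕ × ℕ) → Prog
  | [] => Prog.skip
  | e :: L => emitNum out e ;; emitNums out L

theorem regVal_update {out : ℕ} {e : ℕ × ℕ} (h : e.1 ≠ out) (s : Store) (x : List Bool) :
    regVal (update s out x) e = regVal s e := by
  simp [regVal, h]

theorem Poly.emitNums {out : ℕ} (h₁ : out ≠ 1) (L : List (ℕ × ℕ))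
    (h₂ : ∀ e ∈ L, e.1 ≠ out ∧ e.1 ≠ 1) :
    Poly (emitNums out L) fun B s s' => (∀ e ∈ L, ∃ x ≤ B, s e.1 = unary x) ∧ s 1 = [] ∧
      s' = update s out ((L.flatMap fun e => encNat (regVal s e)).reverse ++ s out) := by
  induction L with
  | nil =>
    refine Poly.skip.mono ?_
    rintro B s _ ⟨-, -, rfl⟩
    simp
  | cons e L ih =>
    obtain ⟨he, hL⟩ := List.forall_mem_cons.1 h₂
    refine ((Poly.emitNum h₁ he.1 he.2).seq (ih hL)).mono ?_
    rintro B s _ ⟨hx, e1, rfl⟩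
    obtain ⟨hx, hxL⟩ := List.forall_mem_cons.1 hx
    refine ⟨_, ⟨hx, e1, rfl⟩, fun e' he' => ?_, ?_, ?_⟩
    · rw [Function.update_of_ne (hL e' he').1]; exact hxL e' he'
    · rw [Function.update_of_ne h₁.symm]; exact e1
    · have : (L.flatMap fun e => encNat (regVal s e)) = L.flatMap fun e' => encNat (regVal
          (update s out ((encNat (regVal s e)).reverse ++ s out)) e') :=
        List.flatMap_congr fun e' he' => by rw [regVal_update (hL e' he').1]
      rw [List.flatMap_cons, this]
      simp

/-- Emit the entries of a list; every entry consists of several numbers. -/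
def emitItems (out : ℕ) : List (List (ℕ × ℕ)) → Prog
  | [] => Prog.skip
  | L :: Ls => Prog.push out true ;; emitNums out L ;; emitItems out Ls

theorem Poly.emitItems {out : ℕ} (h₁ : out ≠ 1) (Ls : List (List (ℕ × ℕ)))
    (h₂ : ∀ L ∈ Ls, ∀ e ∈ L, e.1 ≠ out ∧ e.1 ≠ 1) :
    Poly (emitItems out Ls) fun B s s' =>
      (∀ L ∈ Ls, ∀ e ∈ L, ∃ x ≤ B, s e.1 = unary x) ∧ s 1 = [] ∧
      s' = update s out
        ((Ls.flatMap fun L => true :: L.flatMap fun e => encNat (regVal s e)).reverse ++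
          s out) := by
  induction Ls with
  | nil =>
    refine Poly.skip.mono ?_
    rintro B s _ ⟨-, -, rfl⟩
    simp
  | cons L Ls ih =>
    obtain ⟨he, hL⟩ := List.forall_mem_cons.1 h₂
    refine ((Poly.push out true).seq ((Poly.emitNums h₁ L he).seq (ih hL))).mono ?_
    rintro B s _ ⟨hx, e1, rfl⟩
    obtain ⟨hx, hxL⟩ := List.forall_mem_cons.1 hx
    refine ⟨_, rfl, _, ⟨fun e' he' => ?_, ?_, rfl⟩, fun L' hL' e' he' => ?_, ?_, ?_⟩
    · rw [Function.update_of_ne (he e' he').1]; exact hx e' he'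
    · rw [Function.update_of_ne h₁.symm]; exact e1
    · rw [Function.update_of_ne (hL L' hL' e' he').1, Function.update_of_ne (hL L' hL' e' he').1]
      exact hxL L' hL' e' he'
    · rw [Function.update_of_ne h₁.symm, Function.update_of_ne h₁.symm]; exact e1
    · have a : ∀ x, (L.flatMap fun e => encNat (regVal (update s out x) e))
          = L.flatMap fun e => encNat (regVal s e) := fun x =>
        List.flatMap_congr fun e' he' => by rw [regVal_update (he e' he').1]
      have b : ∀ x, (Ls.flatMap fun L => true :: L.flatMap fun e =>
            encNat (regVal (update s out x) e))
          = Ls.flatMap fun L => true :: L.flatMap fun e => encNat (regVal s e) := fun x =>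
        List.flatMap_congr fun L' hL' => by
          rw [List.flatMap_congr fun e' he' => by rw [regVal_update (hL L' hL' e' he').1]]
      simp only [Function.update_idem, Function.update_self, a, b, List.flatMap_cons]
      simp

/-- The hubs, as the common part of all bags. -/
def emitHubs : Prog :=
  addTo 9 11 1 ;; Prog.loop 11 (Prog.pop 11 ;; Prog.push 6 true ;; emitNum 6 (11, 0))

theorem PolyC.emitHubs : PolyC emitHubs fun B c c' => ∃ h ≤ B, c.H = unary h ∧ c.tmp = [] ∧
    c.hc = [] ∧ c' = { c with
      Bg := ((List.range h).reverse.flatMap fun j => true :: encNat j).reverse ++ c.Bg } := by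
  refine ((Poly.addTo (by decide) (by decide) (by decide)).cfg.seq (PolyC.loop 11
    ((Poly.pop 11).cfg.seq ((Poly.push 6 true).cfg.seq
    (Poly.emitNum (by decide) (by decide) (by decide)).cfg)))).mono ?_
  rintro B c _ ⟨h, hB, e1, e2, e3, rfl⟩
  refine ⟨{ c with hc := unary h }, ⟨h, hB, e1, e2, by simp [e3]⟩, h, hB, ?_⟩
  have key : ∀ h ≤ B, ∀ c : Cfg, c.tmp = [] → c.hc = unary h →
      IterC (fun c c'' => ∃ c', cfg c' = update (cfg c) 11 (cfg c 11).tail ∧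
        ∃ c''', cfg c''' = update (cfg c') 6 (true :: cfg c' 6) ∧
        (∃ x ≤ B, cfg c''' ((11, 0) : ℕ × ℕ).1 = unary x) ∧ cfg c''' 1 = [] ∧
        cfg c'' = update (cfg c''') 6 ((encNat (regVal (cfg c''') (11, 0))).reverse ++ cfg c''' 6))
        11 h c { c with
          hc := [],
          Bg := ((List.range h).reverse.flatMap fun j => true :: encNat j).reverse ++ c.Bg } := by
    intro h
    induction h with
    | zero =>
      rintro - c - e
      have e : c.hc = [] := e
      have : ({ c with
          hc := [],
          Bg := ((List.range 0).reverse.flatMap fun j => true :: encNat j).reverse ++ c.Bg } : Cfg)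
          = c := by
        rw [← e]; rfl
      rw [this]
      exact .done e
    | succ h ih =>
      rintro hB c e2 e
      have := ih (by omega) { c with
        hc := unary h, Bg := (true :: encNat h).reverse ++ c.Bg } e2 rfl
      refine .step (c₁ := { c with
        hc := unary h, Bg := (true :: encNat h).reverse ++ c.Bg })
        (by simp [e, List.replicate_succ]) ⟨{ c with hc := unary h }, by simp [e],
          { c with hc := unary h, Bg := true :: c.Bg }, by simp, ⟨h, by omega, rfl⟩, e2, ?_⟩ ?_
      · simp [regVal]
      · convert this using 1
        simp [List.range_succ]
  convert key h hB _ _ _ using 1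
  · simp [e3]
  · exact e2
  · rfl

/-- The bag of a gadget: all hubs, and the block of `6 * l` vertices of the gadget. -/
def bag (l h b : ℕ) : List ℕ := (List.range h).reverse ++ (List.range (6 * l)).map (b + ·)

/-- Emit the bag of a gadget. -/
def emitBag (l : ℕ) : Prog :=
  Prog.push 6 true ;; emitHubs ;; emitItems 6 ((List.range (6 * l)).map fun q => [(7, q)]) ;;
    Prog.push 6 false

theorem PolyC.emitBag (l : ℕ) : PolyC (emitBag l) fun B c c' => ∃ h ≤ B, ∃ b ≤ B,
    c.H = unary h ∧ c.base = unary b ∧ c.tmp = [] ∧ c.hc = [] ∧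
    c' = { c with Bg := (true :: encList encNat (bag l h b)).reverse ++ c.Bg } := by
  refine ((Poly.push 6 true).cfg.seq (PolyC.emitHubs.seq ((Poly.emitItems (by decide) _ ?_).cfg.seq
    (Poly.push 6 false).cfg))).mono ?_
  · simp
  rintro B c _ ⟨h, hB, b, hb, e1, e2, e3, e4, rfl⟩
  refine ⟨{ c with Bg := true :: c.Bg }, by simp, _, ⟨h, hB, e1, e3, e4, rfl⟩, { c with
    Bg := ((List.range (6 * l)).flatMap fun q => true :: encNat (b + q)).reverse ++
      (((List.range h).reverse.flatMap fun j => true :: encNat j).reverse ++ true :: c.Bg) },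
    ⟨?_, e3, ?_⟩, ?_⟩
  · simp only [List.mem_map, forall_exists_index, and_imp]
    rintro _ q - rfl e he
    obtain rfl : e = (7, q) := by simpa using he
    exact ⟨b, hb, e2⟩
  · simp [List.flatMap_map, regVal, e2]
  · simp [bag, encList, List.flatMap_map]

/-! ### Processing the gadgets -/

/-- The vertices and hubs of a gadget that consists of three threads and three connectors: the
first and the second hub of a thread, and the inner vertices of the threads and the connectors. -/
inductive Loc : Type
  | A (t : Fin 3) : Loc
  | B (t : Fin 3) : Loc
  | thr (t : Fin 3) (p : ℕ) : Loc
  | con (t : Fin 3) (p : ℕ) : Loc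
  deriving DecidableEq

/-- The register and the constant that give the number of a vertex of a gadget. -/
def regOf (l : ℕ) : Loc → ℕ × ℕ
  | .A t => (14 + t, 0)
  | .B t => (17 + t, 0)
  | .thr t p => (7, t * l + p)
  | .con t p => (7, (3 + t) * l + p)

/-- The number of a vertex of a gadget. The inner vertices of the gadget start at `b`, and the
threads belong to the literals of the clause `C`. -/
def locVal (l S b : ℕ) (C : List (ℕ × Bool)) : Loc → ℕ
  | .A t => posA S (lit C t)
  | .B t => posB S (lit C t)
  | .thr t p => b + (t * l + p)
  | .con t p => b + ((3 + t) * l + p)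

/-- A gadget is given by its list of edges and by a clause. -/
abbrev Job : Type := List (Loc × Loc) × List (ℕ × Bool)

/-- The edges of a gadget. -/
def jobEdges (l S b : ℕ) (j : Job) : List (ℕ × ℕ) :=
  j.1.map fun e => (locVal l S b j.2 e.1, locVal l S b j.2 e.2)

/-- The edges of a sequence of gadgets. -/
def allEdges (l S : ℕ) : ℕ → List Job → List (ℕ × ℕ)
  | _, [] => []
  | b, j :: js => jobEdges l S b j ++ allEdges l S (b + 6 * l) js

/-- The bags of a sequence of gadgets. -/
def allBags (l h : ℕ) : ℕ → List Job → List (List ℕ)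
  | _, [] => []
  | b, _ :: js => bag l h b :: allBags l h (b + 6 * l) js

/-- The bits that encode an edge. -/
def encEdge (e : ℕ × ℕ) : List Bool := encNat e.1 ++ encNat e.2

/-- The configuration after a sequence of gadgets has been processed. -/
def after (l S b : ℕ) (js : List Job) (c : Cfg) : Cfg :=
  { c with
    E := ((allEdges l S b js).flatMap fun e => true :: encEdge e).reverse ++ c.E
    Bg := ((allBags l (3 * S) b js).flatMap fun x => true :: encList encNat x).reverse ++ c.Bg
    base := unary (b + 6 * l * js.length)
    k := unary (2 * js.length) ++ c.k }

theorem after_cons (l S b : ℕ) (j : Job) (js : List Job) (c : Cfg) :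
    after l S b (j :: js) c = after l S (b + 6 * l) js (after l S b [j] c) := by
  have h1 : b + 6 * l * (js.length + 1) = b + 6 * l + 6 * l * js.length := by ring
  have h2 : unary (2 * (js.length + 1)) ++ c.k = unary (2 * js.length) ++ (unary 2 ++ c.k) := by
    rw [← List.append_assoc, mul_add]
    congr 1
    exact List.replicate_add ..
  simp only [after, allEdges, allBags, List.flatMap_append, List.flatMap_cons, List.reverse_append,
    List.append_assoc, List.length_cons, List.length_nil, List.flatMap_nil, List.append_nil, h1, h2]

/-- Read a clause from stack `0` and emit the edges and the bag of its gadget. -/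
def process (l : ℕ) (T : List (Loc × Loc)) : Prog :=
  parseClause ;; emitItems 5 (T.map fun e => [regOf l e.1, regOf l e.2]) ;; emitBag l ;;
    pushes 7 (unary (6 * l)) ;; pushes 8 [true, true] ;;
    clear 14 ;; clear 15 ;; clear 16 ;; clear 17 ;; clear 18 ;; clear 19

/-- All temporary registers are empty, and the registers that are only read have their values. -/
structure Ready (S b : ℕ) (c : Cfg) : Prop where
  tmp : c.tmp = []
  fl : c.fl = []
  r : c.r = []
  hc : c.hc = []
  la : c.la = []
  lb : c.lb = []
  a0 : c.a0 = []
  a1 : c.a1 = []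
  a2 : c.a2 = []
  b0 : c.b0 = []
  b1 : c.b1 = []
  b2 : c.b2 = []
  s : c.s = unary S
  H : c.H = unary (3 * S)
  base : c.base = unary b

theorem regOf_ne (l : ℕ) (x : Loc) : (regOf l x).1 ≠ 5 ∧ (regOf l x).1 ≠ 1 := by
  cases x <;> simp only [regOf] <;> omega

theorem PolyC.process (l : ℕ) (T : List (Loc × Loc)) :
    PolyC (process l T) fun B c c' => ∃ S b C rest, Ready S b c ∧ 0 < S ∧ 3 * S ≤ B ∧ b ≤ B ∧
      (∀ x ∈ C, x.1 < B) ∧ 1 ≤ C.length ∧ C.length ≤ 3 ∧ c.io = encList encLit C ++ rest ∧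
      c' = after l S b [(T, C)] { c with io := rest } := by
  refine (PolyC.parseClause.seq ((Poly.emitItems (by decide) _ ?_).cfg.seq ((PolyC.emitBag l).seq
    ((Poly.pushes _ _).cfg.seq ((Poly.pushes _ _).cfg.seq ((Poly.clear _).cfg.seq
    ((Poly.clear _).cfg.seq ((Poly.clear _).cfg.seq ((Poly.clear _).cfg.seq
    ((Poly.clear _).cfg.seq (Poly.clear _).cfg)))))))))).mono ?_
  · intro L hL e he
    obtain ⟨x, -, rfl⟩ := List.mem_map.1 hL
    have : e = regOf l x.1 ∨ e = regOf l x.2 := by simpa using he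
    rcases this with rfl | rfl <;> exact regOf_ne l _
  rintro B c _ ⟨S, b, C, rest, hr, hS, hB, hb, hC, hC1, hC3, e, rfl⟩
  have hlitmem : ∀ t, lit C t ∈ C := fun t => by
    have : min t (C.length - 1) < C.length := by omega
    rw [lit, List.getD_eq_getElem _ _ this]
    exact List.getElem_mem _
  have hA : ∀ t, posA S (lit C t) ≤ B := fun t => (posA_le _).trans (hC _ (hlitmem t)).le
  have hBB : ∀ t, posB S (lit C t) ≤ B := fun t => (posB_lt hS _).le.trans hB
  have hval : ∀ (c' : Cfg), c'.base = unary b → c'.a0 = unary (posA S (lit C 0)) →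
      c'.a1 = unary (posA S (lit C 1)) → c'.a2 = unary (posA S (lit C 2)) →
      c'.b0 = unary (posB S (lit C 0)) → c'.b1 = unary (posB S (lit C 1)) →
      c'.b2 = unary (posB S (lit C 2)) → ∀ x,
      (∃ y ≤ B, cfg c' (regOf l x).1 = unary y) ∧
        regVal (cfg c') (regOf l x) = locVal l S b C x := by
    intro c' e0 e1 e2 e3 e4 e5 e6 x
    cases x with
    | A t => fin_cases t <;> simp [regOf, regVal, locVal, e1, e2, e3, hA]
    | B t => fin_cases t <;> simp [regOf, regVal, locVal, e4, e5, e6, hBB]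
    | thr t p => simp [regOf, regVal, locVal, e0, hb]
    | con t p => simp [regOf, regVal, locVal, e0, hb]
  refine ⟨_, ⟨S, C, rest, hS, hB, hC, hC1, hC3, hr.s, hr.tmp, hr.fl, hr.r, hr.la, hr.lb, hr.a0,
    hr.a1, hr.a2, hr.b0, hr.b1, hr.b2, e, rfl⟩, { c with
      io := rest, a0 := unary (posA S (lit C 0)), a1 := unary (posA S (lit C 1)),
      a2 := unary (posA S (lit C 2)), b0 := unary (posB S (lit C 0)),
      b1 := unary (posB S (lit C 1)), b2 := unary (posB S (lit C 2)),
      E := ((jobEdges l S b (T, C)).flatMap fun e => true :: encEdge e).reverse ++ c.E },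
    ⟨?_, hr.tmp, ?_⟩, _, ⟨3 * S, hB, b, hb, hr.H, hr.base, hr.tmp, hr.hc, rfl⟩, _,
    (upd_base _ _).symm, _, (upd_k _ _).symm, _, ⟨?_, (upd_a0 _ _).symm⟩, _,
    ⟨?_, (upd_a1 _ _).symm⟩, _, ⟨?_, (upd_a2 _ _).symm⟩, _,
    ⟨?_, (upd_b0 _ _).symm⟩, _, ⟨?_, (upd_b1 _ _).symm⟩, ?_, ?_⟩
  · simp only [List.mem_map, forall_exists_index, and_imp]
    rintro _ e - rfl x hx
    have : x = regOf l e.1 ∨ x = regOf l e.2 := by simpa using hx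
    rcases this with rfl | rfl <;>
    exact (hval { c with
        io := rest, a0 := unary (posA S (lit C 0)), a1 := unary (posA S (lit C 1)),
        a2 := unary (posA S (lit C 2)), b0 := unary (posB S (lit C 0)),
        b1 := unary (posB S (lit C 1)), b2 := unary (posB S (lit C 2)) }
        hr.base rfl rfl rfl rfl rfl rfl _).1
  · rw [upd_E, List.flatMap_map]
    simp only [List.flatMap_cons, List.flatMap_nil, List.append_nil,
      (hval { c with
        io := rest, a0 := unary (posA S (lit C 0)), a1 := unary (posA S (lit C 1)),
        a2 := unary (posA S (lit C 2)), b0 := unary (posB S (lit C 0)),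
        b1 := unary (posB S (lit C 1)), b2 := unary (posB S (lit C 2)) }
        hr.base rfl rfl rfl rfl rfl rfl _).2]
    rw [jobEdges, List.flatMap_map]
    rfl
  · simpa using hA 0
  · simpa using hA 1
  · simpa using hA 2
  · simpa using hBB 0
  · simpa using hBB 1
  · simpa using hBB 2
  · rw [upd_b2]
    simp [after, allEdges, allBags, hr.a0, hr.a1, hr.a2, hr.b0, hr.b1, hr.b2, hr.base,
      Nat.add_comm b]
    rfl

theorem Ready.after {l S b : ℕ} {c : Cfg} (h : Ready S b c) (j : Job) (x y : List Bool) :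
    Ready S (b + 6 * l) { ETHLower.after l S b [j] c with io := x, cnt := y } :=
  ⟨h.tmp, h.fl, h.r, h.hc, h.la, h.lb, h.a0, h.a1, h.a2, h.b0, h.b1, h.b2, h.s, h.H,
    by simp [ETHLower.after]⟩

/-- The clause whose gadget lets us choose a truth value for the variable `v`. -/
def varClause (v : ℕ) : List (ℕ × Bool) := [(v, true), (v, false)]

/-- Process the clauses of the variables below the number in register `10`. -/
def varLoop (l : ℕ) (T : List (Loc × Loc)) : Prog :=
  Prog.loop 10 (Prog.pop 10 ;; pushes 0 [false, false, false] ;; addTo 10 0 1 ;;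
    pushes 0 [true, true, false] ;; addTo 10 0 1 ;; Prog.push 0 true ;; process l T)

/-- The gadgets of the variables. -/
def varJobs (T : List (Loc × Loc)) (m : ℕ) : List Job :=
  (List.range m).reverse.map fun v => (T, varClause v)

theorem PolyC.varLoop (l : ℕ) (T : List (Loc × Loc)) :
    PolyC (varLoop l T) fun B c c' => ∃ S b m, Ready S b c ∧ 0 < S ∧ 3 * S ≤ B ∧
      b + 6 * l * m ≤ B ∧ m ≤ B ∧ c.cnt = unary m ∧
      c' = { after l S b (varJobs T m) c with cnt := [] } := by
  refine (PolyC.loop 10 ((Poly.pop 10).cfg.seq ((Poly.pushes _ _).cfg.seq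
    ((Poly.addTo (by decide) (by decide) (by decide)).cfg.seq ((Poly.pushes _ _).cfg.seq
    ((Poly.addTo (by decide) (by decide) (by decide)).cfg.seq ((Poly.push _ _).cfg.seq
    (PolyC.process l T)))))))).mono ?_
  rintro B c _ ⟨S, b, m, hr, hS, hB, hb, hm, e, rfl⟩
  refine ⟨m, hm, ?_⟩
  induction m generalizing c b with
  | zero =>
    have : ({ after l S b (varJobs T 0) c with cnt := [] } : Cfg) = c := by
      have e : c.cnt = [] := e
      rw [← e]
      simp [after, varJobs, allEdges, allBags, ← hr.base]
    rw [this]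
    exact .done e
  | succ m ih =>
    rw [show varJobs T (m + 1) = (T, varClause m) :: varJobs T m by
      simp [varJobs, List.range_succ], after_cons]
    refine .step (c₁ := { after l S b [(T, varClause m)] c with cnt := unary m })
      (by simp [e, List.replicate_succ]) ⟨{ c with cnt := unary m }, by simp [e],
      _, (upd_io _ _).symm, _, ⟨m, by omega, rfl, hr.tmp, (upd_io _ _).symm⟩, _, (upd_io _ _).symm,
      _, ⟨m, by omega, rfl, hr.tmp, (upd_io _ _).symm⟩, _, (upd_io _ _).symm, S, b, varClause m,
      c.io, ⟨hr.tmp, hr.fl, hr.r, hr.hc, hr.la, hr.lb, hr.a0, hr.a1, hr.a2, hr.b0, hr.b1, hr.b2,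
        hr.s, hr.H, hr.base⟩, hS, hB, by omega, by simp [varClause]; omega, by simp [varClause],
        by simp [varClause], ?_, rfl⟩
      (ih { after l S b [(T, varClause m)] c with cnt := unary m } (b + 6 * l)
        (hr.after (T, varClause m) _ _) (by linarith [mul_add (6 * l) m 1]) (by omega) rfl)
    simp [varClause, encList, encLit, encNat]

/-- Process the clauses on stack `0`. -/
def clauseLoop (l : ℕ) (T : List (Loc × Loc)) : Prog :=
  Prog.loop 0 (Prog.branch 0 Prog.skip (Prog.pop 0) (Prog.pop 0 ;; process l T))

theorem PolyC.clauseLoop (l : ℕ) (T : List (Loc × Loc)) :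
    PolyC (clauseLoop l T) fun B c c' => ∃ S b Cs, Ready S b c ∧ 0 < S ∧ 3 * S ≤ B ∧
      b + 6 * l * Cs.length ≤ B ∧ Cs.length < B ∧
      (∀ C ∈ Cs, (∀ x ∈ C, x.1 < B) ∧ 1 ≤ C.length ∧ C.length ≤ 3) ∧
      c.io = encList (encList encLit) Cs ∧
      c' = { after l S b (Cs.map fun C => (T, C)) c with io := [] } := by
  refine (PolyC.loop 0 (PolyC.branch 0 PolyC.skip (Poly.pop 0).cfg ((Poly.pop 0).cfg.seq
    (PolyC.process l T)))).mono ?_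
  rintro B c _ ⟨S, b, Cs, hr, hS, hB, hb, hm, hC, e, rfl⟩
  refine ⟨Cs.length + 1, hm, ?_⟩
  clear hm
  induction Cs generalizing c b with
  | nil =>
    have : ({ after l S b [] c with io := [] } : Cfg) = { c with io := [] } := by
      simp [after, allEdges, allBags, ← hr.base]
    rw [List.map_nil, this]
    have e : c.io = [false] := e
    exact .step (by simp [e]) (.inr (.inl ⟨by simp [e], by rw [upd_io]; simp [e]⟩)) (.done rfl)
  | cons C Cs ih =>
    obtain ⟨hC0, hC⟩ := List.forall_mem_cons.1 hC
    rw [List.map_cons, after_cons]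
    have e' : c.io = true :: (encList encLit C ++ encList (encList encLit) Cs) := by
      rw [e]; simp [encList]
    have hb' : b + 6 * l + 6 * l * Cs.length ≤ B := by
      rw [List.length_cons, mul_add] at hb; omega
    exact .step (c₁ := { after l S b [(T, C)] c with io := encList (encList encLit) Cs })
      (by simp [e']) (.inr (.inr ⟨by simp [e'], _, (upd_io _ _).symm, S, b, C,
        encList (encList encLit) Cs, ⟨hr.tmp, hr.fl, hr.r, hr.hc, hr.la, hr.lb, hr.a0, hr.a1,
        hr.a2, hr.b0, hr.b1, hr.b2, hr.s, hr.H, hr.base⟩, hS, hB, by omega, hC0.1, hC0.2.1,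
        hC0.2.2, by simp [e'], rfl⟩))
      (ih { after l S b [(T, C)] c with io := encList (encList encLit) Cs } (b + 6 * l)
        (hr.after (T, C) _ _) hb' hC rfl)

/-! ### The whole reduction -/

/-- The side length of the square in which `v` variables are placed. -/
def side (v : ℕ) : ℕ := Nat.sqrt v + 1

theorem side_succ (v : ℕ) : (v + 1 < side v ^ 2 ∧ side (v + 1) = side v) ∨
    (v + 1 = side v ^ 2 ∧ side (v + 1) = side v + 1) := by
  have h1 := Nat.lt_succ_sqrt v
  have h2 := Nat.sqrt_le v
  rw [Nat.succ_eq_add_one] at h1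
  unfold side
  rcases Nat.lt_or_ge (v + 1) ((Nat.sqrt v + 1) ^ 2) with h | h
  · refine .inl ⟨h, ?_⟩
    rw [Nat.add_right_cancel_iff]
    exact (Nat.eq_sqrt.2 ⟨by omega, by rw [← sq]; exact h⟩).symm
  · have e : v + 1 = (Nat.sqrt v + 1) ^ 2 := by
      rw [sq] at h ⊢; omega
    refine .inr ⟨e, ?_⟩
    rw [e, Nat.sqrt_eq']

theorem lt_side_sq (v : ℕ) : v < side v ^ 2 := by
  rw [sq]; exact Nat.lt_succ_sqrt v

theorem side_sq_le (v : ℕ) : side v ^ 2 ≤ v + 2 * side v := by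
  have := Nat.sqrt_le v
  unfold side
  nlinarith

/-- Count a unit, and update the side length of the square. Register `4` holds the number of free
places in the square. -/
def sideStep : Prog :=
  Prog.push 10 true ;; Prog.pop 4 ;;
    Prog.branch 4 (Prog.push 3 true ;; addTo 3 4 1 ;; addTo 3 4 1 ;; Prog.pop 4) Prog.skip Prog.skip

theorem PolyC.sideStep : PolyC sideStep fun B c c' =>
    ∃ v, side v < B ∧ c.tmp = [] ∧ c.cnt = unary v ∧ c.s = unary (side v) ∧
    c.r = unary (side v ^ 2 - v) ∧
    c' = { c with
      cnt := unary (v + 1), s := unary (side (v + 1)),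
      r := unary (side (v + 1) ^ 2 - (v + 1)) } := by
  refine ((Poly.push _ _).cfg.seq ((Poly.pop _).cfg.seq (PolyC.branch 4 ((Poly.push _ _).cfg.seq
    ((Poly.addTo (by decide) (by decide) (by decide)).cfg.seq
    ((Poly.addTo (by decide) (by decide) (by decide)).cfg.seq (Poly.pop _).cfg)))
    PolyC.skip PolyC.skip))).mono ?_
  rintro B c _ ⟨v, hv, e1, e2, e3, e4, rfl⟩
  refine ⟨{ c with cnt := unary (v + 1) }, by simp [e2, List.replicate_succ],
    { c with cnt := unary (v + 1), r := unary (side v ^ 2 - (v + 1)) },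
    by simp [e4, Nat.sub_sub], ?_⟩
  rcases side_succ v with ⟨h1, h2⟩ | ⟨h1, h2⟩
  · obtain ⟨y, hy⟩ : ∃ y, side v ^ 2 - (v + 1) = y + 1 := ⟨side v ^ 2 - (v + 1) - 1, by omega⟩
    refine .inr (.inr ⟨by simp [hy, List.replicate_succ], ?_⟩)
    rw [h2, ← e3]
  · have hy : side v ^ 2 - (v + 1) = 0 := by omega
    have hs : side v + 1 ≤ B := hv
    refine .inl ⟨by simp [hy], { c with cnt := unary (v + 1), s := unary (side v + 1), r := [] },
      by simp [hy, e3, List.replicate_succ], { c with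
        cnt := unary (v + 1), s := unary (side v + 1), r := unary (side v + 1) },
      ⟨_, hs, rfl, e1, by simp⟩, { c with
        cnt := unary (v + 1), s := unary (side v + 1), r := unary (side v + 1 + (side v + 1)) },
      ⟨_, hs, rfl, e1, by simp⟩, ?_⟩
    have : (side v + 1) ^ 2 - side v ^ 2 = 2 * side v + 1 := by
      have : (side v + 1) ^ 2 = side v ^ 2 + (2 * side v + 1) := by ring
      omega
    rw [h2, h1, this, upd_r, cfg_r, show side v + 1 + (side v + 1) = 2 * side v + 1 + 1 by ring]
    rfl

end ETHLower

namespace ETHLower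

open Function (update)

theorem after_append (l S b : ℕ) (js js' : List Job) (c : Cfg) (h : c.base = unary b) :
    after l S b (js ++ js') c = after l S (b + 6 * l * js.length) js' (after l S b js c) := by
  induction js generalizing b c with
  | nil =>
    have : after l S b [] c = c := by simp [after, allEdges, allBags, ← h]
    rw [this]; rfl
  | cons j js ih =>
    rw [List.cons_append, after_cons, ih _ _ (by simp [after]), ← after_cons]
    congr 1
    rw [List.length_cons]; ring

/-- Add three times the number on stack `3` to stack `i`. -/
def addThrice (i : ℕ) : Prog := addTo 3 i 1 ;; addTo 3 i 1 ;; addTo 3 i 1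

theorem Poly.addThrice {i : ℕ} (h₁ : 3 ≠ i) (h₂ : i ≠ 1) :
    Poly (addThrice i) fun B s s' => ∃ x ≤ B, s 3 = unary x ∧ s 1 = [] ∧
      s' = update s i (unary (3 * x) ++ s i) := by
  have h := Poly.addTo h₁ (by decide : 3 ≠ 1) h₂
  refine (h.seq (h.seq h)).mono ?_
  rintro B s _ ⟨x, hx, e1, e2, rfl⟩
  refine ⟨_, ⟨x, hx, e1, e2, rfl⟩, _, ⟨x, hx, ?_, ?_, rfl⟩, x, hx, ?_, ?_, ?_⟩
  · simpa [h₁] using e1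
  · simpa [h₂.symm] using e2
  · simpa [h₁] using e1
  · simpa [h₂.symm] using e2
  · have : unary (3 * x) = unary x ++ (unary x ++ unary x) := by
      rw [show 3 * x = x + (x + x) by ring]
      simp
    rw [this]
    simp only [Function.update_idem, Function.update_self, List.append_assoc]

/-- Read a formula from stack `0` and emit the gadgets of its variables and clauses. -/
def emitGadgets (l : ℕ) (T T' : List (Loc × Loc)) : Prog :=
  Prog.push 3 true ;; Prog.push 4 true ;; readUnary 2 sideStep ;; clear 4 ;; Prog.push 10 true ;;
    addThrice 9 ;; addThrice 7 ;; varLoop l T ;; clauseLoop l T'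

/-- The gadgets of a formula, those of the variables in decreasing order first. There is one more
variable than in the formula, so that there is always a gadget, and a path decomposition has a bag. -/
def jobs (T T' : List (Loc × Loc)) (n : ℕ) (Cs : List (List (ℕ × Bool))) : List Job :=
  varJobs T (n + 1) ++ Cs.map fun C => (T', C)

theorem PolyC.emitGadgets (l : ℕ) (T T' : List (Loc × Loc)) :
    PolyC (emitGadgets l T T') fun B c c' => ∃ n Cs, n + 2 ≤ B ∧
      3 * side n + 6 * l * (jobs T T' n Cs).length ≤ B ∧ Cs.length < B ∧
      (∀ C ∈ Cs, (∀ x ∈ C, x.1 < B) ∧ 1 ≤ C.length ∧ C.length ≤ 3) ∧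
      c = { io := encNat n ++ encList (encList encLit) Cs } ∧
      c' = after l (side n) (3 * side n) (jobs T T' n Cs)
        { s := unary (side n), H := unary (3 * side n), base := unary (3 * side n) } := by
  refine ((Poly.push _ _).cfg.seq ((Poly.push _ _).cfg.seq
    ((Poly.readUnary (by decide) PolyC.sideStep).cfg.seq ((Poly.clear _).cfg.seq
    ((Poly.push _ _).cfg.seq ((Poly.addThrice (by decide) (by decide)).cfg.seq
    ((Poly.addThrice (by decide) (by decide)).cfg.seq
    ((PolyC.varLoop l T).seq (PolyC.clauseLoop l T'))))))))).mono ?_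
  rintro B _ _ ⟨n, Cs, hn, hB, hCs, hC, rfl, rfl⟩
  set S := side n with hS
  have hS0 : 0 < S := Nat.succ_pos _
  have hSB : 3 * S ≤ B := by omega
  have hlen : (jobs T T' n Cs).length = n + 1 + Cs.length := by simp [jobs, varJobs]
  have hmono : ∀ w < n, side w < B := fun w hw => by
    have : side w ≤ S := Nat.succ_le_succ (Nat.sqrt_le_sqrt hw.le)
    omega
  rw [hlen, mul_add] at hB
  let K := encList (encList encLit) Cs
  refine ⟨{ io := encNat n ++ K, s := [true] }, by simp [K],
    { io := encNat n ++ K, s := [true], r := [true] }, by simp,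
    { io := K, s := unary S, r := unary (S ^ 2 - n), cnt := unary n },
    ⟨n, by omega, fun w => cfg {
        io := unary (n - w) ++ false :: K, fl := [true], s := unary (side w),
        r := unary (side w ^ 2 - w), cnt := unary w }, K, ?_, ?_, ?_, ?_⟩,
    { io := K, s := unary S, cnt := unary n }, ⟨?_, by simp⟩,
    { io := K, s := unary S, cnt := unary (n + 1) }, by simp [List.replicate_succ],
    { io := K, s := unary S, cnt := unary (n + 1), H := unary (3 * S) },
    ⟨S, by omega, rfl, rfl, by simp⟩,
    { io := K, s := unary S, cnt := unary (n + 1), H := unary (3 * S), base := unary (3 * S) },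
    ⟨S, by omega, rfl, rfl, by simp⟩,
    { after l S (3 * S) (varJobs T (n + 1)) {
        io := K, s := unary S, H := unary (3 * S), base := unary (3 * S) } with cnt := [] },
    ⟨S, 3 * S, n + 1, ⟨rfl, rfl, rfl, rfl, rfl, rfl, rfl, rfl, rfl, rfl, rfl, rfl, rfl, rfl, rfl⟩,
      hS0, hSB, by omega, by omega, rfl, rfl⟩, S, 3 * S + 6 * l * (n + 1), Cs,
    ⟨rfl, rfl, rfl, rfl, rfl, rfl, rfl, rfl, rfl, rfl, rfl, rfl, rfl, rfl,
      by simp [after, varJobs]⟩, hS0, hSB, by omega, hCs, hC, rfl, ?_⟩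
  · intro w hw; simp
  · have : side 0 = 1 := rfl
    simp [this, K, encNat]
  · intro w hw
    exact ⟨_, _, upd_io _ _, rfl, w, hmono w hw, rfl, rfl, rfl, rfl, rfl⟩
  · simp [hS]
  · have := side_sq_le n
    rw [← hS] at this
    simp only [cfg_r, List.length_replicate]
    omega
  · rw [jobs, after_append _ _ _ _ _ _ rfl]
    simp [after, varJobs]

/-- Write the instance to stack `0`, and empty all other stacks. -/
def assemble : Prog :=
  Prog.push 6 false ;; Prog.push 5 false ;; transfer 6 0 ;; transfer 5 0 ;;
    Prog.push 0 false ;; addTo 8 0 1 ;; Prog.push 0 false ;; addTo 7 0 1 ;;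
    clear 7 ;; clear 8 ;; clear 3 ;; clear 9

theorem PolyC.assemble :
    PolyC assemble fun B c c' => ∃ N k S H Es Bs, N ≤ B ∧ k ≤ B ∧ S ≤ B ∧ H ≤ B ∧
      Es.length < B ∧ Bs.length < B ∧
      c = { s := unary S, H := unary H, base := unary N, k := unary k, E := Es.reverse,
            Bg := Bs.reverse } ∧
      c' = { io := encNat N ++ encNat k ++ (Es ++ [false]) ++ (Bs ++ [false]) } := by
  refine ((Poly.push _ _).cfg.seq ((Poly.push _ _).cfg.seq
    ((Poly.transfer (by decide)).cfg.seq ((Poly.transfer (by decide)).cfg.seq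
    ((Poly.push _ _).cfg.seq ((Poly.addTo (by decide) (by decide) (by decide)).cfg.seq
    ((Poly.push _ _).cfg.seq ((Poly.addTo (by decide) (by decide) (by decide)).cfg.seq
    ((Poly.clear _).cfg.seq ((Poly.clear _).cfg.seq ((Poly.clear _).cfg.seq
    (Poly.clear _).cfg))))))))))).mono ?_
  rintro B _ _ ⟨N, k, S, H, Es, Bs, hN, hk, hS, hH, hE, hBs, rfl, rfl⟩
  refine ⟨_, (upd_Bg _ _).symm, _, (upd_E _ _).symm, {
      s := unary S, H := unary H, base := unary N, k := unary k,
      E := false :: Es.reverse, io := Bs ++ [false] },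
    ⟨by simpa using hBs, by simp⟩, {
      s := unary S, H := unary H, base := unary N, k := unary k,
      io := Es ++ [false] ++ (Bs ++ [false]) },
    ⟨by simpa using hE, by simp⟩, _, (upd_io _ _).symm, _, ⟨k, hk, rfl, rfl, (upd_io _ _).symm⟩,
    _, (upd_io _ _).symm, _, ⟨N, hN, rfl, rfl, (upd_io _ _).symm⟩, _,
    ⟨by simpa using hN, (upd_base _ _).symm⟩, _, ⟨by simpa using hk, (upd_k _ _).symm⟩, _,
    ⟨by simpa using hS, (upd_s _ _).symm⟩, by simpa using hH, ?_⟩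
  rw [upd_H]
  simp [encNat]

/-- The encoding of the instance that belongs to a formula: the number of vertices, the number of
vertices that may be removed, the edges and the bags. -/
def output (l : ℕ) (T T' : List (Loc × Loc)) (n : ℕ) (Cs : List (List (ℕ × Bool))) : List Bool :=
  encNat (3 * side n + 6 * l * (jobs T T' n Cs).length) ++ encNat (2 * (jobs T T' n Cs).length) ++
    encList encEdge (allEdges l (side n) (3 * side n) (jobs T T' n Cs)) ++
    encList (encList encNat) (allBags l (3 * side n) (3 * side n) (jobs T T' n Cs))

theorem cfg_eq_initial (x : List Bool) : cfg { io := x } = initial x := by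
  have : initial [] = cfg {} := by
    funext i
    have : ∀ (n i : ℕ), (List.replicate n ([] : List Bool)).getD i [] = [] := by
      intro n i; rcases Nat.lt_or_ge i n with h | h <;> simp [h, List.getD]
    have h2 : initial [] i = [] := by by_cases h : i = 0 <;> simp [initial, h]
    rw [h2]; exact (this 20 i).symm
  rw [show initial x = update (initial []) 0 x by simp [initial], this, upd_io]

theorem length_le_of_runs {p : Prog} {c c' : Cfg} {t : ℕ} (h : Runs p (cfg c) (cfg c') t) (i : ℕ)
    (hi : cfg c i = []) : (cfg c' i).length ≤ t := by
  simpa [hi] using h.length_le i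

/-- The reduction can be computed in polynomial time. -/
theorem exists_reduction (l : ℕ) (T T' : List (Loc × Loc)) :
    ∃ (P : Prog) (K j : ℕ), ∀ n Cs B, n + 2 ≤ B →
      3 * side n + 6 * l * (jobs T T' n Cs).length ≤ B → Cs.length < B →
      (∀ C ∈ Cs, (∀ x ∈ C, x.1 < B) ∧ 1 ≤ C.length ∧ C.length ≤ 3) →
      ∃ t ≤ K * (B + 1) ^ j, Runs P (initial (encNat n ++ encList (encList encLit) Cs))
        (initial (output l T T' n Cs)) t := by
  obtain ⟨K, j, h⟩ := PolyC.emitGadgets l T T'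
  obtain ⟨K', j', h'⟩ := PolyC.assemble
  refine ⟨emitGadgets l T T' ;; assemble, K + K' * (K + 3) ^ j', j + j * j', ?_⟩
  intro n Cs B h1 h2 h3 h4
  obtain ⟨t, ht, hle⟩ := h B _ _ ⟨_, _, rfl, rfl, n, Cs, h1, h2, h3, h4, rfl, rfl⟩
  have hE := length_le_of_runs ht 5 rfl
  have hBg := length_le_of_runs ht 6 rfl
  have hb := length_le_of_runs ht 7 rfl
  have hk := length_le_of_runs ht 8 rfl
  have hs := length_le_of_runs ht 3 rfl
  have hH := length_le_of_runs ht 9 rfl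
  simp only [after, cfg_E, cfg_Bg, cfg_base, cfg_k, cfg_s, cfg_H, List.append_nil,
    List.length_reverse, List.length_replicate] at hE hBg hb hk hs hH
  -- The sizes of all strings that `emitGadgets` produces are bounded by its running time `t`.
  obtain ⟨t', ht', hle'⟩ := h' (t + 1) _ _ ⟨_, _, rfl, rfl, _, _, _, _, _, _, hb.trans (by omega),
    hk.trans (by omega), hs.trans (by omega), hH.trans (by omega), Nat.lt_succ_of_le hE,
    Nat.lt_succ_of_le hBg, rfl, rfl⟩
  refine ⟨t + t', ?_, ?_⟩
  · have e1 : 1 ≤ (B + 1) ^ j := Nat.one_le_pow _ _ (by omega)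
    have e2 : t + 1 + 1 ≤ (K + 3) * (B + 1) ^ j := by nlinarith
    have e3 : (t + 1 + 1) ^ j' ≤ ((K + 3) * (B + 1) ^ j) ^ j' := Nat.pow_le_pow_left e2 _
    rw [mul_pow, ← pow_mul] at e3
    have e4 : (B + 1) ^ j ≤ (B + 1) ^ (j + j * j') := Nat.pow_le_pow_right (by omega) (by omega)
    have e5 : (B + 1) ^ (j * j') ≤ (B + 1) ^ (j + j * j') :=
      Nat.pow_le_pow_right (by omega) (by omega)
    calc t + t' ≤ K * (B + 1) ^ j + K' * ((K + 3) ^ j' * (B + 1) ^ (j * j')) :=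
          add_le_add hle (hle'.trans (Nat.mul_le_mul_left _ e3))
      _ ≤ K * (B + 1) ^ (j + j * j') + K' * ((K + 3) ^ j' * (B + 1) ^ (j + j * j')) := by gcongr
      _ = _ := by ring
  · rw [← cfg_eq_initial, ← cfg_eq_initial]
    convert Runs.seq ht (s₂ := cfg { io := output l T T' n Cs }) (q := assemble) (t₂ := t') ?_
    convert ht' using 1
    · simp [after]
    · simp [output, encList]

end ETHLower

namespace ETHLower

/-! ### The graph of the gadgets -/

/-- The edges of a gadget whose threads have length `len`. The thread `t` is the path
`A t, thr t 0, …, thr t (len - 2), B t`. The three vertices `thr t 0` are pairwise adjacent, and for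
each `s` the two of them with `t ≠ s` are also joined by the connector `con s 0, …, con s (l - 3)`,
which completes their edge to a cycle of length `l`. -/
inductive TEdge (l len : ℕ) : Loc → Loc → Prop
  | first (t : Fin 3) : TEdge l len (.A t) (.thr t 0)
  | thread (t : Fin 3) (p : ℕ) : p + 2 < len → TEdge l len (.thr t p) (.thr t (p + 1))
  | last (t : Fin 3) : TEdge l len (.thr t (len - 2)) (.B t)
  | tri (t : Fin 3) : TEdge l len (.thr (t + 1) 0) (.thr (t + 2) 0)
  | conFirst (t : Fin 3) : TEdge l len (.thr (t + 1) 0) (.con t 0)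
  | con (t : Fin 3) (p : ℕ) : p + 3 < l → TEdge l len (.con t p) (.con t (p + 1))
  | conLast (t : Fin 3) : TEdge l len (.con t (l - 3)) (.thr (t + 2) 0)

/-- The vertices of the constructed graph: hubs, and the inner vertices of the threads and the
connectors of the gadget `g`. -/
inductive Vtx : Type
  | hub (i : ℕ) : Vtx
  | thr (g : ℕ) (t : Fin 3) (p : ℕ) : Vtx
  | con (g : ℕ) (t : Fin 3) (p : ℕ) : Vtx
  deriving DecidableEq

/-- The vertex of the graph that is given by a place in the gadget `g`; the thread `t` of `g` joins
the hubs `a g t` and `b g t`. -/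
def glob (a b : ℕ → Fin 3 → ℕ) (g : ℕ) : Loc → Vtx
  | .A t => .hub (a g t)
  | .B t => .hub (b g t)
  | .thr t p => .thr g t p
  | .con t p => .con g t p

/-- The edges, with an orientation, of the graph that consists of `M` gadgets, the threads of the
gadget `g` having length `len g`. -/
def GEdge (l M : ℕ) (len : ℕ → ℕ) (a b : ℕ → Fin 3 → ℕ) (u v : Vtx) : Prop :=
  ∃ g < M, ∃ x y, TEdge l (len g) x y ∧ u = glob a b g x ∧ v = glob a b g y

/-- Adjacency in the graph of the gadgets. -/
def GAdj (l M : ℕ) (len : ℕ → ℕ) (a b : ℕ → Fin 3 → ℕ) (u v : Vtx) : Prop :=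
  GEdge l M len a b u v ∨ GEdge l M len a b v u

variable {l M : ℕ} {len : ℕ → ℕ} {a b : ℕ → Fin 3 → ℕ}

theorem GAdj.symm {u v : Vtx} (h : GAdj l M len a b u v) : GAdj l M len a b v u := Or.symm h

theorem GAdj.con {g p : ℕ} {t : Fin 3} {v : Vtx} (h : GAdj l M len a b (.con g t p) v) :
    g < M ∧ ((p = 0 ∧ v = .thr g (t + 1) 0) ∨ (p + 3 < l ∧ v = .con g t (p + 1)) ∨
      (∃ q, p = q + 1 ∧ q + 3 < l ∧ v = .con g t q) ∨ (p = l - 3 ∧ v = .thr g (t + 2) 0)) := by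
  rcases h with ⟨g', hg, x, y, h, h1, h2⟩ | ⟨g', hg, x, y, h, h2, h1⟩ <;> cases h <;>
    simp only [glob, Vtx.con.injEq, reduceCtorEq] at h1 h2 <;> obtain ⟨rfl, rfl, rfl⟩ := h1 <;>
    subst h2 <;> refine ⟨hg, ?_⟩ <;> simp_all

theorem GAdj.thr_succ {g p : ℕ} {t : Fin 3} {v : Vtx}
    (h : GAdj l M len a b (.thr g t (p + 1)) v) :
    g < M ∧ ((v = .thr g t p ∧ p + 2 < len g) ∨ (p + 3 < len g ∧ v = .thr g t (p + 2)) ∨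
      (p + 1 = len g - 2 ∧ v = .hub (b g t))) := by
  rcases h with ⟨g', hg, x, y, h, h1, h2⟩ | ⟨g', hg, x, y, h, h2, h1⟩ <;> cases h <;>
    simp only [glob, Vtx.thr.injEq, reduceCtorEq, Nat.add_right_cancel_iff, Nat.add_eq_zero_iff,
      one_ne_zero, and_false] at h1 h2 <;>
    obtain ⟨rfl, rfl, h1⟩ := h1 <;>
    subst h2 <;> refine ⟨hg, ?_⟩ <;> (simp_all; try omega)

theorem GAdj.thr_zero {g : ℕ} {t : Fin 3} {v : Vtx} (h : GAdj l M len a b (.thr g t 0) v) :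
    g < M ∧ (v = .hub (a g t) ∨ (2 < len g ∧ v = .thr g t 1) ∨
      (len g - 2 = 0 ∧ v = .hub (b g t)) ∨ (∃ t' p, v = .con g t' p) ∨
      (∃ t', t' ≠ t ∧ v = .thr g t' 0)) := by
  rcases h with ⟨g', hg, x, y, h, h1, h2⟩ | ⟨g', hg, x, y, h, h2, h1⟩ <;> cases h <;>
    simp only [glob, Vtx.thr.injEq, reduceCtorEq] at h1 h2 <;>
    obtain ⟨rfl, rfl, h1⟩ := h1 <;>
    subst h2 <;> refine ⟨hg, ?_⟩ <;> (simp_all; try omega)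

theorem GAdj.hub {i : ℕ} {v : Vtx} (h : GAdj l M len a b (.hub i) v) :
    ∃ g < M, ∃ t, (i = a g t ∧ v = .thr g t 0) ∨ (i = b g t ∧ v = .thr g t (len g - 2)) := by
  rcases h with ⟨g', hg, x, y, h, h1, h2⟩ | ⟨g', hg, x, y, h, h2, h1⟩ <;> cases h <;>
    simp only [glob, Vtx.hub.injEq, reduceCtorEq] at h1 h2 <;>
    subst h1 h2 <;>
    first | exact ⟨g', hg, _, .inl ⟨rfl, rfl⟩⟩ | exact ⟨g', hg, _, .inr ⟨rfl, rfl⟩⟩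

theorem gAdj_of {g : ℕ} (hg : g < M) {x y : Loc} (h : TEdge l (len g) x y) :
    GAdj l M len a b (glob a b g x) (glob a b g y) := .inl ⟨g, hg, x, y, h, rfl, rfl⟩

/-! ### Sets of vertices of minimum degree two -/

/-- A set `W` of vertices that contains at least two neighbors of each of its elements, and that
avoids the first vertices of all threads but one of each gadget. -/
structure Core (l M : ℕ) (len : ℕ → ℕ) (a b : ℕ → Fin 3 → ℕ) (κ : ℕ → Fin 3) (W : Finset Vtx) :
    Prop where
  degree : ∀ v ∈ W, ∀ z, ∃ x ∈ W, x ≠ z ∧ GAdj l M len a b v x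
  kept : ∀ g < M, ∀ t ≠ κ g, .thr g t 0 ∉ W

variable {κ : ℕ → Fin 3} {W : Finset Vtx}

/-- One of the two ends of a connector is not kept, so a core cannot contain the connector. -/
theorem Core.con_notMem (h : Core l M len a b κ W) (hl : 5 ≤ l) (g : ℕ) (t : Fin 3) (p : ℕ) :
    .con g t p ∉ W := by
  intro hW
  obtain ⟨_, -, -, hadj⟩ := h.degree _ hW (.hub 0)
  have hg := hadj.con.1
  have hbound : ∀ p, Vtx.con g t p ∈ W → p + 3 ≤ l := by
    intro p hp
    obtain ⟨_, -, -, hadj⟩ := h.degree _ hp (.hub 0)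
    rcases hadj.con.2 with h | h | ⟨q, h⟩ | h <;> omega
  by_cases e : t + 1 = κ g
  · have e' : t + 2 ≠ κ g := by
      rw [← e]
      exact (by decide : ∀ t : Fin 3, t + 2 ≠ t + 1) t
    have key : ∀ q p, p + 3 + q = l → Vtx.con g t p ∉ W := by
      intro q
      induction q with
      | zero =>
        intro p hp hpW
        obtain ⟨x, hx, hne, hadj⟩ := h.degree _ hpW (.con g t (p - 1))
        rcases hadj.con.2 with h' | h' | ⟨q, rfl, -, rfl⟩ | ⟨-, rfl⟩
        · omega
        · omega
        · exact hne rfl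
        · exact h.kept g hg _ e' hx
      | succ q ih =>
        intro p hp hpW
        obtain ⟨x, hx, hne, hadj⟩ := h.degree _ hpW
          (if p = 0 then .thr g (t + 1) 0 else .con g t (p - 1))
        rcases hadj.con.2 with ⟨rfl, rfl⟩ | ⟨-, rfl⟩ | ⟨q, rfl, -, rfl⟩ | h'
        · simp at hne
        · exact ih (p + 1) (by omega) hx
        · simp at hne
        · omega
    exact key (l - 3 - p) p (by have := hbound p hW; omega) hW
  · have key : ∀ p, Vtx.con g t p ∉ W := by
      intro p
      induction p with
      | zero =>
        intro hpW
        obtain ⟨x, hx, hne, hadj⟩ := h.degree _ hpW (.con g t 1)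
        rcases hadj.con.2 with ⟨-, rfl⟩ | ⟨-, rfl⟩ | ⟨q, h', -⟩ | h'
        · exact h.kept g hg _ e hx
        · exact hne rfl
        · omega
        · omega
      | succ p ih =>
        intro hpW
        obtain ⟨x, hx, hne, hadj⟩ := h.degree _ hpW
          (if p + 1 = l - 3 then .thr g (t + 2) 0 else .con g t (p + 2))
        rcases hadj.con.2 with ⟨h', -⟩ | ⟨h', rfl⟩ | ⟨q, h', -, rfl⟩ | ⟨h', rfl⟩
        · omega
        · rw [if_neg (by omega)] at hne; exact hne rfl
        · obtain rfl : p = q := by omega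
          exact ih hx
        · rw [if_pos h'] at hne; exact hne rfl
    exact key p hW

theorem Core.thr_notMem (h : Core l M len a b κ W) {g : ℕ} (hg : g < M) {t : Fin 3}
    (ht : t ≠ κ g) (p : ℕ) : .thr g t p ∉ W := by
  induction p with
  | zero => exact h.kept g hg t ht
  | succ p ih =>
    intro hW
    obtain ⟨x, hx, hne, hadj⟩ := h.degree _ hW
      (if p + 1 = len g - 2 then .hub (b g t) else .thr g t (p + 2))
    rcases hadj.thr_succ.2 with ⟨rfl, -⟩ | ⟨h', rfl⟩ | ⟨h', rfl⟩
    · exact ih hx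
    · rw [if_neg (by omega)] at hne; exact hne rfl
    · rw [if_pos h'] at hne; exact hne rfl

/-- A core that meets a thread contains the whole thread together with its two hubs. -/
theorem Core.used (h : Core l M len a b κ W) (hl : 5 ≤ l) (hlen : ∀ g, 2 ≤ len g) {g p : ℕ}
    {t : Fin 3} (hW : .thr g t p ∈ W) :
    g < M ∧ t = κ g ∧ (∀ q, q + 2 ≤ len g → .thr g t q ∈ W) ∧ .hub (a g t) ∈ W ∧
      .hub (b g t) ∈ W := by
  have hg : g < M := by
    obtain ⟨_, -, -, hadj⟩ := h.degree _ hW (.hub 0)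
    cases p with
    | zero => exact hadj.thr_zero.1
    | succ p => exact hadj.thr_succ.1
  have ht : t = κ g := by
    by_contra ht
    exact h.thr_notMem hg ht p hW
  have hcon := h.con_notMem hl g
  have hthr : ∀ t' ≠ t, Vtx.thr g t' 0 ∉ W := fun t' ht' => h.kept g hg t' (by rwa [← ht])
  have down : ∀ q, Vtx.thr g t (q + 1) ∈ W → Vtx.thr g t q ∈ W := by
    intro q hq
    obtain ⟨x, hx, hne, hadj⟩ := h.degree _ hq
      (if q + 1 = len g - 2 then .hub (b g t) else .thr g t (q + 2))
    rcases hadj.thr_succ.2 with ⟨rfl, -⟩ | ⟨h', rfl⟩ | ⟨h', rfl⟩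
    · exact hx
    · rw [if_neg (by omega)] at hne; exact absurd rfl hne
    · rw [if_pos h'] at hne; exact absurd rfl hne
  have h0 : Vtx.thr g t 0 ∈ W := by
    clear hg ht
    induction p with
    | zero => exact hW
    | succ p ih => exact ih (down p hW)
  have up : ∀ q, q + 2 < len g → Vtx.thr g t q ∈ W → Vtx.thr g t (q + 1) ∈ W := by
    intro q hq hqW
    cases q with
    | zero =>
      obtain ⟨x, hx, hne, hadj⟩ := h.degree _ hqW (.hub (a g t))
      rcases hadj.thr_zero.2 with rfl | ⟨-, rfl⟩ | ⟨h', -⟩ | ⟨t', p, rfl⟩ | ⟨t', ht', rfl⟩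
      · exact absurd rfl hne
      · exact hx
      · omega
      · exact absurd hx (hcon _ _)
      · exact absurd hx (hthr t' ht')
    | succ q =>
      obtain ⟨x, hx, hne, hadj⟩ := h.degree _ hqW (.thr g t q)
      rcases hadj.thr_succ.2 with ⟨rfl, -⟩ | ⟨h', rfl⟩ | ⟨h', rfl⟩
      · exact absurd rfl hne
      · exact hx
      · omega
  have hall : ∀ q, q + 2 ≤ len g → Vtx.thr g t q ∈ W := by
    intro q
    induction q with
    | zero => exact fun _ => h0
    | succ q ih => exact fun hq => up q (by omega) (ih (by omega))
  have h2 := hlen g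
  refine ⟨hg, ht, hall, ?_, ?_⟩
  · obtain ⟨x, hx, hne, hadj⟩ := h.degree _ h0
      (if len g - 2 = 0 then .hub (b g t) else .thr g t 1)
    rcases hadj.thr_zero.2 with rfl | ⟨h', rfl⟩ | ⟨h', rfl⟩ | ⟨t', p, rfl⟩ | ⟨t', ht', rfl⟩
    · exact hx
    · rw [if_neg (by omega)] at hne; exact absurd rfl hne
    · rw [if_pos h'] at hne; exact absurd rfl hne
    · exact absurd hx (hcon _ _)
    · exact absurd hx (hthr t' ht')
  · have hlast := hall (len g - 2) (by omega)
    obtain ⟨q, hq⟩ : ∃ q, q = len g - 2 := ⟨_, rfl⟩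
    rw [← hq] at hlast
    cases q with
    | zero =>
      obtain ⟨x, hx, hne, hadj⟩ := h.degree _ hlast (.hub (a g t))
      rcases hadj.thr_zero.2 with rfl | ⟨h', rfl⟩ | ⟨h', rfl⟩ | ⟨t', p, rfl⟩ | ⟨t', ht', rfl⟩
      · exact absurd rfl hne
      · omega
      · exact hx
      · exact absurd hx (hcon _ _)
      · exact absurd hx (hthr t' ht')
    | succ q =>
      obtain ⟨x, hx, hne, hadj⟩ := h.degree _ hlast (.thr g t q)
      rcases hadj.thr_succ.2 with ⟨rfl, -⟩ | ⟨h', rfl⟩ | ⟨h', rfl⟩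
      · exact absurd rfl hne
      · omega
      · exact hx

/-- A core contains at least the threads of a set `D` of gadgets and a set `Hs` of hubs. -/
theorem Core.card_le (h : Core l M len a b κ W) (hl : 5 ≤ l) (hlen : ∀ g, 2 ≤ len g)
    {D Hs : Finset ℕ} (hD : ∀ g ∈ D, .thr g (κ g) 0 ∈ W) (hH : ∀ i ∈ Hs, .hub i ∈ W) :
    ∑ g ∈ D, (len g - 1) + Hs.card ≤ W.card := by
  let A : Finset Vtx := (D.sigma fun g => Finset.range (len g - 1)).image
    fun x => .thr x.1 (κ x.1) x.2
  let A' : Finset Vtx := Hs.image .hub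
  have hA : A.card = ∑ g ∈ D, (len g - 1) := by
    rw [Finset.card_image_of_injOn, Finset.card_sigma]
    · simp
    · rintro ⟨g, p⟩ - ⟨g', p'⟩ - e
      simp only [Vtx.thr.injEq] at e
      obtain ⟨rfl, -, rfl⟩ := e
      rfl
  have hA' : A'.card = Hs.card :=
    Finset.card_image_of_injective _ fun x y e => by simpa using e
  rw [← hA, ← hA', ← Finset.card_union_of_disjoint]
  · refine Finset.card_le_card (Finset.union_subset ?_ ?_)
    · intro v hv
      obtain ⟨⟨g, p⟩, hx, rfl⟩ := Finset.mem_image.1 hv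
      rw [Finset.mem_sigma, Finset.mem_range] at hx
      have := hlen g
      exact (h.used hl hlen (hD g hx.1)).2.2.1 p (by have := hx.2; dsimp only at *; omega)
    · intro v hv
      obtain ⟨i, hi, rfl⟩ := Finset.mem_image.1 hv
      exact hH i hi
  · rw [Finset.disjoint_left]
    intro v hv hv'
    obtain ⟨_, -, rfl⟩ := Finset.mem_image.1 hv
    obtain ⟨_, -, e⟩ := Finset.mem_image.1 hv'
    simp at e

/-- A core is either empty or has more than `l` elements, if no two parallel threads are too
short. -/
theorem Core.lt_card (h : Core l M len a b κ W) (hl : 5 ≤ l) (hlen : ∀ g, 2 ≤ len g)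
    (hlen' : ∀ g, l < 4 * len g) {S : ℕ} (hab : ∀ g g' t t', a g t < S ∧ S ≤ b g' t')
    (hpar : ∀ g < M, ∀ g' < M, g ≠ g' → a g (κ g) = a g' (κ g') → b g (κ g) = b g' (κ g') →
      l < len g + len g') (hW : W.Nonempty) : l < W.card := by
  have hhubA : ∀ g, .thr g (κ g) 0 ∈ W → ∃ g', g' ≠ g ∧ .thr g' (κ g') 0 ∈ W ∧
      a g' (κ g') = a g (κ g) := by
    intro g hg
    obtain ⟨-, -, -, hgW, -⟩ := h.used hl hlen hg
    obtain ⟨x, hx, hne, hadj⟩ := h.degree _ hgW (.thr g (κ g) 0)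
    obtain ⟨g', -, t, ⟨e, rfl⟩ | ⟨e, rfl⟩⟩ := hadj.hub
    · obtain ⟨-, rfl, -⟩ := h.used hl hlen hx
      exact ⟨g', fun e => hne (by rw [e]), hx, e.symm⟩
    · have := hab g g' (κ g) t; omega
  have hhubB : ∀ g, .thr g (κ g) 0 ∈ W → ∃ g', g' ≠ g ∧ .thr g' (κ g') 0 ∈ W ∧
      b g' (κ g') = b g (κ g) := by
    intro g hg
    obtain ⟨-, -, -, -, hgW⟩ := h.used hl hlen hg
    obtain ⟨x, hx, hne, hadj⟩ := h.degree _ hgW (.thr g (κ g) (len g - 2))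
    obtain ⟨g', -, t, ⟨e, rfl⟩ | ⟨e, rfl⟩⟩ := hadj.hub
    · have := hab g' g t (κ g); omega
    · obtain ⟨-, rfl, h', -⟩ := h.used hl hlen hx
      exact ⟨g', fun e => hne (by rw [e]), h' 0 (by have := hlen g'; omega), e.symm⟩
  have hlt : ∀ g, .thr g (κ g) 0 ∈ W → g < M := fun g hg => (h.used hl hlen hg).1
  have hA : ∀ g, .thr g (κ g) 0 ∈ W → .hub (a g (κ g)) ∈ W := fun g hg =>
    (h.used hl hlen hg).2.2.2.1
  have hB : ∀ g, .thr g (κ g) 0 ∈ W → .hub (b g (κ g)) ∈ W := fun g hg =>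
    (h.used hl hlen hg).2.2.2.2
  have par : ∀ g g', .thr g (κ g) 0 ∈ W → .thr g' (κ g') 0 ∈ W → g ≠ g' →
      a g (κ g) = a g' (κ g') → b g (κ g) = b g' (κ g') → l < W.card := by
    intro g g' hg hg' hne ea eb
    have h1 := h.card_le hl hlen (D := {g, g'}) (Hs := {a g (κ g), b g (κ g)})
      (by simp [hg, hg']) (by simp [hA g hg, hB g hg])
    rw [Finset.sum_pair hne, Finset.card_pair (by have := hab g g (κ g) (κ g); omega)] at h1
    have h2 := hpar g (hlt g hg) g' (hlt g' hg') hne ea eb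
    have := hlen g
    have := hlen g'
    omega
  obtain ⟨g₁, hg₁⟩ : ∃ g, Vtx.thr g (κ g) 0 ∈ W := by
    obtain ⟨v, hv⟩ := hW
    have hthr : ∀ g t p, Vtx.thr g t p ∈ W → Vtx.thr g (κ g) 0 ∈ W := by
      intro g t p hW
      obtain ⟨-, rfl, h', -⟩ := h.used hl hlen hW
      exact h' 0 (by have := hlen g; omega)
    cases v with
    | hub i =>
      obtain ⟨x, hx, -, hadj⟩ := h.degree _ hv (.hub 0)
      obtain ⟨g', -, t, ⟨e, rfl⟩ | ⟨e, rfl⟩⟩ := hadj.hub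
      · exact ⟨_, hthr _ _ _ hx⟩
      · exact ⟨_, hthr _ _ _ hx⟩
    | thr g t p => exact ⟨_, hthr _ _ _ hv⟩
    | con g t p => exact absurd hv (h.con_notMem hl g t p)
  obtain ⟨g₂, h21, hg₂, ea⟩ := hhubA g₁ hg₁
  obtain ⟨g₃, h31, hg₃, eb⟩ := hhubB g₁ hg₁
  -- At each of its hubs the thread of `g₁` meets another thread of the core. Either one of these is
  -- parallel to it, or there is a further thread `g₄`, and four threads with four hubs have at least
  -- as many vertices as the sum of the lengths of the threads.
  by_cases hb : b g₂ (κ g₂) = b g₁ (κ g₁)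
  · exact par g₂ g₁ hg₂ hg₁ h21 ea hb
  by_cases ha : a g₃ (κ g₃) = a g₁ (κ g₁)
  · exact par g₃ g₁ hg₃ hg₁ h31 ha eb
  obtain ⟨g₄, h42, hg₄, eb'⟩ := hhubB g₂ hg₂
  have h23 : g₂ ≠ g₃ := by rintro rfl; exact hb eb
  have h41 : g₄ ≠ g₁ := by rintro rfl; exact hb eb'.symm
  have h43 : g₄ ≠ g₃ := by rintro rfl; exact hb (by rw [← eb', eb])
  have h1 := h.card_le hl hlen (D := {g₁, g₂, g₃, g₄})
    (Hs := {a g₁ (κ g₁), a g₃ (κ g₃), b g₁ (κ g₁), b g₂ (κ g₂)})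
    (by simp [hg₁, hg₂, hg₃, hg₄]) (by simp [hA, hB, hg₁, hg₂, hg₃])
  have n1 := hab g₁ g₁ (κ g₁) (κ g₁)
  have n2 := hab g₁ g₂ (κ g₁) (κ g₂)
  have n3 := hab g₃ g₁ (κ g₃) (κ g₁)
  have n4 := hab g₃ g₂ (κ g₃) (κ g₂)
  rw [Finset.sum_insert (by simp [h21.symm, h31.symm, h41.symm]),
    Finset.sum_insert (by simp [h23, h42.symm]), Finset.sum_pair h43.symm,
    Finset.card_insert_of_notMem (by simp; omega), Finset.card_insert_of_notMem (by simp; omega),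
    Finset.card_pair (Ne.symm hb)] at h1
  have m1 := hlen' g₁
  have m2 := hlen' g₂
  have m3 := hlen' g₃
  have m4 := hlen' g₄
  have m1 := hlen g₁
  have m2 := hlen g₂
  have m3 := hlen g₃
  have m4 := hlen g₄
  omega

end ETHLower

namespace ETHLower

variable {l M : ℕ} {len : ℕ → ℕ} {a b : ℕ → Fin 3 → ℕ} {X : Finset Vtx}

/-! ### Hitting all cycles of length `l` -/

/-- A set `X` of vertices that meets all cycles of length `l`. A cycle is given by the sequence of
its vertices. -/
def Hits (l M : ℕ) (len : ℕ → ℕ) (a b : ℕ → Fin 3 → ℕ) (X : Finset Vtx) : Prop :=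
  ∀ c : ℕ → Vtx, (∀ i < l, ∀ j < l, c i = c j → i = j) →
    (∀ i, i + 1 < l → GAdj l M len a b (c i) (c (i + 1))) →
    GAdj l M len a b (c (l - 1)) (c 0) → ∃ i < l, c i ∈ X

/-- A connector and the edge between its ends form a cycle of length `l`, which is hit. -/
theorem Hits.connector (h : Hits l M len a b X) (hl : 5 ≤ l) {g : ℕ} (hg : g < M) (t : Fin 3) :
    ∃ v ∈ X, (∃ p, v = .con g t p) ∨ ∃ s, s ≠ t ∧ v = .thr g s 0 := by
  have ht : ∀ t : Fin 3, t + 1 ≠ t ∧ t + 2 ≠ t ∧ t + 1 ≠ t + 2 := by decide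
  have key := h (fun i => if i = 0 then .thr g (t + 1) 0 else
    if i + 1 < l then .con g t (i - 1) else .thr g (t + 2) 0) ?_ ?_ ?_
  · obtain ⟨i, hi, hX⟩ := key
    refine ⟨_, hX, ?_⟩
    split_ifs
    · exact .inr ⟨_, (ht t).1, rfl⟩
    · exact .inl ⟨_, rfl⟩
    · exact .inr ⟨_, (ht t).2.1, rfl⟩
  · intro i hi j hj e
    split_ifs at e <;> simp only [Vtx.thr.injEq, Vtx.con.injEq, ht, and_false,
      and_true, true_and] at e <;> omega
  · intro i hi
    rw [if_neg (Nat.succ_ne_zero i)]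
    by_cases h0 : i = 0
    · subst h0
      rw [if_pos rfl, if_pos (by omega)]
      exact gAdj_of hg (.conFirst t)
    · rw [if_neg h0, if_pos hi]
      by_cases h1 : i + 1 + 1 < l
      · rw [if_pos h1]
        obtain ⟨i, rfl⟩ := Nat.exists_eq_succ_of_ne_zero h0
        exact gAdj_of hg (.con t i (by omega))
      · rw [if_neg h1, show i - 1 = l - 3 by omega]
        exact gAdj_of hg (.conLast t)
  · rw [if_neg (by omega), if_neg (by omega), if_pos rfl]
    exact (gAdj_of hg (.tri t)).symm

/-- Two parallel threads whose lengths sum up to `l` form a cycle, and thus are hit. -/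
theorem Hits.parallel (h : Hits l M len a b X) (hlen : ∀ g, 2 ≤ len g)
    {S : ℕ} (hab : ∀ g g' t t', a g t < S ∧ S ≤ b g' t') {g g' : ℕ} (hg : g < M) (hg' : g' < M)
    (hne : g ≠ g') {t t' : Fin 3} (hl : len g + len g' = l) (ha : a g t = a g' t')
    (hb : b g t = b g' t') :
    ∃ v ∈ X, (∃ i, v = .hub i) ∨ (∃ p, v = .thr g t p) ∨ ∃ p, v = .thr g' t' p := by
  have h1 := hlen g
  have h2 := hlen g'
  have h3 := hab g g t t
  have key := h (fun i => if i = 0 then .hub (a g t) else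
    if i < len g then .thr g t (i - 1) else
      if i = len g then .hub (b g t) else .thr g' t' (l - 1 - i)) ?_ ?_ ?_
  · obtain ⟨i, hi, hX⟩ := key
    refine ⟨_, hX, ?_⟩
    split_ifs
    · exact .inl ⟨_, rfl⟩
    · exact .inr (.inl ⟨_, rfl⟩)
    · exact .inl ⟨_, rfl⟩
    · exact .inr (.inr ⟨_, rfl⟩)
  · intro i hi j hj e
    split_ifs at e <;> simp only [Vtx.thr.injEq, Vtx.hub.injEq, hne, hne.symm, false_and,
      true_and] at e <;> omega
  · intro i hi
    rw [if_neg (Nat.succ_ne_zero i)]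
    by_cases h0 : i = 0
    · subst h0
      rw [if_pos rfl, if_pos (by omega)]
      exact gAdj_of hg (.first t)
    rw [if_neg h0]
    by_cases e1 : i + 1 < len g
    · rw [if_pos (by omega), if_pos e1]
      obtain ⟨i, rfl⟩ := Nat.exists_eq_succ_of_ne_zero h0
      exact gAdj_of hg (.thread t i (by omega))
    rw [if_neg e1]
    by_cases e2 : i + 1 = len g
    · rw [if_pos (by omega), if_pos e2, show i - 1 = len g - 2 by omega]
      exact gAdj_of hg (.last t)
    rw [if_neg e2, if_neg (by omega)]
    by_cases e3 : i = len g
    · rw [if_pos e3, hb, show l - 1 - (i + 1) = len g' - 2 by omega]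
      exact (gAdj_of hg' (.last t')).symm
    · rw [if_neg e3, show l - 1 - i = l - 1 - (i + 1) + 1 by omega]
      exact (gAdj_of hg' (.thread t' _ (by omega))).symm
  · rw [if_neg (by omega), if_neg (by omega), if_neg (by omega), if_pos rfl, ha, Nat.sub_self]
    exact (gAdj_of hg' (.first t')).symm

/-- The gadget to which a vertex belongs; the hubs are assigned the number `M`. -/
def gadgetOf (M : ℕ) : Vtx → ℕ
  | .hub _ => M
  | .thr g _ _ => g
  | .con g _ _ => g

/-- No vertex other than those that belong to the gadget hits its connector cycles, and no single
vertex hits all three of them. -/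
theorem Hits.two_le (h : Hits l M len a b X) (hl : 5 ≤ l) {g : ℕ} (hg : g < M) :
    2 ≤ (X.filter fun v => gadgetOf M v = g).card := by
  by_contra! hc
  have hc := Finset.card_le_one.1 (Nat.le_of_lt_succ hc)
  choose x hx hx' using fun t => h.connector hl hg t
  have hmem : ∀ t, x t ∈ X.filter fun v => gadgetOf M v = g := by
    intro t
    refine Finset.mem_filter.2 ⟨hx t, ?_⟩
    rcases hx' t with ⟨p, e⟩ | ⟨s, -, e⟩ <;> rw [e] <;> rfl
  have heq : ∀ t, x t = x 0 := fun t => hc _ (hmem t) _ (hmem 0)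
  rcases hx' 0 with ⟨p, e⟩ | ⟨s, -, e⟩
  · rcases hx' 1 with ⟨q, e'⟩ | ⟨s, -, e'⟩ <;> rw [heq, e] at e' <;> simp at e'
  · rcases hx' s with ⟨q, e'⟩ | ⟨s', hne, e'⟩ <;> rw [heq, e] at e' <;> simp at e'
    exact hne e'.symm

/-- A set of at most `2 * M` vertices that hits all cycles of length `l` contains no hub, and leaves
at least one thread of each gadget untouched. -/
theorem Hits.exists_kept (h : Hits l M len a b X) (hl : 5 ≤ l) (hX : X.card ≤ 2 * M) :
    (∀ i, .hub i ∉ X) ∧ ∃ κ : ℕ → Fin 3, ∀ g < M, ∀ p, .thr g (κ g) p ∉ X := by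
  have hsum : ∑ g ∈ Finset.range (M + 1), (X.filter fun v => gadgetOf M v = g).card ≤ 2 * M := by
    rw [Finset.sum_card_fiberwise_eq_card_filter]
    exact (Finset.card_filter_le _ _).trans hX
  have h2 : ∑ g ∈ Finset.range M, 2 = 2 * M := by simp [mul_comm]
  rw [Finset.sum_range_succ] at hsum
  have hge : ∀ g ∈ Finset.range M, 2 ≤ (X.filter fun v => gadgetOf M v = g).card := fun g hg =>
    h.two_le hl (Finset.mem_range.1 hg)
  have hge' := Finset.sum_le_sum hge
  refine ⟨?_, ?_⟩
  · intro i hi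
    have : 0 < (X.filter fun v => gadgetOf M v = M).card :=
      Finset.card_pos.2 ⟨_, Finset.mem_filter.2 ⟨hi, rfl⟩⟩
    omega
  · have key : ∀ g, ∃ t : Fin 3, g < M → ∀ p, .thr g t p ∉ X := by
      intro g
      by_contra! hc
      choose hg p hp using hc
      have h3 : 3 ≤ (X.filter fun v => gadgetOf M v = g).card := by
        have e : ((Finset.univ : Finset (Fin 3)).image fun t => Vtx.thr g t (p t)).card = 3 := by
          rw [Finset.card_image_of_injective _ fun t t' e => by simp at e; exact e.1]
          rfl
        rw [← e]
        refine Finset.card_le_card fun v hv => ?_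
        obtain ⟨t, -, rfl⟩ := Finset.mem_image.1 hv
        exact Finset.mem_filter.2 ⟨hp t, rfl⟩
      have := Finset.sum_lt_sum hge ⟨g, Finset.mem_range.2 (hg 0), h3⟩
      omega
    choose κ hκ using key
    exact ⟨κ, hκ⟩

end ETHLower

namespace ETHLower

/-! ### Numbering the vertices -/

/-- All places of a gadget. -/
def places (l : ℕ) : Finset Loc :=
  Finset.univ.image Loc.A ∪ Finset.univ.image Loc.B ∪
    ((Finset.univ ×ˢ Finset.range l).image fun x => Loc.thr x.1 x.2) ∪
    ((Finset.univ ×ˢ Finset.range l).image fun x => Loc.con x.1 x.2)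

open Classical in
/-- The list of the edges of a gadget whose threads have length `len`. -/
noncomputable def template (l len : ℕ) : List (Loc × Loc) :=
  ((places l ×ˢ places l).filter fun e => TEdge l len e.1 e.2).toList

theorem nodup_template (l len : ℕ) : (template l len).Nodup := Finset.nodup_toList _

/-- A place that occurs in an edge of a gadget. -/
def Loc.Valid (l : ℕ) : Loc → Prop
  | .A _ => True
  | .B _ => True
  | .thr _ p => p < l
  | .con _ p => p < l

theorem TEdge.valid {l len : ℕ} {x y : Loc} (h : TEdge l len x y) (hl : 5 ≤ l) (hlen : len ≤ l) :
    x.Valid l ∧ y.Valid l := by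
  cases h <;> simp only [Loc.Valid, true_and, and_true] <;> omega

theorem mem_template {l len : ℕ} (hl : 5 ≤ l) (hlen : len ≤ l) {e : Loc × Loc} :
    e ∈ template l len ↔ TEdge l len e.1 e.2 := by
  have key : ∀ x : Loc, x.Valid l → x ∈ places l := by
    intro x hx
    cases x <;> simp_all [places, Loc.Valid]
  simp only [template, Finset.mem_toList, Finset.mem_filter, Finset.mem_product,
    and_iff_right_iff_imp]
  intro h
  exact ⟨key _ (h.valid hl hlen).1, key _ (h.valid hl hlen).2⟩

/-- The number of a vertex. The numbers below `H` belong to the hubs, and the gadget `g` has a block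
of `6 * l` numbers, `l` for each of its threads and connectors. Some of these numbers are not used
by any edge. -/
def code (l H : ℕ) : Vtx → ℕ
  | .hub i => i
  | .thr g t p => H + 6 * l * g + (t * l + p)
  | .con g t p => H + 6 * l * g + ((3 + t) * l + p)

/-- The vertex with a given number. -/
def decode (l H : ℕ) (x : ℕ) : Vtx :=
  if x < H then .hub x else
    if (x - H) % (6 * l) / l < 3 then
      .thr ((x - H) / (6 * l)) (Fin.ofNat 3 ((x - H) % (6 * l) / l)) ((x - H) % (6 * l) % l)
    else
      .con ((x - H) / (6 * l)) (Fin.ofNat 3 ((x - H) % (6 * l) / l - 3)) ((x - H) % (6 * l) % l)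

theorem code_decode {l : ℕ} (hl : 0 < l) (H x : ℕ) : code l H (decode l H x) = x := by
  unfold decode
  by_cases h : x < H
  · rw [if_pos h]; rfl
  rw [if_neg h]
  have h1 := Nat.div_add_mod (x - H) (6 * l)
  have h2 := Nat.div_add_mod ((x - H) % (6 * l)) l
  have h3 : (x - H) % (6 * l) / l < 6 :=
    Nat.div_lt_of_lt_mul (by rw [mul_comm l 6]; exact Nat.mod_lt _ (by omega))
  rw [mul_comm l] at h2
  split_ifs with h4
  · simp only [code, Fin.ofNat, Nat.mod_eq_of_lt h4]
    omega
  · simp only [code, Fin.ofNat, Nat.mod_eq_of_lt (show (x - H) % (6 * l) / l - 3 < 3 by omega)]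
    rw [show 3 + ((x - H) % (6 * l) / l - 3) = (x - H) % (6 * l) / l by omega]
    omega

theorem block_div_mod {l g r p : ℕ} (hr : r < 6) (hp : p < l) :
    (6 * l * g + (r * l + p)) / (6 * l) = g ∧ (6 * l * g + (r * l + p)) % (6 * l) / l = r ∧
      (6 * l * g + (r * l + p)) % (6 * l) % l = p := by
  have h0 : r * l + p < 6 * l := by nlinarith
  have h1 := (Nat.div_mod_unique (a := 6 * l * g + (r * l + p)) (d := g) (c := r * l + p)
    (by omega : 0 < 6 * l)).2 ⟨by ring, h0⟩
  have h2 := (Nat.div_mod_unique (a := r * l + p) (d := r) (c := p) (by omega : 0 < l)).2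
    ⟨by ring, hp⟩
  rw [h1.1, h1.2]
  exact ⟨rfl, h2⟩

/-- A vertex that has a number. -/
def Vtx.Valid (l H : ℕ) : Vtx → Prop
  | .hub i => i < H
  | .thr _ _ p => p < l
  | .con _ _ p => p < l

theorem decode_code {l H : ℕ} {v : Vtx} (hv : v.Valid l H) : decode l H (code l H v) = v := by
  cases v with
  | hub i => exact if_pos hv
  | thr g t p =>
    have ht := t.isLt
    obtain ⟨h1, h2, h3⟩ := block_div_mod (l := l) (g := g) (r := t) (p := p) (by omega) hv
    have e : code l H (.thr g t p) - H = 6 * l * g + (t * l + p) := by simp only [code]; omega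
    rw [decode, if_neg (by simp only [code]; omega), e, h1, h2, h3, if_pos ht]
    congr 1
    ext; simp [Fin.ofNat, Nat.mod_eq_of_lt ht]
  | con g t p =>
    have ht := t.isLt
    obtain ⟨h1, h2, h3⟩ := block_div_mod (l := l) (g := g) (r := 3 + t) (p := p) (by omega) hv
    have e : code l H (.con g t p) - H = 6 * l * g + ((3 + t) * l + p) := by
      simp only [code]; omega
    rw [decode, if_neg (by simp only [code]; omega), e, h1, h2, h3, if_neg (by omega)]
    congr 1
    ext; simp [Fin.ofNat, Nat.mod_eq_of_lt ht]

theorem decode_injective {l : ℕ} (hl : 0 < l) (H : ℕ) : Function.Injective (decode l H) :=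
  Function.LeftInverse.injective (code_decode hl H)

variable {l M : ℕ} {len : ℕ → ℕ} {a b : ℕ → Fin 3 → ℕ}

theorem Loc.Valid.glob {x : Loc} (hx : x.Valid l) {H g : ℕ} (ha : ∀ g t, a g t < H)
    (hb : ∀ g t, b g t < H) : (glob a b g x).Valid l H := by
  cases x
  · exact ha _ _
  · exact hb _ _
  · exact hx
  · exact hx

theorem code_glob_mem {x : Loc} (hx : x.Valid l) {H g : ℕ} (ha : ∀ g t, a g t < H)
    (hb : ∀ g t, b g t < H) : code l H (glob a b g x) < H ∨
      (H + 6 * l * g ≤ code l H (glob a b g x) ∧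
        code l H (glob a b g x) < H + 6 * l * g + 6 * l) := by
  cases x with
  | A t => exact .inl (ha _ _)
  | B t => exact .inl (hb _ _)
  | thr t p =>
    have hx : p < l := hx
    have := t.isLt
    refine .inr ⟨by simp only [code, ETHLower.glob]; omega, ?_⟩
    simp only [code, ETHLower.glob]
    nlinarith
  | con t p =>
    have hx : p < l := hx
    have := t.isLt
    refine .inr ⟨by simp only [code, ETHLower.glob]; omega, ?_⟩
    simp only [code, ETHLower.glob]
    nlinarith

/-- An edge determines its gadget and its place in the gadget, since one of its ends is not a
hub. -/
theorem glob_injOn {g g' k k' : ℕ} {x y x' y' : Loc} (h : TEdge l k x y) (h' : TEdge l k' x' y')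
    (h₁ : glob a b g x = glob a b g' x') (h₂ : glob a b g y = glob a b g' y') :
    g = g' ∧ x = x' ∧ y = y' := by
  cases h <;> cases h' <;> simp_all [glob]

theorem gEdge_asymm (hab : ∀ g g' t t', a g t ≠ b g' t') {u v : Vtx}
    (h : GEdge l M len a b u v) : ¬ GEdge l M len a b v u := by
  obtain ⟨g, -, x, y, h, rfl, rfl⟩ := h
  rintro ⟨g', -, x', y', h', h1, h2⟩
  have key : ∀ t t' : Fin 3, t + 1 = t' + 2 → t + 2 ≠ t' + 1 := by decide
  cases h <;> cases h' <;>
    simp only [glob, Vtx.thr.injEq, Vtx.con.injEq, Vtx.hub.injEq, reduceCtorEq] at h1 h2 <;>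
    first
      | exact hab _ _ _ _ h1
      | exact hab _ _ _ _ h2
      | exact hab _ _ _ _ h1.symm
      | exact hab _ _ _ _ h2.symm
      | exact key _ _ h1.2.1 h2.2.1
      | omega

theorem gEdge_irrefl {v : Vtx} : ¬ GEdge l M len a b v v := by
  rintro ⟨g, -, x, y, h, h1, h2⟩
  have e := h1.symm.trans h2
  cases h <;> simp [glob] at e

end ETHLower

namespace ETHLower

/-! ### The graph of a formula -/

/-- The length of the threads in the gadgets of the variables. -/
def shortLen (l : ℕ) : ℕ := l - (l / 2 + 1)

/-- The length of the threads in the gadgets of the clauses. Both lengths sum up to `l`, while two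
threads of this length form a cycle longer than `l`. -/
def longLen (l : ℕ) : ℕ := l / 2 + 1

variable {l S n : ℕ} {Cs : List (List (ℕ × Bool))}

/-- The number of gadgets. -/
def numJobs (n : ℕ) (Cs : List (List (ℕ × Bool))) : ℕ := n + 1 + Cs.length

/-- The clause of the gadget `g`. -/
def clauseAt (n : ℕ) (Cs : List (List (ℕ × Bool))) (g : ℕ) : List (ℕ × Bool) :=
  if g ≤ n then varClause (n - g) else Cs.getD (g - (n + 1)) []

/-- The length of the threads of the gadget `g`. -/
def lenAt (l n g : ℕ) : ℕ := if g ≤ n then shortLen l else longLen l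

theorem lenAt_bounds (hl : 5 ≤ l) (g : ℕ) :
    2 ≤ lenAt l n g ∧ lenAt l n g ≤ l ∧ l < 4 * lenAt l n g := by
  unfold lenAt shortLen longLen
  split_ifs <;> omega

/-- The first hub of a thread. -/
def hubA (S n : ℕ) (Cs : List (List (ℕ × Bool))) (g : ℕ) (t : Fin 3) : ℕ :=
  posA S (lit (clauseAt n Cs g) t)

/-- The second hub of a thread. -/
def hubB (S n : ℕ) (Cs : List (List (ℕ × Bool))) (g : ℕ) (t : Fin 3) : ℕ :=
  posB S (lit (clauseAt n Cs g) t)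

/-- The variables of all clauses are less than `N`. -/
def VarsLt (N : ℕ) (Cs : List (List (ℕ × Bool))) : Prop := ∀ C ∈ Cs, ∀ x ∈ C, x.1 < N

theorem lit_lt {N : ℕ} {C : List (ℕ × Bool)} (hN : 0 < N) (h : ∀ x ∈ C, x.1 < N) (t : ℕ) :
    (lit C t).1 < N := by
  unfold lit
  rcases Nat.lt_or_ge (min t (C.length - 1)) C.length with h' | h'
  · rw [List.getD_eq_getElem _ _ h']
    exact h _ (List.getElem_mem _)
  · rw [List.getD_eq_default _ _ h']
    exact hN

theorem lit_clauseAt_lt (hS : n < S ^ 2) (hC : VarsLt n Cs) (g t : ℕ) :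
    (lit (clauseAt n Cs g) t).1 < S ^ 2 := by
  refine lit_lt (by omega) (fun x hx => ?_) t
  unfold clauseAt at hx
  split_ifs at hx
  · simp only [varClause, List.mem_cons, List.not_mem_nil, or_false] at hx
    rcases hx with rfl | rfl <;> simp only <;> omega
  · rcases Nat.lt_or_ge (g - (n + 1)) Cs.length with h' | h'
    · rw [List.getD_eq_getElem _ _ h'] at hx
      exact (hC _ (List.getElem_mem _) x hx).trans hS
    · rw [List.getD_eq_default _ _ h'] at hx
      simp at hx

theorem hub_bounds (hS : n < S ^ 2) (hC : VarsLt n Cs) (g g' : ℕ) (t t' : Fin 3) :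
    hubA S n Cs g t < S ∧ S ≤ hubB S n Cs g' t' ∧ hubB S n Cs g' t' < 3 * S := by
  have hS0 : 0 < S := by
    rcases Nat.eq_zero_or_pos S with rfl | h
    · simp at hS
    · exact h
  refine ⟨?_, ?_, posB_lt hS0 _⟩
  · have := lit_clauseAt_lt hS hC g t
    exact Nat.div_lt_of_lt_mul (by rwa [← sq])
  · unfold hubB posB; omega

theorem eq_of_pos {x y : ℕ × Bool} (h₁ : posA S x = posA S y) (h₂ : posB S x = posB S y) :
    x = y := by
  unfold posA posB at *
  obtain ⟨v, c⟩ := x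
  obtain ⟨w, d⟩ := y
  dsimp only at *
  have e : v % S = w % S ∧ c = d := by
    cases c <;> cases d <;> simp at h₂ ⊢ <;> omega
  rw [← Nat.div_add_mod v S, ← Nat.div_add_mod w S, h₁, e.1, e.2]

theorem getD_jobs (T T' : List (Loc × Loc)) {g : ℕ} (hg : g < numJobs n Cs) (d : Job) :
    (jobs T T' n Cs).getD g d = (if g ≤ n then T else T', clauseAt n Cs g) := by
  unfold numJobs at hg
  unfold jobs clauseAt
  by_cases h : g ≤ n
  · rw [List.getD_append _ _ _ _ (by simp [varJobs]; omega), if_pos h, if_pos h,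
      List.getD_eq_getElem _ _ (by simp [varJobs]; omega)]
    simp [varJobs]
  · rw [List.getD_append_right _ _ _ _ (by simp [varJobs]; omega), if_neg h, if_neg h,
      List.getD_eq_getElem _ _ (by simp [varJobs]; omega),
      List.getD_eq_getElem _ _ (by omega)]
    simp [varJobs]

theorem length_jobs (T T' : List (Loc × Loc)) : (jobs T T' n Cs).length = numJobs n Cs := by
  simp [jobs, varJobs, numJobs]

theorem allEdges_eq (l S b : ℕ) (js : List Job) : allEdges l S b js =
    (List.range js.length).flatMap fun g => jobEdges l S (b + 6 * l * g) (js.getD g ([], [])) := by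
  induction js generalizing b with
  | nil => rfl
  | cons j js ih =>
    rw [List.length_cons, List.range_succ_eq_map, List.flatMap_cons, List.flatMap_map, allEdges, ih]
    congr 1
    refine List.flatMap_congr fun g _ => ?_
    rw [show b + 6 * l + 6 * l * g = b + 6 * l * (g + 1) by ring]
    rfl

theorem allBags_eq (l h b : ℕ) (js : List Job) : allBags l h b js =
    (List.range js.length).map fun g => bag l h (b + 6 * l * g) := by
  induction js generalizing b with
  | nil => rfl
  | cons j js ih =>
    rw [List.length_cons, List.range_succ_eq_map, List.map_cons, List.map_map, allBags, ih]
    congr 1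
    refine List.map_congr_left fun g _ => ?_
    rw [show b + 6 * l + 6 * l * g = b + 6 * l * (g + 1) by ring]
    rfl

/-- The edges of the graph of a formula, as pairs of numbers. -/
noncomputable def edgeList (l S n : ℕ) (Cs : List (List (ℕ × Bool))) : List (ℕ × ℕ) :=
  allEdges l S (3 * S) (jobs (template l (shortLen l)) (template l (longLen l)) n Cs)

theorem edgeList_eq : edgeList l S n Cs = (List.range (numJobs n Cs)).flatMap fun g =>
    (template l (lenAt l n g)).map fun e =>
      (code l (3 * S) (glob (hubA S n Cs) (hubB S n Cs) g e.1),
        code l (3 * S) (glob (hubA S n Cs) (hubB S n Cs) g e.2)) := by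
  have key : ∀ g x, locVal l S (3 * S + 6 * l * g) (clauseAt n Cs g) x =
      code l (3 * S) (glob (hubA S n Cs) (hubB S n Cs) g x) := by
    intro g x
    cases x <;> rfl
  rw [edgeList, allEdges_eq, length_jobs]
  refine List.flatMap_congr fun g hg => ?_
  rw [getD_jobs _ _ (List.mem_range.1 hg), jobEdges]
  simp only [key, lenAt]
  split_ifs <;> rfl

variable (l S n Cs) in
/-- The oriented edges of the graph of a formula. -/
abbrev FEdge : Vtx → Vtx → Prop :=
  GEdge l (numJobs n Cs) (lenAt l n) (hubA S n Cs) (hubB S n Cs)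

variable (l S n Cs) in
/-- Adjacency in the graph of a formula. -/
abbrev FAdj : Vtx → Vtx → Prop :=
  GAdj l (numJobs n Cs) (lenAt l n) (hubA S n Cs) (hubB S n Cs)

theorem glob_valid (hS : n < S ^ 2) (hC : VarsLt n Cs) {x : Loc} (hx : x.Valid l) (g : ℕ) :
    (glob (hubA S n Cs) (hubB S n Cs) g x).Valid l (3 * S) := by
  refine hx.glob (fun g t => ?_) (fun g t => ?_)
  · have := hub_bounds hS hC g g t t; omega
  · have := hub_bounds hS hC g g t t; omega

theorem code_glob (hS : n < S ^ 2) (hC : VarsLt n Cs) {x : Loc} (hx : x.Valid l) (g : ℕ) :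
    code l (3 * S) (glob (hubA S n Cs) (hubB S n Cs) g x) < 3 * S ∨
      (3 * S + 6 * l * g ≤ code l (3 * S) (glob (hubA S n Cs) (hubB S n Cs) g x) ∧
        code l (3 * S) (glob (hubA S n Cs) (hubB S n Cs) g x) < 3 * S + 6 * l * g + 6 * l) := by
  refine code_glob_mem hx (fun g t => ?_) (fun g t => ?_)
  · have := hub_bounds hS hC g g t t; omega
  · have := hub_bounds hS hC g g t t; omega

/-- The number of vertices. -/
def numVerts (l S n : ℕ) (Cs : List (List (ℕ × Bool))) : ℕ := 3 * S + 6 * l * numJobs n Cs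

/-- The two ends of an edge have numbers, and belong to the bag of some gadget. -/
theorem FEdge.exists_bag (hl : 5 ≤ l) (hS : n < S ^ 2) (hC : VarsLt n Cs) {u v : Vtx}
    (h : FEdge l S n Cs u v) : u.Valid l (3 * S) ∧ v.Valid l (3 * S) ∧
      ∃ g < numJobs n Cs, (code l (3 * S) u < 3 * S ∨ (3 * S + 6 * l * g ≤ code l (3 * S) u ∧
          code l (3 * S) u < 3 * S + 6 * l * g + 6 * l)) ∧
        (code l (3 * S) v < 3 * S ∨ (3 * S + 6 * l * g ≤ code l (3 * S) v ∧
          code l (3 * S) v < 3 * S + 6 * l * g + 6 * l)) := by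
  obtain ⟨g, hg, x, y, hT, rfl, rfl⟩ := h
  obtain ⟨hx, hy⟩ := hT.valid hl (lenAt_bounds hl g).2.1
  exact ⟨glob_valid hS hC hx g, glob_valid hS hC hy g, g, hg, code_glob hS hC hx g,
    code_glob hS hC hy g⟩

theorem lt_numVerts {g x : ℕ} (hg : g < numJobs n Cs)
    (h : x < 3 * S ∨ (3 * S + 6 * l * g ≤ x ∧ x < 3 * S + 6 * l * g + 6 * l)) :
    x < numVerts l S n Cs := by
  have : 6 * l * (g + 1) ≤ 6 * l * numJobs n Cs := Nat.mul_le_mul_left _ hg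
  rw [mul_add] at this
  unfold numVerts
  omega

theorem mem_edgeList (hl : 5 ≤ l) (hS : n < S ^ 2) (hC : VarsLt n Cs) {x y : ℕ} :
    (x, y) ∈ edgeList l S n Cs ↔ FEdge l S n Cs (decode l (3 * S) x) (decode l (3 * S) y) := by
  rw [edgeList_eq]
  simp only [List.mem_flatMap, List.mem_range, List.mem_map, Prod.mk.injEq]
  constructor
  · rintro ⟨g, hg, e, he, rfl, rfl⟩
    have hb := (lenAt_bounds (n := n) hl g).2.1
    have hT := (mem_template hl hb).1 he
    obtain ⟨hx, hy⟩ := hT.valid hl hb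
    exact ⟨g, hg, e.1, e.2, hT, decode_code (glob_valid hS hC hx g),
      decode_code (glob_valid hS hC hy g)⟩
  · rintro ⟨g, hg, x', y', hT, h1, h2⟩
    refine ⟨g, hg, (x', y'), (mem_template hl (lenAt_bounds hl g).2.1).2 hT, ?_, ?_⟩
    · rw [← h1, code_decode (by omega)]
    · rw [← h2, code_decode (by omega)]

theorem nodup_edgeList (hl : 5 ≤ l) (hS : n < S ^ 2) (hC : VarsLt n Cs) :
    (edgeList l S n Cs).Nodup := by
  have key : ∀ g g', ∀ e ∈ template l (lenAt l n g), ∀ e' ∈ template l (lenAt l n g'),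
      (code l (3 * S) (glob (hubA S n Cs) (hubB S n Cs) g e.1),
        code l (3 * S) (glob (hubA S n Cs) (hubB S n Cs) g e.2)) =
      (code l (3 * S) (glob (hubA S n Cs) (hubB S n Cs) g' e'.1),
        code l (3 * S) (glob (hubA S n Cs) (hubB S n Cs) g' e'.2)) → g = g' ∧ e = e' := by
    rintro g g' e he e' he' h
    have hb := (lenAt_bounds (n := n) hl g).2.1
    have hb' := (lenAt_bounds (n := n) hl g').2.1
    have hT := (mem_template hl hb).1 he
    have hT' := (mem_template hl hb').1 he'
    obtain ⟨hx, hy⟩ := hT.valid hl hb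
    obtain ⟨hx', hy'⟩ := hT'.valid hl hb'
    rw [Prod.mk.injEq] at h
    obtain ⟨h1, h2, h3⟩ := glob_injOn hT hT'
      (by rw [← decode_code (glob_valid hS hC hx g), h.1, decode_code (glob_valid hS hC hx' g')])
      (by rw [← decode_code (glob_valid hS hC hy g), h.2, decode_code (glob_valid hS hC hy' g')])
    exact ⟨h1, Prod.ext h2 h3⟩
  rw [edgeList_eq, List.nodup_flatMap]
  refine ⟨fun g _ => List.Nodup.map_on (fun e he e' he' h => (key g g e he e' he' h).2)
    (nodup_template _ _), List.nodup_range.imp fun {g g'} hne => ?_⟩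
  rw [Function.onFun, List.disjoint_left]
  intro p hp hp'
  obtain ⟨e, he, rfl⟩ := List.mem_map.1 hp
  obtain ⟨e', he', h⟩ := List.mem_map.1 hp'
  exact hne (key g' g e' he' e he h).1.symm

theorem mem_bag {l h b x : ℕ} : x ∈ bag l h b ↔ x < h ∨ (b ≤ x ∧ x < b + 6 * l) := by
  simp only [bag, List.mem_append, List.mem_reverse, List.mem_range, List.mem_map]
  refine or_congr Iff.rfl ⟨?_, fun h => ⟨x - b, by omega, by omega⟩⟩
  rintro ⟨q, hq, rfl⟩
  omega

theorem nodup_bag {l h b : ℕ} (hb : h ≤ b) : (bag l h b).Nodup := by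
  refine List.Nodup.append (List.nodup_reverse.2 List.nodup_range)
    (List.nodup_range.map fun x y e => by simpa using e) ?_
  rw [List.disjoint_left]
  intro x hx hx'
  simp only [List.mem_reverse, List.mem_range, List.mem_map] at hx hx'
  obtain ⟨q, -, rfl⟩ := hx'
  omega

/-- The graph of a formula on the numbers of its vertices. -/
def formulaGraph (l S n : ℕ) (Cs : List (List (ℕ × Bool))) :
    SimpleGraph (Fin (numVerts l S n Cs)) where
  Adj u v := FAdj l S n Cs (decode l (3 * S) u) (decode l (3 * S) v)
  symm := ⟨fun _ _ h => h.symm⟩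
  loopless := ⟨fun _ h => h.elim gEdge_irrefl gEdge_irrefl⟩

theorem exists_lift {N : ℕ} (L : List ℕ) (h : ∀ x ∈ L, x < N) :
    ∃ L' : List (Fin N), L'.map Fin.val = L := by
  refine ⟨L.pmap (fun x hx => ⟨x, hx⟩) h, ?_⟩
  simp [List.map_pmap]

/-- The instance of the deletion problems that belongs to a formula. The relation `R` stands for
the question that is asked about the graph and the number `k`. -/
theorem exists_instance (hl : 5 ≤ l) (hS : n < S ^ 2) (hC : VarsLt n Cs) :
    ∃ I : Instance, (∀ R : ∀ N : ℕ, SimpleGraph (Fin N) → ℕ → Prop,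
        R _ I.graph I.k ↔ R _ (formulaGraph l S n Cs) (2 * numJobs n Cs)) ∧
      I.pathWidth ≤ 3 * S + 6 * l ∧
      I.encode = encNat (numVerts l S n Cs) ++ encNat (2 * numJobs n Cs) ++
        encList encEdge (edgeList l S n Cs) ++ encList (encList encNat)
          ((List.range (numJobs n Cs)).map fun g => bag l (3 * S) (3 * S + 6 * l * g)) := by
  have hE : ∀ e ∈ edgeList l S n Cs, e.1 < numVerts l S n Cs ∧ e.2 < numVerts l S n Cs := by
    rintro ⟨x, y⟩ he
    obtain ⟨-, -, g, hg, h1, h2⟩ := FEdge.exists_bag hl hS hC ((mem_edgeList hl hS hC).1 he)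
    rw [code_decode (by omega)] at h1 h2
    exact ⟨lt_numVerts hg h1, lt_numVerts hg h2⟩
  obtain ⟨edges, hedges⟩ : ∃ L : List (Fin (numVerts l S n Cs) × Fin (numVerts l S n Cs)),
      L.map (fun e => ((e.1 : ℕ), (e.2 : ℕ))) = edgeList l S n Cs :=
    ⟨(edgeList l S n Cs).pmap (fun e he => (⟨e.1, he.1⟩, ⟨e.2, he.2⟩)) hE,
      by simp [List.map_pmap]⟩
  have hbag : ∀ g : Fin (numJobs n Cs), ∃ L : List (Fin (numVerts l S n Cs)),
      L.map Fin.val = bag l (3 * S) (3 * S + 6 * l * g) := fun g =>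
    exists_lift _ fun x hx => lt_numVerts g.2 (mem_bag.1 hx)
  choose B hB using hbag
  have hmemB : ∀ g v, v ∈ B g ↔ (v : ℕ) < 3 * S ∨
      (3 * S + 6 * l * g ≤ v ∧ v < 3 * S + 6 * l * g + 6 * l) := by
    intro g v
    rw [← mem_bag, ← hB g, List.mem_map_of_injective Fin.val_injective]
  have hmem : ∀ u v, (u, v) ∈ edges ↔
      FEdge l S n Cs (decode l (3 * S) u) (decode l (3 * S) v) := by
    intro u v
    rw [← mem_edgeList hl hS hC, ← hedges]
    constructor
    · exact fun h => List.mem_map.2 ⟨_, h, rfl⟩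
    · intro h
      obtain ⟨⟨u', v'⟩, h', e⟩ := List.mem_map.1 h
      simp only [Prod.mk.injEq, Fin.val_inj] at e
      obtain ⟨rfl, rfl⟩ := e
      exact h'
  have hM : 0 < numJobs n Cs := by unfold numJobs; omega
  have hab : ∀ g g' t t', hubA S n Cs g t ≠ hubB S n Cs g' t' := fun g g' t t' => by
    have := hub_bounds hS hC g g' t t'; omega
  refine ⟨{
    numVertices := numVerts l S n Cs
    graph := formulaGraph l S n Cs
    k := 2 * numJobs n Cs
    edges := edges
    edges_nodup := ?_
    mem_edges := ?_
    bags := List.ofFn B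
    bags_nodup := ?_
    pathDecomposition := ?_
    k_le := ?_
    bags_le := ?_ }, fun _ => Iff.rfl, ?_, ?_⟩
  · refine List.Nodup.map_on ?_ (List.Nodup.of_map _ (hedges ▸ nodup_edgeList hl hS hC))
    rintro ⟨u, v⟩ h ⟨u', v'⟩ h' e
    rcases Sym2.eq_iff.1 e with ⟨rfl, rfl⟩ | ⟨rfl, rfl⟩
    · rfl
    · exact absurd ((hmem _ _).1 h') (gEdge_asymm hab ((hmem _ _).1 h))
  · refine Sym2.ind fun u v => ?_
    rw [SimpleGraph.mem_edgeSet, List.mem_map]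
    constructor
    · rintro ⟨⟨u', v'⟩, h, e⟩
      rcases Sym2.eq_iff.1 e with ⟨rfl, rfl⟩ | ⟨rfl, rfl⟩
      · exact .inl ((hmem _ _).1 h)
      · exact .inr ((hmem _ _).1 h)
    · rintro (h | h)
      · exact ⟨_, (hmem _ _).2 h, rfl⟩
      · exact ⟨_, (hmem _ _).2 h, Sym2.eq_swap⟩
  · intro L hL
    obtain ⟨g, rfl⟩ := (List.mem_ofFn' _ _).1 hL
    exact List.Nodup.of_map Fin.val (hB g ▸ nodup_bag (Nat.le_add_right _ _))
  · have hlen : (List.ofFn B).length = numJobs n Cs := List.length_ofFn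
    have hget : ∀ (i : Fin (List.ofFn B).length) v, v ∈ ((List.ofFn B).get i).toFinset ↔
        (v : ℕ) < 3 * S ∨ (3 * S + 6 * l * i ≤ v ∧ v < 3 * S + 6 * l * i + 6 * l) := by
      intro i v
      rw [List.mem_toFinset, List.get_eq_getElem, List.getElem_ofFn, hmemB]
    refine ⟨by omega, fun v => ?_, fun u v h => ?_, fun v i j k hij hjk hi hk => ?_⟩
    · by_cases h : (v : ℕ) < 3 * S
      · exact ⟨⟨0, by omega⟩, (hget _ _).2 (.inl h)⟩
      · have h1 := Nat.div_add_mod ((v : ℕ) - 3 * S) (6 * l)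
        have h2 := Nat.mod_lt ((v : ℕ) - 3 * S) (by omega : 0 < 6 * l)
        have h3 : ((v : ℕ) - 3 * S) / (6 * l) < numJobs n Cs := by
          refine Nat.div_lt_of_lt_mul ?_
          have := v.2
          unfold numVerts at this
          omega
        exact ⟨⟨((v : ℕ) - 3 * S) / (6 * l), by omega⟩, (hget _ _).2 (.inr (by dsimp only; omega))⟩
    · have hb : ∀ u v : Fin (numVerts l S n Cs),
          FEdge l S n Cs (decode l (3 * S) u) (decode l (3 * S) v) →
          ∃ i : Fin (List.ofFn B).length, u ∈ ((List.ofFn B).get i).toFinset ∧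
            v ∈ ((List.ofFn B).get i).toFinset := by
        intro u v h
        obtain ⟨-, -, g, hg, h1, h2⟩ := FEdge.exists_bag hl hS hC h
        rw [code_decode (by omega)] at h1 h2
        exact ⟨⟨g, by omega⟩, (hget _ _).2 h1, (hget _ _).2 h2⟩
      rcases h with h | h
      · exact hb u v h
      · obtain ⟨i, h1, h2⟩ := hb v u h
        exact ⟨i, h2, h1⟩
    · rw [hget] at *
      have h1 : 6 * l * i ≤ 6 * l * j := Nat.mul_le_mul_left _ hij
      have h2 : 6 * l * j ≤ 6 * l * k := Nat.mul_le_mul_left _ hjk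
      omega
  · have : 2 * numJobs n Cs ≤ 6 * l * numJobs n Cs := Nat.mul_le_mul_right _ (by omega)
    unfold numVerts
    omega
  · have : 1 * numJobs n Cs ≤ 6 * l * numJobs n Cs := Nat.mul_le_mul_right _ (by omega)
    rw [List.length_ofFn]
    unfold numVerts
    omega
  · refine (Nat.sub_le _ _).trans (Finset.sup_le fun i _ => ?_)
    refine (List.toFinset_card_le _).trans ?_
    change ((List.ofFn B).get i).length ≤ _
    rw [List.get_eq_getElem, List.getElem_ofFn]
    have := congrArg List.length (hB ⟨i, by simpa using i.2⟩)
    rw [List.length_map] at this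
    exact (this.trans (by simp [bag])).le
  · have hlist : (List.ofFn B).map (fun L => L.map Fin.val) =
        (List.range (numJobs n Cs)).map fun g => bag l (3 * S) (3 * S + 6 * l * g) := by
      rw [List.map_ofFn]
      refine List.ext_getElem (by simp) fun i h1 h2 => ?_
      simp [hB]
    simp only [Instance.encode, ← hedges, ← hlist, encList, encEdge, List.flatMap_map]

end ETHLower

namespace ETHLower

/-! ### Cycles as sequences and as walks -/

/-- A cyclic sequence of distinct vertices gives a cycle. -/
theorem exists_isCycle {V : Type} {G : SimpleGraph V} {l : ℕ} (hl : 3 ≤ l) (c : ℕ → V)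
    (hinj : ∀ i < l, ∀ j < l, c i = c j → i = j) (hadj : ∀ i, i + 1 < l → G.Adj (c i) (c (i + 1)))
    (hclose : G.Adj (c (l - 1)) (c 0)) :
    ∃ (v : V) (w : G.Walk v v), w.IsCycle ∧ w.length = l := by
  have key : ∀ m, m < l → ∃ p : G.Walk (c 0) (c m), p.support = (List.range (m + 1)).map c ∧
      p.edges = (List.range m).map (fun i => s(c i, c (i + 1))) ∧ p.length = m := by
    intro m
    induction m with
    | zero => exact fun _ => ⟨.nil, by simp⟩
    | succ m ih =>
      intro hm
      obtain ⟨p, hp, he, hp'⟩ := ih (by omega)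
      refine ⟨p.concat (hadj m hm), ?_, by simp [SimpleGraph.Walk.edges_concat, he,
        List.range_succ], by simp [hp']⟩
      rw [SimpleGraph.Walk.support_concat, hp, List.range_succ (n := m + 1), List.map_append]
      simp
  obtain ⟨p, hp, hpe, hp'⟩ := key (l - 1) (by omega)
  refine ⟨_, .cons hclose p, ?_, by simp [hp']; omega⟩
  rw [SimpleGraph.Walk.cons_isCycle_iff]
  refine ⟨.mk' ?_, fun he => ?_⟩
  · rw [hp]
    refine List.Nodup.map_on (fun i hi j hj e => ?_) List.nodup_range
    rw [List.mem_range] at hi hj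
    exact hinj i (by omega) j (by omega) e
  · rw [hpe, List.mem_map] at he
    obtain ⟨i, hi, e⟩ := he
    rw [List.mem_range] at hi
    rcases Sym2.eq_iff.1 e with ⟨h1, h2⟩ | ⟨h1, h2⟩
    · have := hinj _ (by omega) _ (by omega) h1
      omega
    · have := hinj _ (by omega) _ (by omega) h1
      have := hinj _ (by omega) _ (by omega) h2
      omega

/-- Every vertex of a cycle has two neighbors on the cycle. -/
theorem exists_adj_ne_of_isCycle {V : Type} {G : SimpleGraph V} {v : V} {w : G.Walk v v}
    (hw : w.IsCycle) {u : V} (hu : u ∈ w.support) (z : V) :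
    ∃ x ∈ w.support, x ≠ z ∧ G.Adj u x := by
  classical
  have hc : (w.rotate u hu).IsCycle := (SimpleGraph.Walk.isCycle_rotate hu).2 hw
  have hmem := fun i => (w.mem_support_rotate_iff u hu).1 ((w.rotate u hu).getVert_mem_support i)
  by_cases h : (w.rotate u hu).snd = z
  · refine ⟨_, hmem _, ?_, ((w.rotate u hu).adj_penultimate hc.not_nil).symm⟩
    rw [← h]
    exact hc.snd_ne_penultimate.symm
  · exact ⟨_, hmem _, h, (w.rotate u hu).adj_snd hc.not_nil⟩

theorem card_support_le {V : Type} [DecidableEq V] {G : SimpleGraph V} {v : V} (w : G.Walk v v)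
    (hw : ¬ w.Nil) : w.support.toFinset.card ≤ w.length := by
  have : w.support.toFinset = w.support.tail.toFinset := by
    rw [← w.cons_tail_support, List.toFinset_cons, List.tail_cons]
    exact Finset.insert_eq_self.2
      (List.mem_toFinset.2 (SimpleGraph.Walk.end_mem_tail_support hw))
  rw [this]
  refine (List.toFinset_card_le _).trans ?_
  simp

/-! ### Correctness of the reduction -/

variable {l S n : ℕ} {Cs : List (List (ℕ × Bool))}

/-- The assignment `α` makes a literal of every clause true. -/
def Satisfies (α : ℕ → Bool) (Cs : List (List (ℕ × Bool))) : Prop :=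
  ∀ C ∈ Cs, ∃ r ∈ C, α r.1 = r.2

/-- All clauses have one, two or three literals. -/
def Narrow (Cs : List (List (ℕ × Bool))) : Prop := ∀ C ∈ Cs, 1 ≤ C.length ∧ C.length ≤ 3

theorem exists_lit {C : List (ℕ × Bool)} (hC : C.length ≤ 3) {x : ℕ × Bool} (hx : x ∈ C) :
    ∃ t : Fin 3, lit C t = x := by
  obtain ⟨i, hi, rfl⟩ := List.getElem_of_mem hx
  refine ⟨⟨i, by omega⟩, ?_⟩
  rw [lit, Nat.min_eq_left (by simp only; omega), List.getD_eq_getElem]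

theorem lit_mem {C : List (ℕ × Bool)} (hC : 1 ≤ C.length) (t : ℕ) : lit C t ∈ C := by
  rw [lit, List.getD_eq_getElem _ _ (by omega)]
  exact List.getElem_mem _

theorem clauseAt_mem {g : ℕ} (hg : g < numJobs n Cs) (h : ¬ g ≤ n) : clauseAt n Cs g ∈ Cs := by
  unfold numJobs at hg
  rw [clauseAt, if_neg h, List.getD_eq_getElem _ _ (by omega)]
  exact List.getElem_mem _

/-- If the assignment `α` satisfies the formula, then it is possible to keep a false literal in the
gadget of every variable, and a true literal in the gadget of every clause. Every cycle in the rest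
of the graph is longer than `l`. -/
theorem girthVertexDeletion_of_satisfies (hl : 5 ≤ l) (hS : n < S ^ 2) (hC : VarsLt n Cs)
    (h3 : Narrow Cs) {α : ℕ → Bool} (hα : Satisfies α Cs) :
    GirthVertexDeletion l (formulaGraph l S n Cs) (2 * numJobs n Cs) := by
  classical
  have hκ : ∀ g, ∃ t : Fin 3, g < numJobs n Cs →
      if g ≤ n then (lit (clauseAt n Cs g) t).1 = n - g ∧
        α (lit (clauseAt n Cs g) t).1 ≠ (lit (clauseAt n Cs g) t).2
      else α (lit (clauseAt n Cs g) t).1 = (lit (clauseAt n Cs g) t).2 := by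
    intro g
    by_cases hg : g < numJobs n Cs
    · split_ifs with h
      · have : (n - g, !α (n - g)) ∈ clauseAt n Cs g := by
          rw [clauseAt, if_pos h, varClause]
          cases α (n - g) <;> simp
        obtain ⟨t, ht⟩ := exists_lit (by rw [clauseAt, if_pos h]; simp [varClause]) this
        exact ⟨t, fun _ => by simp [ht]⟩
      · have hm := clauseAt_mem hg h
        obtain ⟨r, hr, hr'⟩ := hα _ hm
        obtain ⟨t, ht⟩ := exists_lit (h3 _ hm).2 hr
        exact ⟨t, fun _ => by rw [ht, hr']⟩
    · exact ⟨0, fun h => absurd h hg⟩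
  choose κ hκ using hκ
  refine ⟨Finset.univ.filter fun u => ∃ g < numJobs n Cs, ∃ t, t ≠ κ g ∧
    decode l (3 * S) u = .thr g t 0, ?_, fun v w hw hle => ?_⟩
  · have hinj : Function.Injective fun u : Fin (numVerts l S n Cs) => decode l (3 * S) u :=
      (decode_injective (by omega) _).comp Fin.val_injective
    rw [← Finset.card_image_of_injective _ hinj]
    refine (Finset.card_le_card (t := (Finset.range (numJobs n Cs)).biUnion fun g =>
      (Finset.univ.erase (κ g)).image fun t => Vtx.thr g t 0) fun x hx => ?_).trans
      (Finset.card_biUnion_le.trans ((Finset.sum_le_card_nsmul _ _ 2 fun g _ => ?_).trans ?_))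
    · obtain ⟨u, hu, rfl⟩ := Finset.mem_image.1 hx
      obtain ⟨-, g, hg, t, ht, e⟩ := Finset.mem_filter.1 hu
      exact Finset.mem_biUnion.2 ⟨g, Finset.mem_range.2 hg, Finset.mem_image.2
        ⟨t, Finset.mem_erase.2 ⟨ht, Finset.mem_univ _⟩, e.symm⟩⟩
    · refine Finset.card_image_le.trans ?_
      simp [Finset.card_erase_of_mem]
    · simp [mul_comm]
  · set X : Finset (Fin (numVerts l S n Cs)) := Finset.univ.filter fun u =>
      ∃ g < numJobs n Cs, ∃ t, t ≠ κ g ∧ decode l (3 * S) u = .thr g t 0 with hX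
    have hcore : Core l (numJobs n Cs) (lenAt l n) (hubA S n Cs) (hubB S n Cs) κ
        (w.support.toFinset.image fun u => decode l (3 * S) u.1) := by
      refine ⟨fun y hy z => ?_, fun g hg t ht hm => ?_⟩
      · obtain ⟨u, hu, rfl⟩ := Finset.mem_image.1 hy
        rw [List.mem_toFinset] at hu
        by_cases hz : ∃ z' : {u : Fin (numVerts l S n Cs) | u ∉ X}, decode l (3 * S) z'.1 = z
        · obtain ⟨z', rfl⟩ := hz
          obtain ⟨x, hx, hne, hadj⟩ := exists_adj_ne_of_isCycle hw hu z'
          refine ⟨_, Finset.mem_image_of_mem _ (List.mem_toFinset.2 hx), fun e => hne ?_, hadj⟩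
          exact Subtype.ext (Fin.ext (decode_injective (by omega) _ e))
        · obtain ⟨x, hx, -, hadj⟩ := exists_adj_ne_of_isCycle hw hu u
          exact ⟨_, Finset.mem_image_of_mem _ (List.mem_toFinset.2 hx),
            fun e => hz ⟨x, e⟩, hadj⟩
      · obtain ⟨u, -, e⟩ := Finset.mem_image.1 hm
        exact u.2 (Finset.mem_filter.2 ⟨Finset.mem_univ _, g, hg, t, ht, e⟩)
    have hlt := hcore.lt_card hl (fun g => (lenAt_bounds hl g).1)
      (fun g => (lenAt_bounds hl g).2.2)
      (fun g g' t t' => ⟨(hub_bounds hS hC g g' t t').1, (hub_bounds hS hC g g' t t').2.1⟩)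
      (fun g hg g' hg' hne ha hb => ?_)
      ⟨_, Finset.mem_image_of_mem _ (List.mem_toFinset.2 w.start_mem_support)⟩
    · have h1 := (Finset.card_image_le (s := w.support.toFinset)
        (f := fun u => decode l (3 * S) u.1)).trans (card_support_le w hw.not_nil)
      omega
    · -- Equal hubs mean equal literals, so at most one of two parallel threads is short.
      have e := eq_of_pos ha hb
      have k := hκ g hg
      have k' := hκ g' hg'
      unfold lenAt shortLen longLen
      rw [e] at k
      split_ifs at k k' ⊢ with h h'
      · have := k.1.symm.trans k'.1
        omega
      · exact absurd k' k.2
      · exact absurd k k'.2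
      · omega

/-- Conversely, after the deletion of at most `2 * numJobs n Cs` vertices a thread is left in every
gadget. If there are no cycles of length `l`, then a literal that is kept in the gadget of a clause
is not kept in the gadget of its variable. So making the literals that are kept for the variables
false satisfies the formula. -/
theorem exists_satisfies_of_cycleVertexDeletion (hl : 5 ≤ l) (hS : n < S ^ 2) (hC : VarsLt n Cs)
    (h3 : Narrow Cs) (h : CycleVertexDeletion l (formulaGraph l S n Cs) (2 * numJobs n Cs)) :
    ∃ α, Satisfies α Cs := by
  classical
  obtain ⟨X, hcard, hX⟩ := h
  have hits : Hits l (numJobs n Cs) (lenAt l n) (hubA S n Cs) (hubB S n Cs)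
      (X.image fun u : Fin (numVerts l S n Cs) => decode l (3 * S) u) := by
    intro c hinj hadj hclose
    by_contra! hc
    have hv : ∀ u v, FAdj l S n Cs u v → u.Valid l (3 * S) ∧
        code l (3 * S) u < numVerts l S n Cs := by
      rintro u v (h | h)
      · obtain ⟨h1, -, g, hg, h2, -⟩ := FEdge.exists_bag hl hS hC h
        exact ⟨h1, lt_numVerts hg h2⟩
      · obtain ⟨-, h1, g, hg, -, h2⟩ := FEdge.exists_bag hl hS hC h
        exact ⟨h1, lt_numVerts hg h2⟩
    have hv' : ∀ i, (c (min i (l - 1))).Valid l (3 * S) ∧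
        code l (3 * S) (c (min i (l - 1))) < numVerts l S n Cs := by
      intro i
      rcases Nat.lt_or_ge (i + 1) l with h | h
      · rw [Nat.min_eq_left (by omega)]
        exact hv _ _ (hadj i h)
      · rw [Nat.min_eq_right (by omega)]
        exact hv _ _ hclose
    have hd : ∀ i, decode l (3 * S) (code l (3 * S) (c (min i (l - 1)))) = c (min i (l - 1)) :=
      fun i => decode_code (hv' i).1
    have hmin : ∀ i < l, min i (l - 1) = i := fun i hi => Nat.min_eq_left (by omega)
    obtain ⟨v, w, hw, hlen⟩ := exists_isCycle (G := (formulaGraph l S n Cs).induce {u | u ∉ X})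
      (l := l) (by omega)
      (fun i => ⟨⟨_, (hv' i).2⟩, fun hm => hc _ (by omega : min i (l - 1) < l)
        (Finset.mem_image.2 ⟨_, hm, hd i⟩)⟩)
      (fun i hi j hj e => by
        have e' := congrArg (fun u => decode l (3 * S) u.1.1) e
        simp only [hd] at e'
        rw [hmin i hi, hmin j hj] at e'
        exact hinj i hi j hj e')
      (fun i hi => by
        change FAdj l S n Cs (decode l (3 * S) (code l (3 * S) _))
          (decode l (3 * S) (code l (3 * S) _))
        rw [hd, hd, hmin i (by omega), hmin (i + 1) hi]
        exact hadj i hi)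
      (by
        change FAdj l S n Cs (decode l (3 * S) (code l (3 * S) _))
          (decode l (3 * S) (code l (3 * S) _))
        rw [hd, hd, hmin (l - 1) (by omega), hmin 0 (by omega)]
        exact hclose)
    exact hX v w hw hlen
  obtain ⟨hhub, κ, hκ⟩ := hits.exists_kept hl (Finset.card_image_le.trans hcard)
  refine ⟨fun v => !(lit (varClause v) (κ (n - v))).2, fun C hm => ?_⟩
  obtain ⟨j, hj, rfl⟩ := List.getElem_of_mem hm
  have hg : n + 1 + j < numJobs n Cs := by unfold numJobs; omega
  have hgn : ¬ n + 1 + j ≤ n := by omega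
  have hCl : clauseAt n Cs (n + 1 + j) = Cs[j] := by
    rw [clauseAt, if_neg hgn, show n + 1 + j - (n + 1) = j by omega, List.getD_eq_getElem]
  have hr := lit_mem (h3 _ hm).1 (κ (n + 1 + j))
  refine ⟨_, hr, ?_⟩
  set r := lit Cs[j] (κ (n + 1 + j)) with hrdef
  by_contra hne
  have hv := hC _ hm _ hr
  have hg' : n - r.1 < numJobs n Cs := by unfold numJobs; omega
  have hCl' : clauseAt n Cs (n - r.1) = varClause r.1 := by
    rw [clauseAt, if_pos (by omega), show n - (n - r.1) = r.1 by omega]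
  have hlit : lit (clauseAt n Cs (n - r.1)) (κ (n - r.1)) = r := by
    have h1 := lit_mem (C := varClause r.1) (by simp [varClause]) (κ (n - r.1))
    have h2 : (lit (varClause r.1) (κ (n - r.1))).1 = r.1 := by
      generalize lit (varClause r.1) (κ (n - r.1)) = q at h1
      simp only [varClause, List.mem_cons, List.not_mem_nil, or_false] at h1
      rcases h1 with rfl | rfl <;> rfl
    rw [hCl']
    exact Prod.ext h2 (by simpa using hne)
  have hlit' : lit (clauseAt n Cs (n + 1 + j)) (κ (n + 1 + j)) = r := by rw [hCl]
  obtain ⟨v, hvX, ⟨i, rfl⟩ | ⟨p, rfl⟩ | ⟨p, rfl⟩⟩ := hits.parallel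
    (fun g => (lenAt_bounds hl g).1) (fun g g' t t' =>
      ⟨(hub_bounds hS hC g g' t t').1, (hub_bounds hS hC g g' t t').2.1⟩) hg' hg
    (by omega : n - r.1 ≠ n + 1 + j)
    (t := κ (n - r.1)) (t' := κ (n + 1 + j))
    (by unfold lenAt shortLen longLen; split_ifs <;> omega)
    (by rw [hubA, hubA, hlit, hlit']) (by rw [hubB, hubB, hlit, hlit'])
  · exact hhub i hvX
  · exact hκ _ hg' p hvX
  · exact hκ _ hg p hvX

end ETHLower

namespace ETHLower

/-! ### Running times -/

/-- The clauses of a formula, without the bound on the variables. -/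
def CNF3.rawClauses (φ : CNF3) : List (List (ℕ × Bool)) :=
  φ.clauses.map fun C => C.map fun r => ((r.1 : ℕ), r.2)

theorem CNF3.encode_eq (φ : CNF3) :
    φ.encode = encNat φ.numVars ++ encList (encList encLit) φ.rawClauses := by
  simp only [CNF3.encode, CNF3.rawClauses, encList, List.flatMap_map, encLit]

theorem CNF3.varsLt (φ : CNF3) : VarsLt φ.numVars φ.rawClauses := by
  intro C hC x hx
  obtain ⟨C, -, rfl⟩ := List.mem_map.1 hC
  obtain ⟨r, -, rfl⟩ := List.mem_map.1 hx
  exact r.1.isLt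

theorem CNF3.narrow (φ : CNF3) : Narrow φ.rawClauses := by
  intro C hC
  obtain ⟨C', hC', rfl⟩ := List.mem_map.1 hC
  rw [List.length_map]
  exact φ.clause_length C' hC'

theorem CNF3.satisfiable_iff (φ : CNF3) :
    φ.Satisfiable ↔ ∃ α, Satisfies α φ.rawClauses := by
  constructor
  · rintro ⟨a, ha⟩
    refine ⟨fun v => if h : v < φ.numVars then a ⟨v, h⟩ else false, fun C hC => ?_⟩
    obtain ⟨C', hC', rfl⟩ := List.mem_map.1 hC
    obtain ⟨r, hr, e⟩ := ha C' hC'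
    exact ⟨_, List.mem_map.2 ⟨r, hr, rfl⟩, by simpa using e⟩
  · rintro ⟨α, hα⟩
    refine ⟨fun v => α v, fun C hC => ?_⟩
    obtain ⟨x, hx, e⟩ := hα _ (List.mem_map.2 ⟨C, hC, rfl⟩)
    obtain ⟨r, hr, rfl⟩ := List.mem_map.1 hx
    exact ⟨r, hr, e⟩

theorem graphSize_le {N : ℕ} (G : SimpleGraph (Fin N)) : graphSize G ≤ (N + 1) ^ 2 := by
  classical
  have h1 := G.card_edgeFinset_le_card_choose_two
  have h2 := Nat.choose_le_pow N 2
  rw [graphSize, Nat.card_fin, Nat.card_eq_fintype_card, ← SimpleGraph.edgeFinset_card]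
  rw [Fintype.card_fin] at h1
  nlinarith

/-- A function in `o(p ^ 2)` is at most `ε * p ^ 2` up to a constant, for all `p`. -/
theorem exists_le_of_isLittleO {f : ℕ → ℝ} (hf : f =o[Filter.atTop] fun p : ℕ => (p : ℝ) ^ 2)
    {ε : ℝ} (hε : 0 < ε) : ∃ K, ∀ p, f p ≤ ε * (p : ℝ) ^ 2 + K := by
  obtain ⟨N, hN⟩ := Filter.eventually_atTop.1 (hf.bound hε)
  refine ⟨∑ p ∈ Finset.range N, |f p|, fun p => ?_⟩
  have h0 : 0 ≤ ∑ p ∈ Finset.range N, |f p| := Finset.sum_nonneg fun _ _ => abs_nonneg _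
  rcases Nat.lt_or_ge p N with h | h
  · have h1 := Finset.single_le_sum (f := fun p => |f p|) (fun _ _ => abs_nonneg _)
      (Finset.mem_range.2 h)
    have h2 := le_abs_self (f p)
    have h3 : 0 ≤ ε * (p : ℝ) ^ 2 := by positivity
    linarith
  · have h1 := hN p h
    rw [Real.norm_eq_abs, Real.norm_of_nonneg (by positivity)] at h1
    have h2 := le_abs_self (f p)
    linarith

/-- The square of the width of the path decomposition is linear in the number of variables, since
the variables are placed in a square. -/
theorem pathWidth_sq_le (l n : ℕ) {p : ℕ} (hp : p ≤ 3 * side n + 6 * l) :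
    p ^ 2 ≤ 36 * n + (72 + 72 * l ^ 2) := by
  have h1 := side_sq_le n
  have h2 : p ^ 2 ≤ (3 * side n + 6 * l) ^ 2 := Nat.pow_le_pow_left hp 2
  zify at *
  nlinarith [sq_nonneg (3 * (side n : ℤ) - 6 * l), sq_nonneg ((side n : ℤ) - 2)]

/-- Under ETH a problem cannot be solved in time `2 ^ o(p ^ 2) * |G| ^ O(1)` if on the instances
that the reduction computes it asks for the satisfiability of the formula. -/
theorem not_solvableInTime (hETH : ETH) {l : ℕ} {Q : Instance → Prop}
    (hQ : ∀ φ : CNF3, ∃ I : Instance, (Q I ↔ φ.Satisfiable) ∧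
      I.pathWidth ≤ 3 * side φ.numVars + 6 * l ∧
      graphSize I.graph ≤ (numVerts l (side φ.numVars) φ.numVars φ.rawClauses + 1) ^ 2 ∧
      I.encode = output l (template l (shortLen l)) (template l (longLen l)) φ.numVars
        φ.rawClauses) : ¬ SolvableInTime Q := by
  rintro ⟨P, f, C, d, hf, hP⟩
  obtain ⟨c₀, hc₀, hlow⟩ := hETH
  set c : ℝ := (1 + c₀) / 2 with hc
  have hc1 : 1 < c := by rw [hc]; linarith
  have hlog : 0 < Real.logb 2 c := Real.logb_pos (by norm_num) hc1
  obtain ⟨K₀, hK₀⟩ := exists_le_of_isLittleO hf (div_pos hlog (by norm_num : (0 : ℝ) < 36))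
  obtain ⟨R, K, j, hR⟩ := exists_reduction l (template l (shortLen l)) (template l (longLen l))
  set D : ℝ := 2 ^ (Real.logb 2 c / 36 * (72 + 72 * (l : ℝ) ^ 2) + K₀) with hD
  have hD0 : 0 < D := by positivity
  suffices h : CNF3SatSolvable c by
    have := hlow ⟨by linarith, h⟩
    linarith
  refine ⟨.seq R P, (K + |C| * D) * ((6 * l + 4 : ℕ) : ℝ) ^ (j + 2 * d), j + 2 * d, fun φ => ?_⟩
  obtain ⟨I, hI, hw, hsize, henc⟩ := hQ φ
  obtain ⟨s, t, hrun, ht, hacc⟩ := hP I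
  set n := φ.numVars with hn
  set q := n + φ.clauses.length + 1 with hq
  have hm : φ.rawClauses.length = φ.clauses.length := by simp [CNF3.rawClauses]
  have hside : side n ≤ q := by
    have := Nat.sqrt_le_self n
    unfold side
    omega
  have hJ : numJobs n φ.rawClauses = q := by unfold numJobs; omega
  -- The number of vertices, `3 * side n + 6 * l * q`, is at most `(6 * l + 3) * q`.
  obtain ⟨t', ht', hrun'⟩ := hR n φ.rawClauses ((6 * l + 3) * q) (by nlinarith)
    (by rw [length_jobs, hJ]; nlinarith) (by nlinarith) (fun C hC =>
      ⟨fun x hx => (φ.varsLt C hC x hx).trans_le (by nlinarith), φ.narrow C hC⟩)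
  rw [← φ.encode_eq, ← henc] at hrun'
  refine ⟨s, _, .seq hrun' hrun, ?_, hacc.trans hI⟩
  set B : ℕ := (6 * l + 4) * q with hB
  have hB1 : 1 ≤ B := by nlinarith
  have hBB : (6 * l + 3) * q + 1 ≤ B := by nlinarith
  have hB1' : (1 : ℝ) ≤ B := by exact_mod_cast hB1
  have hcn : 1 ≤ c ^ n := one_le_pow₀ hc1.le
  have h1 : (t' : ℝ) ≤ K * (B : ℝ) ^ j := by
    exact_mod_cast ht'.trans (Nat.mul_le_mul_left _ (Nat.pow_le_pow_left hBB _))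
  have h2 : (graphSize I.graph : ℝ) ^ d ≤ (B : ℝ) ^ (2 * d) := by
    rw [pow_mul]
    have : graphSize I.graph ≤ B ^ 2 := by
      refine hsize.trans (Nat.pow_le_pow_left ?_ 2)
      rw [numVerts, hJ]
      nlinarith
    exact pow_le_pow_left₀ (by positivity) (by exact_mod_cast this) _
  have h3 : (2 : ℝ) ^ f I.pathWidth ≤ c ^ n * D := by
    have hp : ((I.pathWidth : ℝ)) ^ 2 ≤ 36 * n + (72 + 72 * (l : ℝ) ^ 2) := by
      exact_mod_cast pathWidth_sq_le l n hw
    have e : c ^ n = (2 : ℝ) ^ (Real.logb 2 c * n) := by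
      rw [Real.rpow_mul (by norm_num), Real.rpow_logb (by norm_num) (by norm_num) (by linarith),
        Real.rpow_natCast]
    rw [e, hD, ← Real.rpow_add (by norm_num)]
    refine Real.rpow_le_rpow_of_exponent_le (by norm_num) ((hK₀ _).trans ?_)
    have := mul_le_mul_of_nonneg_left hp (div_pos hlog (by norm_num : (0 : ℝ) < 36)).le
    linarith
  have h4 : (t : ℝ) ≤ |C| * (c ^ n * D) * (B : ℝ) ^ (2 * d) :=
    ht.trans (by gcongr; exact le_abs_self C)
  have h5 : (B : ℝ) ^ j ≤ c ^ n * (B : ℝ) ^ (j + 2 * d) :=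
    (pow_le_pow_right₀ hB1' (by omega)).trans (le_mul_of_one_le_left (by positivity) hcn)
  have h6 : (B : ℝ) ^ (2 * d) ≤ (B : ℝ) ^ (j + 2 * d) := pow_le_pow_right₀ hB1' (by omega)
  have h7 : (B : ℝ) ^ (j + 2 * d) =
      ((6 * l + 4 : ℕ) : ℝ) ^ (j + 2 * d) * (q : ℝ) ^ (j + 2 * d) := by
    rw [hB, Nat.cast_mul, mul_pow]
  calc ((t' + t : ℕ) : ℝ) ≤ K * (c ^ n * (B : ℝ) ^ (j + 2 * d)) +
        |C| * (c ^ n * D) * (B : ℝ) ^ (j + 2 * d) := by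
        rw [Nat.cast_add]
        exact add_le_add (h1.trans (by gcongr)) (h4.trans (by gcongr))
    _ = _ := by rw [h7]; ring

/-- On the instance of a formula both problems ask for the satisfiability of the formula. -/
theorem exists_instance_of_formula {l : ℕ} (hl : 5 ≤ l) (φ : CNF3) : ∃ I : Instance,
    (CycleVertexDeletion l I.graph I.k ↔ φ.Satisfiable) ∧
    (GirthVertexDeletion l I.graph I.k ↔ φ.Satisfiable) ∧
    I.pathWidth ≤ 3 * side φ.numVars + 6 * l ∧
    graphSize I.graph ≤ (numVerts l (side φ.numVars) φ.numVars φ.rawClauses + 1) ^ 2 ∧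
    I.encode = output l (template l (shortLen l)) (template l (longLen l)) φ.numVars
      φ.rawClauses := by
  have hS := lt_side_sq φ.numVars
  obtain ⟨I, hI, hw, henc⟩ := exists_instance hl hS φ.varsLt
  have hsat := φ.satisfiable_iff
  have h1 : φ.Satisfiable → GirthVertexDeletion l I.graph I.k := fun h => by
    obtain ⟨α, hα⟩ := hsat.1 h
    exact (hI fun _ G k => GirthVertexDeletion l G k).2
      (girthVertexDeletion_of_satisfies hl hS φ.varsLt φ.narrow hα)
  have h2 : GirthVertexDeletion l I.graph I.k → CycleVertexDeletion l I.graph I.k :=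
    fun ⟨X, hX, h⟩ => ⟨X, hX, fun v w hw e => h v w hw e.le⟩
  have h3 : CycleVertexDeletion l I.graph I.k → φ.Satisfiable := fun h =>
    hsat.2 (exists_satisfies_of_cycleVertexDeletion hl hS φ.varsLt φ.narrow
      ((hI fun _ G k => CycleVertexDeletion l G k).1 h))
  refine ⟨I, ⟨h3, h2 ∘ h1⟩, ⟨h3 ∘ h2, h1⟩, hw,
    (hI fun _ G _ => graphSize G ≤ _).2 (graphSize_le _), ?_⟩
  rw [henc, output, length_jobs, allBags_eq, length_jobs]
  rfl

end ETHLower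

theorem theorem3 (hETH : ETHLower.ETH) (l : ℕ) (hl : 5 ≤ l) :
    (¬ ETHLower.SolvableInTime
        (fun I => ETHLower.CycleVertexDeletion l I.graph I.k)) ∧
      (¬ ETHLower.SolvableInTime
        (fun I => ETHLower.GirthVertexDeletion l I.graph I.k)) := by
  refine ⟨ETHLower.not_solvableInTime hETH (l := l) fun φ => ?_,
    ETHLower.not_solvableInTime hETH (l := l) fun φ => ?_⟩
  · obtain ⟨I, h, -, h'⟩ := ETHLower.exists_instance_of_formula hl φ
    exact ⟨I, h, h'⟩
  · obtain ⟨I, -, h, h'⟩ := ETHLower.exists_instance_of_formula hl φ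
    exact ⟨I, h, h'⟩
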